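/- Let $n\ge 1$, $T>0$, $I=[0,T]$, and let $k,\ell,r,s\in\mathbb N$ satisfy $$r\ge\max\{k+1,\ell\},\qquad k\ge 2+\tfrac n2,\qquad s>\ell>n .$$ Let $f\in C^2(I\times\mathbb R^n\times\mathbb R\times\mathbb R^n)$ have compact support, let $\rho_0\in C^r_c(\mathbb R^n)$, and let $\rho\in C^{2,r}_c(I\times\mathbb R^n)$ (continuous time derivatives up to order 2, continuous space derivatives up to order $r$, and $\operatorname{supp}\rho(t,\cdot)$ contained in one compact set for all $t\in I$) be a solution of $$\partial_t\rho+f(t,x,\rho,\nabla\rho)=0\ \text{ on } I\times\mathbb R^n,\qquad \rho(0,\cdot)=\rho_0 .$$ Let $\zeta\in C^s(\mathbb R^n)\cap W_1^s(\mathbb R^n)$ be a compactly supported, even kernel of order $k$, i.e. $\zeta(-x)=\zeta(x)$, $\int\zeta=1$, $\int x^\alpha\zeta(x)\,dx=0$ for $1\le|\alpha|\le k-1$, and $\int|x|^k|\zeta(x)|\,dx<\infty$. Put $\zeta_\varepsilon(x)=\varepsilon^{-n}\zeta(x/\varepsilon)$. For $\varepsilon,h>0$ let the functions $\rho_i^{\varepsilon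 h}:I\to\mathbb R$, $i\in\mathbb Z^n$, solve the semi-discrete scheme $$\dot\rho_i^{\varepsilon h}(t)=-f\big(t,ih,[\rho^{\varepsilon h}](t,ih),\nabla[\rho^{\varepsilon h}](t,ih)\big),\qquad \rho_i^{\varepsilon h}(0)=\rho_0(ih),$$ where $$[\rho^{\varepsilon h}](t,x)=h^n\sum_{j\in\mathbb Z^n}\rho_j^{\varepsilon h}(t)\,\zeta_\varepsilon(x-jh).$$ Then there is a constant $C>0$, independent of $\varepsilon$ and $h$, such that for all $\varepsilon\ge h>0$ with $h\le\varepsilon^{1+(3+n/2)/\ell}$, all $\alpha\in\mathbb N_0^n$ with $|\alpha|\le 1$ and all $t\in[0,T]$, $$\big\|\partial^\alpha\rho(t,\cdot)-\partial^\alpha[\rho^{\varepsilon h}](t,\cdot)\big\|_{L_\infty(\mathbb R^n)}\le C\,\varepsilon^{-|\alpha|-n/2}\Big(\varepsilon^k+\frac{h^\ell}{\varepsilon^{\ell+1}}\Big).$$ If moreover $h\le\varepsilon^{1+(k+1)/\ell}$ (no further restriction when $k=2+n/2$), then the left-hand side is also at most $C\,\varepsilon^{k-|\alpha|-n/2}$.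 -/

import Mathlib

open MeasureTheory Set
open scoped ENNReal ContDiff

noncomputable section

namespace KernelScheme

/-- Euclidean space of dimension `n`. -/
abbrev Rn (n : ℕ) : Type := EuclideanSpace ℝ (Fin n)

/-- The order of a multi-index. -/
def order {n : ℕ} (α : Fin n → ℕ) : ℕ := ∑ i, α i

/-- The monomial with exponent `α`. -/
def monomial {n : ℕ} (α : Fin n → ℕ) (x : Rn n) : ℝ := ∏ i, x i ^ α i

/-- The classical partial derivative in the `i`-th coordinate direction. -/
def partialDeriv {n : ℕ} (i : Fin n) (u : Rn n → ℝ) : Rn n → ℝ :=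
  fun x => lineDeriv ℝ u x (EuclideanSpace.single i 1)

/-- The classical derivative with multi-index `α`: the partial derivative in the coordinate `i`
is applied `α i` times, for every `i`. -/
def multiDeriv {n : ℕ} (α : Fin n → ℕ) (u : Rn n → ℝ) : Rn n → ℝ :=
  (List.finRange n).foldr (fun i v => (partialDeriv i)^[α i] v) u

/-- `v` is the weak derivative of `u` with multi-index `α`. -/
structure HasWeakDeriv {n : ℕ} (α : Fin n → ℕ) (u v : Rn n → ℝ) : Prop where
  left : LocallyIntegrable u volume
  right : LocallyIntegrable v volume
  by_parts : ∀ φ : Rn n → ℝ, ContDiff ℝ ∞ φ → HasCompactSupport φ →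
    ∫ x, u x * multiDeriv α φ x = (-1) ^ order α * ∫ x, v x * φ x

/-- The Sobolev space of integrable functions whose weak derivatives up to order `s` are
integrable. -/
def MemW1 {n : ℕ} (s : ℕ) (u : Rn n → ℝ) : Prop :=
  Integrable u volume ∧
    ∀ α : Fin n → ℕ, order α ≤ s → ∃ v : Rn n → ℝ, Integrable v volume ∧ HasWeakDeriv α u v

/-- Kernels of order `k`. -/
structure IsKernel {n : ℕ} (k : ℕ) (ζ : Rn n → ℝ) : Prop where
  one_le_order : 1 ≤ k
  continuous : Continuous ζ
  bounded : ∃ B : ℝ, ∀ x, |ζ x| ≤ B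
  integrable : Integrable ζ volume
  integral_eq_one : ∫ x, ζ x = 1
  moments : ∀ α : Fin n → ℕ, 1 ≤ order α → order α ≤ k - 1 → ∫ x, monomial α x * ζ x = 0
  finite_moment : Integrable (fun x => ‖x‖ ^ k * |ζ x|) volume

/-- Compactly supported kernels of order `k` and smoothness `s`. -/
structure IsCompactKernel {n : ℕ} (k s : ℕ) (ζ : Rn n → ℝ) : Prop extends IsKernel k ζ where
  smooth : ContDiff ℝ s ζ
  sobolev : MemW1 s ζ
  compact_support : HasCompactSupport ζ

/-- Compactly supported functions on `[0,T] × ℝⁿ` that have continuous time derivatives up to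
order `q` and continuous space derivatives up to order `r`; continuity is joint in time and space,
and time derivatives at the end points are one-sided. -/
structure IsTimeSpaceCc {n : ℕ} (q r : ℕ) (T : ℝ) (ρ : ℝ → Rn n → ℝ) : Prop where
  time_smooth : ∀ x, ContDiffOn ℝ q (fun t => ρ t x) (Icc 0 T)
  space_smooth : ∀ t ∈ Icc 0 T, ContDiff ℝ r (ρ t)
  time_continuous : ∀ m ≤ q, ContinuousOn
    (fun z : ℝ × Rn n => iteratedDerivWithin m (fun t => ρ t z.2) (Icc 0 T) z.1)
    (Icc 0 T ×ˢ univ)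
  space_continuous : ∀ m ≤ r, ContinuousOn
    (fun z : ℝ × Rn n => iteratedFDeriv ℝ m (ρ z.1) z.2) (Icc 0 T ×ˢ univ)
  compact_support : ∃ Ω : Set (Rn n), IsCompact Ω ∧ ∀ t ∈ Icc 0 T, ∀ x ∉ Ω, ρ t x = 0

/-- `ρ` solves `∂ₜρ + f(t, x, ρ, ∇ρ) = 0` on `[0,T] × ℝⁿ` with `ρ(0, ·) = ρ₀`. -/
structure SolvesPDE {n : ℕ} (T : ℝ) (f : ℝ → Rn n → ℝ → Rn n → ℝ) (ρ₀ : Rn n → ℝ)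
    (ρ : ℝ → Rn n → ℝ) : Prop where
  initial : ∀ x, ρ 0 x = ρ₀ x
  equation : ∀ t ∈ Icc 0 T, ∀ x,
    derivWithin (fun τ => ρ τ x) (Icc 0 T) t + f t x (ρ t x) (gradient (ρ t) x) = 0

/-- The grid point `jh`. -/
def gridPoint {n : ℕ} (h : ℝ) (j : Fin n → ℤ) : Rn n := WithLp.toLp 2 fun i => (j i : ℝ) * h

/-- The scaled kernel `ζ_ε(x) = ε⁻ⁿ ζ(x / ε)`. -/
def scaledKernel {n : ℕ} (ζ : Rn n → ℝ) (ε : ℝ) (x : Rn n) : ℝ := (ε ^ n)⁻¹ * ζ (ε⁻¹ • x)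

/-- The function `x ↦ hⁿ ∑ⱼ cⱼ ζ_ε(x - jh)`. For a compactly supported `ζ` and positive `ε`, `h`
only finitely many terms of the series are nonzero at each `x`. -/
def quasiInterpolant {n : ℕ} (ζ : Rn n → ℝ) (ε h : ℝ) (c : (Fin n → ℤ) → ℝ) (x : Rn n) : ℝ :=
  h ^ n * ∑' j : Fin n → ℤ, c j * scaledKernel ζ ε (x - gridPoint h j)

/-- The family `c` of coefficient functions solves the semi-discrete scheme on `[0,T]`. -/
structure SolvesScheme {n : ℕ} (T : ℝ) (f : ℝ → Rn n → ℝ → Rn n → ℝ) (ρ₀ : Rn n → ℝ)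
    (ζ : Rn n → ℝ) (ε h : ℝ) (c : (Fin n → ℤ) → ℝ → ℝ) : Prop where
  initial : ∀ i, c i 0 = ρ₀ (gridPoint h i)
  equation : ∀ i, ∀ t ∈ Icc 0 T,
    HasDerivWithinAt (c i)
      (-f t (gridPoint h i)
        (quasiInterpolant ζ ε h (fun j => c j t) (gridPoint h i))
        (gradient (quasiInterpolant ζ ε h (fun j => c j t)) (gridPoint h i)))
      (Icc 0 T) t

end KernelScheme

end

/-! The error `e j = c j t - ρ t (gridPoint h j)` of the coefficients is estimated by an energy
method. Subtracting the PDE at the grid points from the scheme and expanding `f` to first order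
gives `e' = -(a U + b P + Q)`. Here `U = μ * e + U₀` and `P = κ * e + P₀` are the errors of value
and gradient, `μ` and `κ` are the samples of the scaled kernel and of its gradient, `U₀` and `P₀`
are consistency errors, and `Q` is quadratic in `(U, P)` (`errorEquation`).

Stability. Since `ζ` is even, `κ` is odd, so convolution with `κ` is skew-symmetric. Against the
Lipschitz coefficient `b` only a commutator remains: weights of total size `1 / ε` times a variation
of order `ε` of `b` over the stencil (`abs_tsum_mul_stencil_le`). The linear part therefore grows at
a rate independent of `ε` and `h`.

Nonlinearity. `Q` is harmless as long as `U` and `P` are `O(ε)` pointwise, and this is a bootstrap.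
The weights `κ` sum to zero, so `κ * e` is controlled, both in mean square and pointwise, by the
differences of `e`, that is by `diffEnergy`. While `diffEnergy + ε² ‖e‖² / N ≤ ε⁴`, where `N` is the
number of points of the larger stencil, this quantity satisfies a linear differential inequality,
because the differences of `e` solve an equation of the same structure. Gronwall's inequality keeps
it below the barrier if the consistency errors are small enough; a second Gronwall argument then
bounds `‖e‖² / N` (`exists_error_bound`).

Consistency. A sum over lattice translates is periodic, its mean over a cell is the integral, and a
periodic function is controlled by any one of its higher pure derivatives in each direction. This
gives quadrature errors of order `(h / ε) ^ l` (`exists_quadrature_bound`). Taylor expansion and the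
vanishing moments then give `ε ^ k + (h / ε) ^ l` at grid points for values and gradients
(`exists_kernelSum_bound`, `exists_gridError_bound`). Oddness removes a factor `1 / ε` from the
quadrature error of the gradient there.

Smallness. In mean square the consistency error is `ε ^ (-n/2) (ε ^ k + (h / ε) ^ l)`, and for `k =
2 + n/2` this only just fails to be small against `ε²`. What enters the barrier condition without an
extra power of `ε` is the error of the differences of `ρ`, and uniform continuity of the top
derivatives makes it smaller by any prescribed factor once `ε` is small
(`exists_sumSq_gridError_bound`, `energy_smallness`).

Conclusion. Cauchy-Schwarz over the active grid points turns the mean square bound into a uniform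
one, and consistency at arbitrary points is added (`exists_pointwise_bound_of_small`). When `ε` is
bounded from below, boundedness of `f` alone suffices, since the right-hand side is then bounded
below suitably (`exists_pointwise_bound`, `exists_rpow_lower_bound`). -/

noncomputable section

namespace KernelScheme

/-! ### Discrete calculus: square sums, differences and stencil operators -/

section DiscreteCalculus

variable {J : Type*}

/-- The square of the `ℓ²` norm of a grid function. -/
def sumSq {F : Type*} [NormedAddCommGroup F] (u : J → F) : ℝ := ∑' j, ‖u j‖ ^ 2

lemma summable_normSq {F : Type*} [NormedAddCommGroup F] {u : J → F} (hu : u.HasFiniteSupport) :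
    Summable fun j => ‖u j‖ ^ 2 :=
  summable_of_hasFiniteSupport (hu.subset fun j hj => by
    contrapose! hj; simp only [Function.mem_support, not_not] at hj ⊢; simp [hj])

lemma sumSq_nonneg {F : Type*} [NormedAddCommGroup F] (u : J → F) : 0 ≤ sumSq u :=
  tsum_nonneg fun _ => by positivity

lemma sumSq_le_mul {F G : Type*} [NormedAddCommGroup F] [NormedAddCommGroup G] {u : J → F}
    {w : J → G} {c : ℝ} (hw : w.HasFiniteSupport) (h : ∀ j, ‖u j‖ ≤ c * ‖w j‖) :
    sumSq u ≤ c ^ 2 * sumSq w := by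
  have hu : u.HasFiniteSupport := hw.subset fun j hj => by
    contrapose! hj
    simp only [Function.mem_support, not_not] at hj ⊢
    have := h j
    simpa [hj] using this
  unfold sumSq
  rw [← tsum_mul_left]
  refine Summable.tsum_le_tsum (fun j => ?_) (summable_normSq hu) ((summable_normSq hw).mul_left _)
  rw [← mul_pow]
  exact pow_le_pow_left₀ (norm_nonneg _) (h j) 2

lemma sumSq_add_le {F : Type*} [NormedAddCommGroup F] {u w : J → F} (hu : u.HasFiniteSupport)
    (hw : w.HasFiniteSupport) : sumSq (fun j => u j + w j) ≤ 2 * (sumSq u + sumSq w) := by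
  unfold sumSq
  rw [← Summable.tsum_add (summable_normSq hu) (summable_normSq hw), ← tsum_mul_left]
  have h : Function.HasFiniteSupport fun j => u j + w j := by fun_prop
  refine Summable.tsum_le_tsum (fun j => ?_) (summable_normSq h)
    (((summable_normSq hu).add (summable_normSq hw)).mul_left _)
  have := norm_add_le (u j) (w j)
  nlinarith [sq_nonneg (‖u j‖ - ‖w j‖), norm_nonneg (u j + w j)]

lemma sum_normSq_le_sumSq {F ι : Type*} [NormedAddCommGroup F] {u : J → F}
    (hu : u.HasFiniteSupport) (V : Finset ι) {g : ι → J} (hg : Set.InjOn g V) :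
    ∑ v ∈ V, ‖u (g v)‖ ^ 2 ≤ sumSq u := by
  classical
  rw [← Finset.sum_image (f := fun j => ‖u j‖ ^ 2) hg]
  exact (summable_normSq hu).sum_le_tsum _ fun _ _ => by positivity

variable [AddCommGroup J] {E : Type*} [NormedAddCommGroup E] [NormedSpace ℝ E]

/-- The difference of a grid function and its translate by `v`. -/
def shiftDiff {F : Type*} [AddGroup F] (v : J) (u : J → F) (j : J) : F := u (j + v) - u j

/-- Discrete convolution with weights `κ` on the stencil `V`. -/
def stencil (V : Finset J) (κ : J → E) (u : J → ℝ) (j : J) : E := ∑ v ∈ V, u (j - v) • κ v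

lemma hasFiniteSupport_add_right {F : Type*} [Zero F] {u : J → F} (hu : u.HasFiniteSupport)
    (v : J) : Function.HasFiniteSupport fun j => u (j + v) :=
  hu.fun_comp_of_injective (add_left_injective v)

lemma hasFiniteSupport_sub_right {F : Type*} [Zero F] {u : J → F} (hu : u.HasFiniteSupport)
    (v : J) : Function.HasFiniteSupport fun j => u (j - v) :=
  hu.fun_comp_of_injective sub_left_injective

lemma hasFiniteSupport_shiftDiff {F : Type*} [AddGroup F] {u : J → F} (hu : u.HasFiniteSupport)
    (v : J) : (shiftDiff v u).HasFiniteSupport := by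
  exact (hasFiniteSupport_add_right hu v).sub hu

lemma hasFiniteSupport_stencil (V : Finset J) (κ : J → E) {u : J → ℝ} (hu : u.HasFiniteSupport) :
    (stencil V κ u).HasFiniteSupport := by
  exact Function.HasFiniteSupport.sum
    (fun v => (hasFiniteSupport_sub_right hu v).smul_left fun _ => κ v) V

lemma tsum_add_right {F : Type*} [AddCommMonoid F] [TopologicalSpace F] (u : J → F) (v : J) :
    ∑' j, u (j + v) = ∑' j, u j :=
  (Equiv.addRight v).tsum_eq u

lemma tsum_sub_right {F : Type*} [AddCommMonoid F] [TopologicalSpace F] (u : J → F) (v : J) :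
    ∑' j, u (j - v) = ∑' j, u j :=
  (Equiv.subRight v).tsum_eq u

lemma sumSq_add_right {F : Type*} [NormedAddCommGroup F] (u : J → F) (v : J) :
    sumSq (fun j => u (j + v)) = sumSq u :=
  tsum_add_right (fun j => ‖u j‖ ^ 2) v

lemma sumSq_shiftDiff_le {F : Type*} [NormedAddCommGroup F] {u : J → F} (hu : u.HasFiniteSupport)
    (v : J) : sumSq (shiftDiff v u) ≤ 4 * sumSq u := by
  have h := sumSq_add_le (hasFiniteSupport_add_right hu v) (w := fun j => -u j) (by fun_prop)
  have h1 : sumSq (fun j => -u j) = sumSq u := by simp [sumSq]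
  rw [sumSq_add_right, h1] at h
  simp only [← sub_eq_add_neg] at h
  unfold shiftDiff
  linarith

lemma normSq_sum_smul_le {ι : Type*} {V : Finset ι} {κ : ι → E} {c : ℝ} (hκ : ∀ v ∈ V, ‖κ v‖ ≤ c)
    (r : ι → ℝ) : ‖∑ v ∈ V, r v • κ v‖ ^ 2 ≤ c ^ 2 * V.card * ∑ v ∈ V, r v ^ 2 := by
  have h1 : ‖∑ v ∈ V, r v • κ v‖ ≤ ∑ v ∈ V, c * |r v| := by
    refine (norm_sum_le _ _).trans (Finset.sum_le_sum fun v hv => ?_)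
    rw [norm_smul, mul_comm, Real.norm_eq_abs]
    exact mul_le_mul_of_nonneg_right (hκ v hv) (abs_nonneg _)
  have h2 := sq_sum_le_card_mul_sum_sq (s := V) (f := fun v => c * |r v|)
  calc _ ≤ (∑ v ∈ V, c * |r v|) ^ 2 := pow_le_pow_left₀ (norm_nonneg _) h1 2
    _ ≤ _ := h2
    _ = _ := by
      simp only [mul_pow, sq_abs, ← Finset.mul_sum]; ring

lemma sumSq_stencil_le {V : Finset J} {κ : J → E} {c : ℝ} (hκ : ∀ v ∈ V, ‖κ v‖ ≤ c) {u : J → ℝ}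
    (hu : u.HasFiniteSupport) : sumSq (stencil V κ u) ≤ (c * V.card) ^ 2 * sumSq u := by
  have hs : ∀ v ∈ V, Summable fun j => u (j - v) ^ 2 := fun v _ => by
    simpa using summable_normSq (hasFiniteSupport_sub_right hu v)
  calc sumSq (stencil V κ u) ≤ ∑' j, c ^ 2 * V.card * ∑ v ∈ V, u (j - v) ^ 2 :=
        Summable.tsum_le_tsum (fun j => normSq_sum_smul_le hκ _)
          (summable_normSq (hasFiniteSupport_stencil V κ hu)) ((summable_sum hs).mul_left _)
    _ = _ := by
      rw [tsum_mul_left, Summable.tsum_finsetSum hs]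
      simp_rw [tsum_sub_right (fun j => u j ^ 2)]
      simp [sumSq]; ring

lemma normSq_stencil_le {V : Finset J} {κ : J → E} {c : ℝ} (hκ : ∀ v ∈ V, ‖κ v‖ ≤ c) {u : J → ℝ}
    (hu : u.HasFiniteSupport) (j : J) :
    ‖stencil V κ u j‖ ^ 2 ≤ c ^ 2 * V.card * sumSq u := by
  refine (normSq_sum_smul_le hκ _).trans (mul_le_mul_of_nonneg_left ?_ (by positivity))
  simpa using sum_normSq_le_sumSq hu V (g := fun v => j - v) (sub_right_injective.injOn)

/-- Weights of sum zero annihilate constants, so any reference value may be subtracted. The choice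
of the reference `r` distinguishes the summed estimate from the pointwise one. -/
lemma stencil_eq_sub {V : Finset J} {κ : J → E} (h : ∑ v ∈ V, κ v = 0) (u : J → ℝ) (r : ℝ) (j : J) :
    stencil V κ u j = ∑ v ∈ V, (u (j - v) - r) • κ v := by
  simp only [sub_smul, Finset.sum_sub_distrib, ← Finset.smul_sum, h, smul_zero, sub_zero, stencil]

lemma sum_eq_zero_of_odd {V : Finset J} (hV : ∀ v ∈ V, -v ∈ V) {κ : J → E}
    (hodd : ∀ v, κ (-v) = -κ v) : ∑ v ∈ V, κ v = 0 := by
  have h : ∑ v ∈ V, κ v = ∑ v ∈ V, κ (-v) :=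
    Finset.sum_bij' (fun v _ => -v) (fun v _ => -v) hV hV (by simp) (by simp) (by simp)
  simp only [hodd, Finset.sum_neg_distrib] at h
  have h2 : (2 : ℝ) • ∑ v ∈ V, κ v = 0 := by
    rw [two_smul]; nth_rewrite 1 [h]; simp
  simpa using h2

/-- Subtracting the reference value `u j` turns every term into a difference of `u`; then
Cauchy-Schwarz applies. -/
lemma sumSq_stencil_le_shiftDiff {V W : Finset J} (hVW : ∀ v ∈ V, -v ∈ W) {κ : J → E} {c : ℝ}
    (hκ : ∀ v ∈ V, ‖κ v‖ ≤ c) (h0 : ∑ v ∈ V, κ v = 0) {u : J → ℝ} (hu : u.HasFiniteSupport) :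
    sumSq (stencil V κ u) ≤ c ^ 2 * V.card * ∑ w ∈ W, sumSq (shiftDiff w u) := by
  classical
  have hs : ∀ v ∈ V, Summable fun j => ‖shiftDiff (-v) u j‖ ^ 2 := fun v _ =>
    summable_normSq (hasFiniteSupport_shiftDiff hu _)
  calc sumSq (stencil V κ u)
      ≤ ∑' j, c ^ 2 * V.card * ∑ v ∈ V, ‖shiftDiff (-v) u j‖ ^ 2 := by
        refine Summable.tsum_le_tsum (fun j => ?_)
          (summable_normSq (hasFiniteSupport_stencil V κ hu)) ((summable_sum hs).mul_left _)
        rw [stencil_eq_sub h0 u (u j)]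
        simpa [shiftDiff, ← sub_eq_add_neg] using
          normSq_sum_smul_le hκ (fun v => u (j - v) - u j)
    _ = c ^ 2 * V.card * ∑ v ∈ V, sumSq (shiftDiff (-v) u) := by
      rw [tsum_mul_left, Summable.tsum_finsetSum hs]; rfl
    _ ≤ _ := by
      refine mul_le_mul_of_nonneg_left ?_ (by positivity)
      rw [← Finset.sum_image (f := fun w => sumSq (shiftDiff w u)) (neg_injective.injOn)]
      exact Finset.sum_le_sum_of_subset_of_nonneg
        (Finset.image_subset_iff.2 hVW) fun _ _ _ => sumSq_nonneg _

/-- Every `u (j - v')` with `v' ∈ V` can serve as reference value. Averaging the resulting bounds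
over `v'` turns pointwise differences into full square sums and cancels the factor `V.card` of
Cauchy-Schwarz. -/
lemma normSq_stencil_le_shiftDiff {V W : Finset J} (hV : V.Nonempty)
    (hVW : ∀ v ∈ V, ∀ v' ∈ V, v - v' ∈ W) {κ : J → E} {c : ℝ}
    (hκ : ∀ v ∈ V, ‖κ v‖ ≤ c) (h0 : ∑ v ∈ V, κ v = 0) {u : J → ℝ} (hu : u.HasFiniteSupport) (j : J) :
    ‖stencil V κ u j‖ ^ 2 ≤ c ^ 2 * ∑ w ∈ W, sumSq (shiftDiff w u) := by
  classical
  have hcard : (0 : ℝ) < V.card := by exact_mod_cast hV.card_pos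
  have h1 : ∀ v' ∈ V, ‖stencil V κ u j‖ ^ 2
      ≤ c ^ 2 * V.card * ∑ w ∈ W, ‖shiftDiff w u (j - v')‖ ^ 2 := fun v' hv' => by
    rw [stencil_eq_sub h0 u (u (j - v'))]
    refine (normSq_sum_smul_le hκ _).trans (mul_le_mul_of_nonneg_left ?_ (by positivity))
    calc ∑ v ∈ V, (u (j - v) - u (j - v')) ^ 2
        = ∑ v ∈ V, ‖shiftDiff (v' - v) u (j - v')‖ ^ 2 := by
          refine Finset.sum_congr rfl fun v _ => ?_
          rw [Real.norm_eq_abs, sq_abs, shiftDiff]; congr 3; abel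
      _ ≤ _ := by
        rw [← Finset.sum_image (f := fun w => ‖shiftDiff w u (j - v')‖ ^ 2)
          (g := fun v => v' - v) (sub_right_injective.injOn)]
        exact Finset.sum_le_sum_of_subset_of_nonneg
          (Finset.image_subset_iff.2 fun v hv => hVW v' hv' v hv) fun _ _ _ => by positivity
  have h2 := Finset.sum_le_sum h1
  rw [Finset.sum_const, nsmul_eq_mul, ← Finset.mul_sum, Finset.sum_comm] at h2
  -- For fixed `w` the base points `j - v'` are distinct, so the inner sum is part of one square
  -- sum.
  have h3 : ∑ w ∈ W, ∑ v' ∈ V, ‖shiftDiff w u (j - v')‖ ^ 2 ≤ ∑ w ∈ W, sumSq (shiftDiff w u) :=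
    Finset.sum_le_sum fun w _ => sum_normSq_le_sumSq (hasFiniteSupport_shiftDiff hu w) V
      (g := fun v => j - v) (sub_right_injective.injOn)
  have h4 : (V.card : ℝ) * ‖stencil V κ u j‖ ^ 2
      ≤ V.card * (c ^ 2 * ∑ w ∈ W, sumSq (shiftDiff w u)) := by
    refine h2.trans ?_
    rw [mul_comm (c ^ 2) (V.card : ℝ), mul_assoc]
    gcongr
  exact le_of_mul_le_mul_left h4 hcard

/-- Summation by parts: for odd weights, the stencil operator with Lipschitz coefficients is
almost skew-symmetric. -/
lemma abs_tsum_mul_stencil_le {V : Finset J} (hV : ∀ v ∈ V, -v ∈ V) {κ : J → E}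
    (hodd : ∀ v, κ (-v) = -κ v) {c β : ℝ} (hκ : ∀ v ∈ V, ‖κ v‖ ≤ c) (hβ : 0 ≤ β)
    {b : J → E →L[ℝ] ℝ}
    (hb : ∀ v ∈ V, ∀ j, ‖b (j + v) - b j‖ ≤ β) {u : J → ℝ} (hu : u.HasFiniteSupport) :
    2 * |∑' j, u j * b j (stencil V κ u j)| ≤ c * V.card * β * sumSq u := by
  have hfs : ∀ v, Function.HasFiniteSupport fun j => u j * u (j - v) := fun v => by fun_prop
  have hs : ∀ (v : J) (r : J → ℝ), Summable fun j => u j * u (j - v) * r j := fun v r =>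
    summable_of_hasFiniteSupport (by have := hfs v; fun_prop)
  have h1 : ∑' j, u j * b j (stencil V κ u j)
      = ∑ v ∈ V, ∑' j, u j * u (j - v) * b j (κ v) := by
    rw [← Summable.tsum_finsetSum fun v _ => hs v _]
    refine tsum_congr fun j => ?_
    simp [stencil, Finset.mul_sum, mul_assoc]
  -- The substitutions `v ↦ -v` and a translation in `j` exchange the two factors `u`; oddness of
  -- `κ` supplies the sign, and `b` is now evaluated at the other point.
  have h2 : ∑ v ∈ V, ∑' j, u j * u (j - v) * b j (κ v)
      = -∑ v ∈ V, ∑' j, u j * u (j - v) * b (j - v) (κ v) := by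
    rw [← Finset.sum_neg_distrib]
    refine Finset.sum_bij' (fun v _ => -v) (fun v _ => -v) hV hV (by simp) (by simp) fun v _ => ?_
    rw [← tsum_sub_right _ (-v), ← tsum_neg]
    refine tsum_congr fun j => ?_
    simp only [sub_neg_eq_add, hodd, map_neg, add_sub_cancel_right]
    ring
  -- Adding the two representations of the sum leaves only the variation of `b` along the stencil.
  have h3 : 2 * ∑' j, u j * b j (stencil V κ u j)
      = ∑ v ∈ V, ∑' j, u j * u (j - v) * ((b j - b (j - v)) (κ v)) := by
    rw [two_mul]
    nth_rewrite 2 [h1]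
    rw [h2, h1, ← sub_eq_add_neg, ← Finset.sum_sub_distrib]
    refine Finset.sum_congr rfl fun v _ => ?_
    rw [← Summable.tsum_sub (hs v _) (hs v _)]
    refine tsum_congr fun j => ?_
    simp; ring
  rw [show ∀ r : ℝ, 2 * |r| = |2 * r| from fun r => by rw [abs_mul, abs_two], h3]
  have h4 : ∀ v ∈ V, |∑' j, u j * u (j - v) * ((b j - b (j - v)) (κ v))| ≤ β * c * sumSq u := by
    intro v hv
    have hsu : Summable fun j => u j ^ 2 := by simpa using summable_normSq hu
    have hsv : Summable fun j => u (j - v) ^ 2 := by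
      simpa using summable_normSq (hasFiniteSupport_sub_right hu v)
    have hc : 0 ≤ c := (norm_nonneg _).trans (hκ v hv)
    calc |∑' j, u j * u (j - v) * ((b j - b (j - v)) (κ v))|
        ≤ ∑' j, β * c * ((u j ^ 2 + u (j - v) ^ 2) / 2) := by
          rw [← Real.norm_eq_abs]
          refine tsum_of_norm_bounded (g := fun j => β * c * ((u j ^ 2 + u (j - v) ^ 2) / 2))
            (((hsu.add hsv).div_const 2).mul_left _).hasSum fun j => ?_
          have hB : ‖(b j - b (j - v)) (κ v)‖ ≤ β * c := by
            refine (ContinuousLinearMap.le_opNorm _ _).trans ?_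
            have := hb v hv (j - v)
            rw [sub_add_cancel] at this
            gcongr
            exact hκ v hv
          have hU : ‖u j * u (j - v)‖ ≤ (u j ^ 2 + u (j - v) ^ 2) / 2 := by
            rw [norm_mul, Real.norm_eq_abs, Real.norm_eq_abs]
            nlinarith [sq_nonneg (|u j| - |u (j - v)|), sq_abs (u j), sq_abs (u (j - v))]
          rw [norm_mul, mul_comm]
          gcongr
      _ = _ := by
        rw [tsum_mul_left, tsum_div_const, Summable.tsum_add hsu hsv,
          tsum_sub_right (fun j => u j ^ 2)]
        simp [sumSq]
  calc _ ≤ ∑ v ∈ V, β * c * sumSq u := (Finset.abs_sum_le_sum_abs _ _).trans (Finset.sum_le_sum h4)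
    _ = _ := by simp; ring

/-- Energy estimate for `u' = -(b · K u + X)` with a skew-symmetric stencil operator `K`. -/
lemma energy_le {V : Finset J} (hV : ∀ v ∈ V, -v ∈ V) {κ : J → E}
    (hodd : ∀ v, κ (-v) = -κ v) {c β : ℝ} (hκ : ∀ v ∈ V, ‖κ v‖ ≤ c) (hβ : 0 ≤ β)
    {b : J → E →L[ℝ] ℝ}
    (hb : ∀ v ∈ V, ∀ j, ‖b (j + v) - b j‖ ≤ β) {u u' X : J → ℝ} (hu : u.HasFiniteSupport)
    (hX : X.HasFiniteSupport) (h : ∀ j, u' j = -(b j (stencil V κ u j) + X j)) :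
    2 * ∑' j, u j * u' j ≤ (c * V.card * β + 1) * sumSq u + sumSq X := by
  have h1 := abs_tsum_mul_stencil_le hV hodd hκ hβ hb hu
  have hs1 : Summable fun j => u j * b j (stencil V κ u j) :=
    summable_of_hasFiniteSupport (by fun_prop)
  have hs2 : Summable fun j => u j * X j := summable_of_hasFiniteSupport (by fun_prop)
  have h2 : ∑' j, u j * u' j = -∑' j, u j * b j (stencil V κ u j) - ∑' j, u j * X j := by
    rw [← tsum_neg, ← Summable.tsum_sub hs1.neg hs2]
    exact tsum_congr fun j => by rw [h]; ring
  have h3 : -(2 * ∑' j, u j * X j) ≤ sumSq u + sumSq X := by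
    rw [← tsum_mul_left, ← tsum_neg, sumSq, sumSq,
      ← Summable.tsum_add (summable_normSq hu) (summable_normSq hX)]
    refine Summable.tsum_le_tsum (fun j => ?_) (hs2.mul_left 2).neg
      ((summable_normSq hu).add (summable_normSq hX))
    simp only [Real.norm_eq_abs, sq_abs]
    nlinarith [sq_nonneg (u j + X j)]
  have h4 := neg_abs_le (∑' j, u j * b j (stencil V κ u j))
  rw [h2]
  nlinarith

end DiscreteCalculus

/-! ### Energy estimates for the error equation -/

section ErrorEnergy

variable {J : Type*}

lemma sumSq_le_mul_add {F G H : Type*} [NormedAddCommGroup F] [NormedAddCommGroup G]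
    [NormedAddCommGroup H] {q : J → F} {u : J → G} {w : J → H} {c : ℝ}
    (hq : q.HasFiniteSupport) (hu : u.HasFiniteSupport) (hw : w.HasFiniteSupport)
    (h : ∀ j, ‖q j‖ ^ 2 ≤ c * (‖u j‖ ^ 2 + ‖w j‖ ^ 2)) :
    sumSq q ≤ c * (sumSq u + sumSq w) := by
  unfold sumSq
  rw [← Summable.tsum_add (summable_normSq hu) (summable_normSq hw), ← tsum_mul_left]
  exact Summable.tsum_le_tsum h (summable_normSq hq)
    (((summable_normSq hu).add (summable_normSq hw)).mul_left _)

lemma sumSq_coeff_mul_le {c K' : ℝ} {m : J → ℝ} (hm : m.HasFiniteSupport) {a' : J → ℝ}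
    (ha : ∀ j, ‖a' j‖ ≤ K') (hc : K' ^ 2 = c) : sumSq (fun j => a' j * m j) ≤ c * sumSq m := by
  rw [← hc]
  exact sumSq_le_mul hm fun j => by rw [norm_mul]; exact mul_le_mul_of_nonneg_right (ha j) (norm_nonneg _)

lemma sumSq_coeff_apply_le {c K' : ℝ} {E : Type*} [NormedAddCommGroup E] [NormedSpace ℝ E] {m : J → E} (hm : m.HasFiniteSupport) {a' : J → E →L[ℝ] ℝ}
    (ha : ∀ j, ‖a' j‖ ≤ K') (hc : K' ^ 2 = c) : sumSq (fun j => a' j (m j)) ≤ c * sumSq m := by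
  rw [← hc]
  exact sumSq_le_mul hm fun j => (a' j).le_of_opNorm_le (ha j) _

lemma hasFiniteSupport_apply {E : Type*} [NormedAddCommGroup E] [NormedSpace ℝ E] {m : J → E}
    (c : J → E →L[ℝ] ℝ) (hm : m.HasFiniteSupport) :
    Function.HasFiniteSupport fun j => c j (m j) :=
  hm.subset fun j hj => by
    contrapose! hj
    simp only [Function.mem_support, not_not] at hj ⊢
    rw [hj, map_zero]

variable [AddCommGroup J] {E : Type*} [NormedAddCommGroup E] [NormedSpace ℝ E]

/-- Stencil weights `μ` of size `1 / N` and odd stencil weights `κ` of size `1 / (N ε)`, where `N`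
is the cardinality of the larger stencil `W`. -/
structure IsStencilPair (V W : Finset J) (ε K : ℝ) (μ : J → ℝ) (κ : J → E) : Prop where
  one_le : 1 ≤ K
  eps_pos : 0 < ε
  eps_le_one : ε ≤ 1
  zero_mem : 0 ∈ V
  neg_mem : ∀ v ∈ V, -v ∈ V
  sub_mem : ∀ v ∈ V, ∀ v' ∈ V, v - v' ∈ W
  mu_le : ∀ v ∈ V, ‖μ v‖ ≤ K / W.card
  kappa_le : ∀ v ∈ V, ‖κ v‖ ≤ K / (W.card * ε)
  odd : ∀ v, κ (-v) = -κ v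

/-- The equation `e' = -(a U + b P + Q)` with `U = μ * e + U₀`, `P = κ * e + P₀` and a quadratic
remainder `Q`. -/
structure ErrorEquation (V W : Finset J) (ε K : ℝ) (μ : J → ℝ) (κ : J → E) (e e' a : J → ℝ)
    (b : J → E →L[ℝ] ℝ) (Q U₀ : J → ℝ) (P₀ : J → E) : Prop where
  e_fin : e.HasFiniteSupport
  Q_fin : Q.HasFiniteSupport
  U_fin : U₀.HasFiniteSupport
  P_fin : P₀.HasFiniteSupport
  a_le : ∀ j, ‖a j‖ ≤ K
  b_le : ∀ j, ‖b j‖ ≤ K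
  a_lip : ∀ w ∈ W, ∀ j, ‖a (j + w) - a j‖ ≤ K * ε
  b_lip : ∀ w ∈ W, ∀ j, ‖b (j + w) - b j‖ ≤ K * ε
  Q_le : ∀ j, |Q j| ≤ K * ((stencil V μ e j + U₀ j) ^ 2 + ‖stencil V κ e j + P₀ j‖ ^ 2)
  U_le : ∀ j, |U₀ j| ≤ K * ε
  P_le : ∀ j, ‖P₀ j‖ ≤ K * ε
  eq : ∀ j, e' j = -(a j * (stencil V μ e j + U₀ j) + b j (stencil V κ e j + P₀ j) + Q j)

/-- The mean over the stencil of the squared differences. -/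
def diffEnergy (W : Finset J) (e : J → ℝ) : ℝ := (∑ w ∈ W, sumSq (shiftDiff w e)) / (W.card : ℝ) ^ 2

lemma diffEnergy_nonneg (W : Finset J) (e : J → ℝ) : 0 ≤ diffEnergy W e :=
  div_nonneg (Finset.sum_nonneg fun _ _ => sumSq_nonneg _) (by positivity)

lemma stencil_sub (V : Finset J) (κ : J → E) (u w : J → ℝ) (j : J) :
    stencil V κ (fun j => u j - w j) j = stencil V κ u j - stencil V κ w j := by
  simp [stencil, sub_smul]

lemma stencil_shiftDiff (V : Finset J) (κ : J → E) (u : J → ℝ) (w j : J) :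
    stencil V κ (shiftDiff w u) j = stencil V κ u (j + w) - stencil V κ u j := by
  simp only [stencil, shiftDiff, sub_smul, Finset.sum_sub_distrib]
  congr 1
  exact Finset.sum_congr rfl fun v _ => by rw [sub_add_eq_add_sub]

namespace IsStencilPair

variable {V W : Finset J} {ε K : ℝ} {μ : J → ℝ} {κ : J → E}

set_option linter.unusedSectionVars false in
lemma subset (h : IsStencilPair V W ε K μ κ) : V ⊆ W := fun v hv => by
  simpa using h.sub_mem v hv 0 h.zero_mem

lemma card_pos (h : IsStencilPair V W ε K μ κ) : (0 : ℝ) < W.card := by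
  exact_mod_cast Finset.card_pos.2 ⟨0, h.subset h.zero_mem⟩

lemma card_le (h : IsStencilPair V W ε K μ κ) : (V.card : ℝ) ≤ W.card := by
  exact_mod_cast Finset.card_le_card h.subset

lemma sumSq_mu_le (h : IsStencilPair V W ε K μ κ) {u : J → ℝ} (hu : u.HasFiniteSupport) :
    sumSq (stencil V μ u) ≤ K ^ 2 * sumSq u := by
  have hN := h.card_pos
  have hK := h.one_le
  refine (sumSq_stencil_le h.mu_le hu).trans (mul_le_mul_of_nonneg_right ?_ (sumSq_nonneg _))
  gcongr
  calc K / W.card * V.card ≤ K / W.card * W.card := by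
        have := h.card_le; gcongr
    _ = K := by field_simp

lemma normSq_mu_le (h : IsStencilPair V W ε K μ κ) {u : J → ℝ} (hu : u.HasFiniteSupport) (j : J) :
    ‖stencil V μ u j‖ ^ 2 ≤ K ^ 2 * (sumSq u / W.card) := by
  have hN := h.card_pos
  refine (normSq_stencil_le h.mu_le hu j).trans ?_
  calc (K / W.card) ^ 2 * V.card * sumSq u ≤ (K / W.card) ^ 2 * W.card * sumSq u := by
        have := h.card_le; have := sumSq_nonneg u; gcongr
    _ = _ := by field_simp

/-- The weights are of size `1 / (N ε)`; the factor `ε ^ 2` absorbs the loss of one derivative. The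
same balance appears in the pointwise version. -/
lemma sumSq_kappa_le (h : IsStencilPair V W ε K μ κ) {u : J → ℝ} (hu : u.HasFiniteSupport) :
    ε ^ 2 * sumSq (stencil V κ u) ≤ W.card * (K ^ 2 * diffEnergy W u) := by
  have hN := h.card_pos
  have he := h.eps_pos
  have h1 := sumSq_stencil_le_shiftDiff (fun v hv => h.subset (h.neg_mem v hv)) h.kappa_le
    (sum_eq_zero_of_odd h.neg_mem h.odd) hu
  have h0 : 0 ≤ ∑ w ∈ W, sumSq (shiftDiff w u) := Finset.sum_nonneg fun _ _ => sumSq_nonneg _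
  calc ε ^ 2 * sumSq (stencil V κ u)
      ≤ ε ^ 2 * ((K / (W.card * ε)) ^ 2 * W.card * ∑ w ∈ W, sumSq (shiftDiff w u)) := by
        refine mul_le_mul_of_nonneg_left (h1.trans ?_) (by positivity)
        have := h.card_le; gcongr
    _ = _ := by unfold diffEnergy; field_simp

lemma normSq_kappa_le (h : IsStencilPair V W ε K μ κ) {u : J → ℝ} (hu : u.HasFiniteSupport)
    (j : J) : ε ^ 2 * ‖stencil V κ u j‖ ^ 2 ≤ K ^ 2 * diffEnergy W u := by
  have hN := h.card_pos
  have he := h.eps_pos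
  have h1 := normSq_stencil_le_shiftDiff ⟨0, h.zero_mem⟩ h.sub_mem h.kappa_le
    (sum_eq_zero_of_odd h.neg_mem h.odd) hu j
  calc ε ^ 2 * ‖stencil V κ u j‖ ^ 2
      ≤ ε ^ 2 * ((K / (W.card * ε)) ^ 2 * ∑ w ∈ W, sumSq (shiftDiff w u)) := by gcongr
    _ = _ := by unfold diffEnergy; field_simp

/-- The total size `K / ε` of the weights cancels against the variation `K * ε` of `b`, which leaves
a growth rate free of `ε`. -/
lemma energy_le (h : IsStencilPair V W ε K μ κ) {b : J → E →L[ℝ] ℝ}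
    (hb : ∀ w ∈ W, ∀ j, ‖b (j + w) - b j‖ ≤ K * ε) {u u' X : J → ℝ} (hu : u.HasFiniteSupport)
    (hX : X.HasFiniteSupport) (he : ∀ j, u' j = -(b j (stencil V κ u j) + X j)) :
    2 * ∑' j, u j * u' j ≤ 2 * K ^ 2 * sumSq u + sumSq X := by
  have hN := h.card_pos
  have hε := h.eps_pos
  have hK := h.one_le
  have h1 := KernelScheme.energy_le h.neg_mem h.odd h.kappa_le (β := K * ε) (by positivity)
    (fun v hv => hb v (h.subset hv)) hu hX he
  have h2 : K / (W.card * ε) * V.card * (K * ε) ≤ K ^ 2 := by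
    calc K / (W.card * ε) * V.card * (K * ε) ≤ K / (W.card * ε) * W.card * (K * ε) := by
          have := h.card_le; gcongr
      _ = _ := by field_simp
  have h3 : K / (W.card * ε) * V.card * (K * ε) + 1 ≤ 2 * K ^ 2 := by
    have := one_le_pow₀ hK (n := 2)
    linarith
  have h4 := mul_le_mul_of_nonneg_right h3 (sumSq_nonneg u)
  linarith

end IsStencilPair

namespace ErrorEquation

variable {V W : Finset J} {ε K : ℝ} {μ : J → ℝ} {κ : J → E} {e e' a : J → ℝ}
    {b : J → E →L[ℝ] ℝ} {Q U₀ : J → ℝ} {P₀ : J → E}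

lemma U_fin' (h : ErrorEquation V W ε K μ κ e e' a b Q U₀ P₀) :
    Function.HasFiniteSupport fun j => stencil V μ e j + U₀ j :=
  (hasFiniteSupport_stencil V μ h.e_fin).add h.U_fin

lemma P_fin' (h : ErrorEquation V W ε K μ κ e e' a b Q U₀ P₀) :
    Function.HasFiniteSupport fun j => stencil V κ e j + P₀ j :=
  (hasFiniteSupport_stencil V κ h.e_fin).add h.P_fin

lemma sumSq_U_le (h : ErrorEquation V W ε K μ κ e e' a b Q U₀ P₀)
    (hs : IsStencilPair V W ε K μ κ) :
    sumSq (fun j => stencil V μ e j + U₀ j) ≤ 2 * (K ^ 2 * sumSq e + sumSq U₀) := by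
  have h1 := sumSq_add_le (hasFiniteSupport_stencil V μ h.e_fin) h.U_fin
  have h2 := hs.sumSq_mu_le h.e_fin
  linarith

lemma sumSq_P_le (h : ErrorEquation V W ε K μ κ e e' a b Q U₀ P₀)
    (hs : IsStencilPair V W ε K μ κ) :
    ε ^ 2 * sumSq (fun j => stencil V κ e j + P₀ j)
      ≤ 2 * (W.card * (K ^ 2 * diffEnergy W e) + ε ^ 2 * sumSq P₀) := by
  have h1 := sumSq_add_le (hasFiniteSupport_stencil V κ h.e_fin) h.P_fin
  have h2 := hs.sumSq_kappa_le h.e_fin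
  have h3 := mul_le_mul_of_nonneg_left h1 (sq_nonneg ε)
  linarith

/-- The hypothesis `hG` is the barrier of the bootstrap; it gives `sumSq e / N ≤ ε ^ 2`. -/
lemma normSq_U_le (h : ErrorEquation V W ε K μ κ e e' a b Q U₀ P₀)
    (hs : IsStencilPair V W ε K μ κ)
    (hG : diffEnergy W e + ε ^ 2 * (sumSq e / W.card) ≤ ε ^ 4) (j : J) :
    ‖stencil V μ e j + U₀ j‖ ^ 2 ≤ 4 * K ^ 2 * ε ^ 2 := by
  have hε := hs.eps_pos
  have h1 := hs.normSq_mu_le h.e_fin j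
  have h2 : sumSq e / W.card ≤ ε ^ 2 := by
    have := diffEnergy_nonneg W e
    have h3 : ε ^ 2 * (sumSq e / W.card) ≤ ε ^ 2 * ε ^ 2 := by nlinarith
    exact le_of_mul_le_mul_left h3 (by positivity)
  have h3 : ‖U₀ j‖ ^ 2 ≤ (K * ε) ^ 2 := pow_le_pow_left₀ (norm_nonneg _) (h.U_le j) 2
  have h4 := norm_add_le (stencil V μ e j) (U₀ j)
  have h5 : K ^ 2 * (sumSq e / W.card) ≤ K ^ 2 * ε ^ 2 := by gcongr
  have h6 := pow_le_pow_left₀ (norm_nonneg _) h4 2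
  nlinarith [sq_nonneg (‖stencil V μ e j‖ - ‖U₀ j‖)]

/-- Here the full power `ε ^ 4` of the barrier is needed: one factor `ε ^ 2` is spent on the size of
`κ`. -/
lemma normSq_P_le (h : ErrorEquation V W ε K μ κ e e' a b Q U₀ P₀)
    (hs : IsStencilPair V W ε K μ κ)
    (hG : diffEnergy W e + ε ^ 2 * (sumSq e / W.card) ≤ ε ^ 4) (j : J) :
    ‖stencil V κ e j + P₀ j‖ ^ 2 ≤ 4 * K ^ 2 * ε ^ 2 := by
  have hε := hs.eps_pos
  have h1 := hs.normSq_kappa_le h.e_fin j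
  have h2 : diffEnergy W e ≤ ε ^ 4 := by
    have : 0 ≤ ε ^ 2 * (sumSq e / W.card) := by have := sumSq_nonneg e; positivity
    linarith
  have h3 : ‖P₀ j‖ ^ 2 ≤ (K * ε) ^ 2 := pow_le_pow_left₀ (norm_nonneg _) (h.P_le j) 2
  have h4 := norm_add_le (stencil V κ e j) (P₀ j)
  have h5 : ‖stencil V κ e j‖ ^ 2 ≤ K ^ 2 * ε ^ 2 := by
    refine le_of_mul_le_mul_left (h1.trans ?_) (show 0 < ε ^ 2 by positivity)
    calc K ^ 2 * diffEnergy W e ≤ K ^ 2 * ε ^ 4 := by gcongr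
      _ = _ := by ring
  have h6 := pow_le_pow_left₀ (norm_nonneg _) h4 2
  nlinarith [sq_nonneg (‖stencil V κ e j‖ - ‖P₀ j‖)]

/-- Below the barrier one of the two quadratic factors of `Q ^ 2` is `O(ε ^ 2)`. That is exactly the
factor needed to bound the remaining square sum of `P` by `diffEnergy`. -/
lemma sumSq_Q_le (h : ErrorEquation V W ε K μ κ e e' a b Q U₀ P₀)
    (hs : IsStencilPair V W ε K μ κ)
    (hG : diffEnergy W e + ε ^ 2 * (sumSq e / W.card) ≤ ε ^ 4) {d : ℝ}
    (hd : sumSq U₀ + sumSq P₀ ≤ W.card * d) :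
    sumSq Q ≤ W.card * (16 * K ^ 6 *
      (diffEnergy W e + ε ^ 2 * (sumSq e / W.card) + ε ^ 2 * d)) := by
  have hε := hs.eps_pos
  have hK := hs.one_le
  have hN := hs.card_pos
  have h1 : sumSq Q ≤ 8 * K ^ 4 * ε ^ 2 * (sumSq (fun j => stencil V μ e j + U₀ j)
      + sumSq (fun j => stencil V κ e j + P₀ j)) := by
    refine sumSq_le_mul_add h.Q_fin h.U_fin' h.P_fin' fun j => ?_
    have hU := h.normSq_U_le hs hG j
    have hP := h.normSq_P_le hs hG j
    have hQ := pow_le_pow_left₀ (abs_nonneg _) (h.Q_le j) 2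
    rw [Real.norm_eq_abs]
    have h0 : (stencil V μ e j + U₀ j) ^ 2 = ‖stencil V μ e j + U₀ j‖ ^ 2 := by
      rw [Real.norm_eq_abs, sq_abs]
    rw [h0] at hQ
    set p := ‖stencil V μ e j + U₀ j‖ ^ 2
    set q := ‖stencil V κ e j + P₀ j‖ ^ 2
    have hp : 0 ≤ p := by positivity
    have hq : 0 ≤ q := by positivity
    calc |Q j| ^ 2 ≤ K ^ 2 * (p + q) * (p + q) := by linarith
      _ ≤ K ^ 2 * (4 * K ^ 2 * ε ^ 2 + 4 * K ^ 2 * ε ^ 2) * (p + q) := by gcongr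
      _ = _ := by ring
  have hU := h.sumSq_U_le hs
  have hP := h.sumSq_P_le hs
  have h2 : sumSq e = W.card * (sumSq e / W.card) := by field_simp
  set y := sumSq e / W.card
  have hy : 0 ≤ y := div_nonneg (sumSq_nonneg _) hN.le
  have hK2 : 1 ≤ K ^ 2 := one_le_pow₀ hK
  have hd0 : 0 ≤ W.card * d := by
    have := sumSq_nonneg U₀; have := sumSq_nonneg P₀; linarith
  calc sumSq Q ≤ 8 * K ^ 4 * (ε ^ 2 * sumSq (fun j => stencil V μ e j + U₀ j)
      + ε ^ 2 * sumSq (fun j => stencil V κ e j + P₀ j)) := by linarith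
    _ ≤ 8 * K ^ 4 * (ε ^ 2 * (2 * (K ^ 2 * sumSq e + sumSq U₀))
      + 2 * (W.card * (K ^ 2 * diffEnergy W e) + ε ^ 2 * sumSq P₀)) := by gcongr
    _ = 16 * K ^ 6 * (W.card * (diffEnergy W e + ε ^ 2 * y))
        + 16 * K ^ 4 * ε ^ 2 * (sumSq U₀ + sumSq P₀) := by rw [h2]; ring
    _ ≤ 16 * K ^ 6 * (W.card * (diffEnergy W e + ε ^ 2 * y))
        + 16 * K ^ 6 * ε ^ 2 * (W.card * d) := by
      gcongr
      · exact add_nonneg (sumSq_nonneg _) (sumSq_nonneg _)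
      · norm_num
    _ = _ := by ring

/-- Only the term `b (κ * e)` needs skew-symmetry. Everything else is treated as a source and
estimated in square sum. -/
lemma energy_le (h : ErrorEquation V W ε K μ κ e e' a b Q U₀ P₀)
    (hs : IsStencilPair V W ε K μ κ)
    (hG : diffEnergy W e + ε ^ 2 * (sumSq e / W.card) ≤ ε ^ 4) {d : ℝ}
    (hd : sumSq U₀ + sumSq P₀ ≤ W.card * d) :
    2 * ∑' j, e j * e' j
      ≤ W.card * (100 * K ^ 6 * (diffEnergy W e + sumSq e / W.card + d)) := by
  have hε := hs.eps_pos
  have hε1 := hs.eps_le_one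
  have hK := hs.one_le
  have hN := hs.card_pos
  have hUf := h.U_fin'
  have hPf := h.P_fin
  have hQf := h.Q_fin
  have f1 : Function.HasFiniteSupport fun j => a j * (stencil V μ e j + U₀ j) := hUf.mul_right a
  have f2 := hasFiniteSupport_apply b hPf
  have h1 := hs.energy_le h.b_lip h.e_fin
    (X := fun j => a j * (stencil V μ e j + U₀ j) + (b j (P₀ j) + Q j))
    (f1.add (f2.add hQf)) (u' := e') fun j => by rw [h.eq, map_add]; ring
  have h2 := sumSq_add_le f1 (f2.add hQf)
  have h3 := sumSq_add_le f2 hQf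
  have h4 := sumSq_coeff_mul_le hUf h.a_le rfl
  have h5 := sumSq_coeff_apply_le hPf h.b_le rfl
  have h6 := h.sumSq_Q_le hs hG hd
  have h7 := h.sumSq_U_le hs
  have e1 : sumSq e = W.card * (sumSq e / W.card) := by field_simp
  set y := sumSq e / W.card
  set w := diffEnergy W e
  have hw : 0 ≤ w := diffEnergy_nonneg W e
  have hy : 0 ≤ y := div_nonneg (sumSq_nonneg _) hN.le
  have u0 := sumSq_nonneg U₀
  have p0 := sumSq_nonneg P₀
  have hd0 : 0 ≤ d := nonneg_of_mul_nonneg_right (by linarith : 0 ≤ (W.card : ℝ) * d) hN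
  have h8 : 2 * ∑' j, e j * e' j ≤ 2 * K ^ 2 * sumSq e
      + 2 * (K ^ 2 * (2 * (K ^ 2 * sumSq e + sumSq U₀)) + 2 * (K ^ 2 * sumSq P₀
        + W.card * (16 * K ^ 6 * (w + ε ^ 2 * y + ε ^ 2 * d)))) := by
    have := mul_le_mul_of_nonneg_left h7 (sq_nonneg K)
    simp only [Pi.add_def] at h1 h2 h3
    linarith
  refine h8.trans ?_
  have k2 : K ^ 2 ≤ K ^ 6 := pow_le_pow_right₀ hK (by norm_num)
  have k4 : K ^ 4 ≤ K ^ 6 := pow_le_pow_right₀ hK (by norm_num)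
  have e2 : ε ^ 2 ≤ 1 := pow_le_one₀ hε.le hε1
  rw [e1]
  clear_value y w
  clear h8 h7 h6 h5 h4 h3 h2 h1 hG e1
  calc _ = (W.card : ℝ) * ((2 * K ^ 2 + 4 * K ^ 4) * y) + 4 * K ^ 2 * (sumSq U₀ + sumSq P₀)
        + W.card * (64 * K ^ 6 * (w + ε ^ 2 * y + ε ^ 2 * d)) := by ring
    _ ≤ W.card * ((2 * K ^ 6 + 4 * K ^ 6) * y) + 4 * K ^ 6 * (W.card * d)
        + W.card * (64 * K ^ 6 * (w + 1 * y + 1 * d)) := by gcongr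
    _ = W.card * (K ^ 6 * (64 * w + 70 * y + 68 * d)) := by ring
    _ ≤ W.card * (K ^ 6 * (100 * w + 100 * y + 100 * d)) := by gcongr <;> norm_num
    _ = _ := by ring

/-- Translation differences commute with convolution, so `shiftDiff w e` solves an equation with the
same skew-symmetric principal part. The discrete product rule adds terms with differences of `a` and
`b`; these are `O(ε)`, which pays for the size of `P`. -/
lemma diff_energy_le_aux (h : ErrorEquation V W ε K μ κ e e' a b Q U₀ P₀)
    (hs : IsStencilPair V W ε K μ κ)
    (hG : diffEnergy W e + ε ^ 2 * (sumSq e / W.card) ≤ ε ^ 4) {d η : ℝ}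
    (hd : sumSq U₀ + sumSq P₀ ≤ W.card * d) {w : J} (hw : w ∈ W)
    (hη : sumSq (shiftDiff w U₀) + sumSq (shiftDiff w P₀) ≤ W.card * η) :
    2 * ∑' j, shiftDiff w e j * shiftDiff w e' j
      ≤ 10 * K ^ 6 * sumSq (shiftDiff w e) + W.card * (K ^ 6 * (600 *
        (diffEnergy W e + ε ^ 2 * (sumSq e / W.card) + ε ^ 2 * d + η))) := by
  have hε := hs.eps_pos
  have hε1 := hs.eps_le_one
  have hK := hs.one_le
  have hN := hs.card_pos
  set u := shiftDiff w e with hu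
  have fu : u.HasFiniteSupport := hasFiniteSupport_shiftDiff h.e_fin w
  have fM := hasFiniteSupport_stencil V μ fu
  have fU := hasFiniteSupport_shiftDiff h.U_fin w
  have fP := hasFiniteSupport_shiftDiff h.P_fin w
  have fQ := hasFiniteSupport_shiftDiff h.Q_fin w
  have fUw := hasFiniteSupport_add_right h.U_fin' w
  have fPw := hasFiniteSupport_add_right h.P_fin' w
  have f1 : Function.HasFiniteSupport fun j => a j * stencil V μ u j := fM.mul_right a
  have f2 : Function.HasFiniteSupport fun j => a j * shiftDiff w U₀ j := fU.mul_right a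
  have f3 : Function.HasFiniteSupport fun j => b j (shiftDiff w P₀ j) := hasFiniteSupport_apply b fP
  have f5 : Function.HasFiniteSupport fun j =>
    (shiftDiff w a j) * (stencil V μ e (j + w) + U₀ (j + w)) := fUw.mul_right _
  have f6 : Function.HasFiniteSupport fun j =>
    (shiftDiff w b j) (stencil V κ e (j + w) + P₀ (j + w)) :=
    hasFiniteSupport_apply _ fPw
  have h1 := hs.energy_le h.b_lip fu
    (X := fun j => (((a j * stencil V μ u j) + (a j * shiftDiff w U₀ j))
      + ((b j (shiftDiff w P₀ j)) + shiftDiff w Q j))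
      + ((shiftDiff w a j) * (stencil V μ e (j + w) + U₀ (j + w))
        + (shiftDiff w b j) (stencil V κ e (j + w) + P₀ (j + w))))
    (((f1.add f2).add (f3.add fQ)).add (f5.add f6)) (u' := shiftDiff w e') fun j => by
      have s1 := stencil_shiftDiff V κ e w j
      have s2 := stencil_shiftDiff V μ e w j
      rw [← hu] at s1 s2
      simp only [s1, s2, shiftDiff, h.eq, map_add, map_sub, _root_.sub_apply]
      ring
  have t1 := sumSq_add_le ((f1.add f2).add (f3.add fQ)) (f5.add f6)
  have t2 := sumSq_add_le (f1.add f2) (f3.add fQ)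
  have t3 := sumSq_add_le f1 f2
  have t4 := sumSq_add_le f3 fQ
  have t5 := sumSq_add_le f5 f6
  have b1 := sumSq_coeff_mul_le fM h.a_le rfl
  have b1' := hs.sumSq_mu_le fu
  have b2 := sumSq_coeff_mul_le fU h.a_le rfl
  have b3 := sumSq_coeff_apply_le fP h.b_le rfl
  -- No cancellation is used in the differences of `Q`: the bound on `Q` itself is already strong
  -- enough.
  have b4 := sumSq_shiftDiff_le h.Q_fin w
  have b4' := h.sumSq_Q_le hs hG hd
  have b5 := sumSq_coeff_mul_le fUw (h.a_lip w hw) rfl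
  have b6 := sumSq_coeff_apply_le fPw (h.b_lip w hw) rfl
  rw [sumSq_add_right (fun j => stencil V μ e j + U₀ j)] at b5
  rw [sumSq_add_right (fun j => stencil V κ e j + P₀ j)] at b6
  have b5' := mul_le_mul_of_nonneg_left (h.sumSq_U_le hs) (sq_nonneg (K * ε))
  have b6' := mul_le_mul_of_nonneg_left (h.sumSq_P_le hs) (sq_nonneg K)
  have b1'' := mul_le_mul_of_nonneg_left b1' (sq_nonneg K)
  simp only [Pi.add_def] at h1 t1 t2 t3 t4 t5
  change sumSq (fun j => shiftDiff w a j * (stencil V μ e (j + w) + U₀ (j + w))) ≤ _ at b5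
  change sumSq (fun j => (shiftDiff w b j) (stencil V κ e (j + w) + P₀ (j + w))) ≤ _ at b6
  have e1 : sumSq e = W.card * (sumSq e / W.card) := by field_simp
  set y := sumSq e / W.card
  set g := diffEnergy W e
  have hg : 0 ≤ g := diffEnergy_nonneg W e
  have hy : 0 ≤ y := div_nonneg (sumSq_nonneg _) hN.le
  have u0 := sumSq_nonneg U₀
  have p0 := sumSq_nonneg P₀
  have su := sumSq_nonneg u
  have hd0 : 0 ≤ d := nonneg_of_mul_nonneg_right (by linarith : 0 ≤ (W.card : ℝ) * d) hN
  have hη0 : 0 ≤ η := by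
    have := sumSq_nonneg (shiftDiff w U₀)
    have := sumSq_nonneg (shiftDiff w P₀)
    exact nonneg_of_mul_nonneg_right (by linarith : 0 ≤ (W.card : ℝ) * η) hN
  have h8 : 2 * ∑' j, u j * shiftDiff w e' j ≤ 2 * K ^ 2 * sumSq u
      + (8 * K ^ 4 * sumSq u + 8 * K ^ 2 * (sumSq (shiftDiff w U₀) + sumSq (shiftDiff w P₀))
        + 32 * (W.card * (16 * K ^ 6 * (g + ε ^ 2 * y + ε ^ 2 * d)))
        + 8 * K ^ 4 * (W.card * (g + ε ^ 2 * y)) + 8 * K ^ 2 * ε ^ 2 * (sumSq U₀ + sumSq P₀)) := by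
    rw [e1] at b5'
    linarith
  refine h8.trans ?_
  have k2 : K ^ 2 ≤ K ^ 6 := pow_le_pow_right₀ hK (by norm_num)
  have k4 : K ^ 4 ≤ K ^ 6 := pow_le_pow_right₀ hK (by norm_num)
  have hq1 := add_nonneg (sumSq_nonneg (shiftDiff w U₀)) (sumSq_nonneg (shiftDiff w P₀))
  clear_value y g u
  clear h8 b6' b6 b5' b5 b4' b4 b3 b2 b1'' b1' b1 t5 t4 t3 t2 t1 h1 hG e1
  calc _ ≤ 2 * K ^ 6 * sumSq u
      + (8 * K ^ 6 * sumSq u + 8 * K ^ 6 * (W.card * η)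
        + 32 * (W.card * (16 * K ^ 6 * (g + ε ^ 2 * y + ε ^ 2 * d)))
        + 8 * K ^ 6 * (W.card * (g + ε ^ 2 * y)) + 8 * K ^ 6 * ε ^ 2 * (W.card * d)) := by gcongr
    _ = 10 * K ^ 6 * sumSq u + W.card * (K ^ 6 * (520 * (g + ε ^ 2 * y + ε ^ 2 * d) + 8 * η)) := by
      ring
    _ ≤ 10 * K ^ 6 * sumSq u
        + W.card * (K ^ 6 * (600 * (g + ε ^ 2 * y + ε ^ 2 * d) + 600 * η)) := by
      gcongr <;> norm_num
    _ = _ := by ring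

/-- The weight `ε ^ 2` on the energy of `e` makes the system close: the differences produce `sumSq
e` only with this factor, and the energy of `e` produces `diffEnergy` with a bounded one. -/
lemma diff_energy_le (h : ErrorEquation V W ε K μ κ e e' a b Q U₀ P₀)
    (hs : IsStencilPair V W ε K μ κ)
    (hG : diffEnergy W e + ε ^ 2 * (sumSq e / W.card) ≤ ε ^ 4) {d η : ℝ}
    (hd : sumSq U₀ + sumSq P₀ ≤ W.card * d)
    (hη : ∀ w ∈ W, sumSq (shiftDiff w U₀) + sumSq (shiftDiff w P₀) ≤ W.card * η) :
    (∑ w ∈ W, 2 * ∑' j, shiftDiff w e j * shiftDiff w e' j) / (W.card : ℝ) ^ 2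
        + ε ^ 2 * ((2 * ∑' j, e j * e' j) / W.card)
      ≤ 800 * K ^ 6 * (diffEnergy W e + ε ^ 2 * (sumSq e / W.card) + (ε ^ 2 * d + η)) := by
  have hε := hs.eps_pos
  have hε1 := hs.eps_le_one
  have hK := hs.one_le
  have hN := hs.card_pos
  have h1 := Finset.sum_le_sum fun w hw => h.diff_energy_le_aux hs hG hd hw (hη w hw)
  rw [Finset.sum_add_distrib, Finset.sum_const, nsmul_eq_mul,
    ← Finset.mul_sum (f := fun w => sumSq (shiftDiff w e))] at h1
  have h2 := h.energy_le hs hG hd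
  have e1 : ∑ w ∈ W, sumSq (shiftDiff w e) = (W.card : ℝ) ^ 2 * diffEnergy W e := by
    unfold diffEnergy; field_simp
  rw [e1] at h1
  set y := sumSq e / W.card
  set g := diffEnergy W e
  have hg : 0 ≤ g := diffEnergy_nonneg W e
  have hy : 0 ≤ y := div_nonneg (sumSq_nonneg _) hN.le
  have hd0 : 0 ≤ d := by
    have := sumSq_nonneg U₀
    have := sumSq_nonneg P₀
    exact nonneg_of_mul_nonneg_right (by linarith : 0 ≤ (W.card : ℝ) * d) hN
  have hη0 : 0 ≤ η := by
    have h0 := hη 0 (hs.subset hs.zero_mem)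
    have := sumSq_nonneg (shiftDiff 0 U₀)
    have := sumSq_nonneg (shiftDiff 0 P₀)
    exact nonneg_of_mul_nonneg_right (by linarith : 0 ≤ (W.card : ℝ) * η) hN
  have h3 : (∑ w ∈ W, 2 * ∑' j, shiftDiff w e j * shiftDiff w e' j) / (W.card : ℝ) ^ 2
      ≤ K ^ 6 * (10 * g + 600 * (g + ε ^ 2 * y + ε ^ 2 * d + η)) := by
    rw [div_le_iff₀ (by positivity)]
    refine h1.trans (le_of_eq ?_)
    ring
  have h4 : (2 * ∑' j, e j * e' j) / W.card ≤ 100 * K ^ 6 * (g + y + d) := by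
    rw [div_le_iff₀ hN]
    linarith
  have e2 : ε ^ 2 ≤ 1 := pow_le_one₀ hε.le hε1
  calc _ ≤ K ^ 6 * (10 * g + 600 * (g + ε ^ 2 * y + ε ^ 2 * d + η))
        + ε ^ 2 * (100 * K ^ 6 * (g + y + d)) := by gcongr
    _ = K ^ 6 * (610 * g + 100 * ε ^ 2 * g + 700 * (ε ^ 2 * y) + 700 * (ε ^ 2 * d) + 600 * η) := by
      ring
    _ ≤ K ^ 6 * (610 * g + 100 * 1 * g + 700 * (ε ^ 2 * y) + 700 * (ε ^ 2 * d) + 600 * η) := by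
      gcongr
    _ ≤ K ^ 6 * (800 * g + 800 * (ε ^ 2 * y) + 800 * (ε ^ 2 * d) + 800 * η) := by
      have : 0 ≤ ε ^ 2 * y := by positivity
      have : 0 ≤ ε ^ 2 * d := by positivity
      refine mul_le_mul_of_nonneg_left ?_ (by positivity)
      linarith
    _ = _ := by ring

end ErrorEquation

end ErrorEnergy

/-! ### Gronwall's inequality and the bootstrap -/

section Gronwall

lemma hasDerivWithinAt_Ici_of_Icc {f : ℝ → ℝ} {f' T t : ℝ} (ht : t ∈ Ico 0 T)
    (h : HasDerivWithinAt f f' (Icc 0 T) t) : HasDerivWithinAt f f' (Ici t) t :=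
  h.mono_of_mem_nhdsWithin (Filter.mem_of_superset (Icc_mem_nhdsGE ht.2) (Icc_subset_Icc_left ht.1))

/-- A Gronwall inequality whose differential inequality is only required below a barrier `B`. -/
lemma le_exp_of_deriv_le_below {f f' : ℝ → ℝ} {T M D B : ℝ} (hM : 0 ≤ M) (hD : 0 < D)
    (hf : ∀ t ∈ Icc 0 T, HasDerivWithinAt f (f' t) (Icc 0 T) t) (h0 : f 0 = 0)
    (hB : D * Real.exp ((2 * M + 1) * T) ≤ B)
    (h : ∀ t ∈ Icc 0 T, f t ≤ B → f' t ≤ M * (f t + D)) {t : ℝ} (ht : t ∈ Icc 0 T) :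
    f t ≤ D * Real.exp ((2 * M + 1) * T) := by
  have hmono : ∀ τ ∈ Icc 0 T, Real.exp ((2 * M + 1) * τ) ≤ Real.exp ((2 * M + 1) * T) :=
    fun τ hτ => Real.exp_le_exp.2 (by have := hτ.2; gcongr)
  have hd : ∀ τ : ℝ, HasDerivAt (fun τ => D * Real.exp ((2 * M + 1) * τ))
      (D * (Real.exp ((2 * M + 1) * τ) * ((2 * M + 1) * 1))) τ := fun τ =>
    (((hasDerivAt_id τ).const_mul (2 * M + 1)).exp).const_mul D
  have key := image_le_of_deriv_right_lt_deriv_boundary' (a := 0) (b := T) (f := f) (f' := f')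
    (fun τ hτ => (hf τ hτ).continuousWithinAt)
    (fun τ hτ => hasDerivWithinAt_Ici_of_Icc hτ (hf τ (Ico_subset_Icc_self hτ)))
    (B := fun τ => D * Real.exp ((2 * M + 1) * τ)) (by simp [h0, hD.le])
    (fun τ _ => (hd τ).continuousAt.continuousWithinAt) (fun τ _ => (hd τ).hasDerivWithinAt)
    -- At a contact point `f τ ≥ D`, so the derivative is at most `2 * M * f τ`. The extra `1` in
    -- the exponent makes the comparison strict.
    (fun τ hτ he => by
      have hτ' := Ico_subset_Icc_self hτ
      have h1 : D ≤ f τ := by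
        rw [he]
        have h3 : 1 ≤ Real.exp ((2 * M + 1) * τ) :=
          Real.one_le_exp (mul_nonneg (by linarith) hτ.1)
        nlinarith
      have h2 := h τ hτ' (by rw [he]; exact (mul_le_mul_of_nonneg_left (hmono τ hτ') hD.le).trans hB)
      calc f' τ ≤ M * (f τ + D) := h2
        _ ≤ M * (f τ + f τ) := by gcongr
        _ < (2 * M + 1) * f τ := by nlinarith
        _ = _ := by rw [he]; ring)
  exact (key ht).trans (mul_le_mul_of_nonneg_left (hmono t ht) hD.le)

lemma hasDerivWithinAt_sumSq {J : Type*} {S : Finset J} {e : J → ℝ → ℝ} {e' : J → ℝ} {s : Set ℝ}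
    {t : ℝ} (ht : t ∈ s) (hS : ∀ τ ∈ s, ∀ j ∉ S, e j τ = 0)
    (h : ∀ j, HasDerivWithinAt (e j) (e' j) s t) :
    HasDerivWithinAt (fun τ => sumSq fun j => e j τ) (2 * ∑' j, e j t * e' j) s t := by
  have h1 : ∀ τ ∈ s, sumSq (fun j => e j τ) = ∑ j ∈ S, e j τ ^ 2 := fun τ hτ => by
    unfold sumSq
    rw [tsum_eq_sum (s := S) fun j hj => by simp [hS τ hτ j hj]]
    simp
  rw [tsum_eq_sum (s := S) fun j hj => by rw [hS t ht j hj, zero_mul]]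
  refine HasDerivWithinAt.congr ?_ h1 (h1 t ht)
  have := HasDerivWithinAt.fun_sum fun j (_ : j ∈ S) => (h j).pow 2
  refine this.congr_deriv ?_
  rw [Finset.mul_sum]
  exact Finset.sum_congr rfl fun j _ => by simp; ring

variable {J : Type*} [AddCommGroup J] {E : Type*} [NormedAddCommGroup E] [NormedSpace ℝ E]

/-- Gronwall is applied twice. The first pass, under the barrier `ε ^ 4`, controls `diffEnergy` and
justifies the treatment of `Q` on all of `[0, T]`. The second pass bounds the plain energy, with
`diffEnergy` now a known source. `C` depends only on `K` and `T`. -/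
lemma exists_error_bound {T : ℝ} (K : ℝ) (hT : 0 ≤ T) :
    ∃ C : ℝ, 1 ≤ C ∧ ∀ (V W : Finset J) (ε : ℝ) (μ : J → ℝ) (κ : J → E) (S : Finset J)
      (e e' a : J → ℝ → ℝ) (b : ℝ → J → E →L[ℝ] ℝ) (Q U₀ : ℝ → J → ℝ) (P₀ : ℝ → J → E)
      (d η : ℝ), IsStencilPair V W ε K μ κ →
      (∀ t ∈ Icc 0 T, ∀ j ∉ S, e j t = 0) → (∀ j, e j 0 = 0) →
      (∀ j, ∀ t ∈ Icc 0 T, HasDerivWithinAt (e j) (e' j t) (Icc 0 T) t) →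
      (∀ t ∈ Icc 0 T, ErrorEquation V W ε K μ κ (fun j => e j t) (fun j => e' j t)
        (fun j => a j t) (b t) (Q t) (U₀ t) (P₀ t)) →
      0 < d → (∀ t ∈ Icc 0 T, sumSq (U₀ t) + sumSq (P₀ t) ≤ W.card * d) →
      0 < η → (∀ t ∈ Icc 0 T, ∀ w ∈ W,
        sumSq (shiftDiff w (U₀ t)) + sumSq (shiftDiff w (P₀ t)) ≤ W.card * η) →
      C * (ε ^ 2 * d + η) ≤ ε ^ 4 →
      ∀ t ∈ Icc 0 T, sumSq (fun j => e j t) / W.card ≤ C * (d + η) := by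
  classical
  set M := 800 * K ^ 6 with hM
  have hM0 : 0 ≤ M := by positivity
  set A := Real.exp ((2 * M + 1) * T) with hA
  have hA1 : 1 ≤ A := Real.one_le_exp (by positivity)
  -- The factor `1 + A` comes from the source in the second pass, the factor `A` from its
  -- exponential.
  refine ⟨(1 + A) * A, by nlinarith, ?_⟩
  intro V W ε μ κ S e e' a b Q U₀ P₀ d η hs hS h0 hd he hdp hdb hη hηb hsmall
  have hε := hs.eps_pos
  have hN := hs.card_pos
  have hD : 0 < ε ^ 2 * d + η := by positivity
  have hderiv : ∀ t ∈ Icc 0 T, HasDerivWithinAt (fun τ => sumSq fun j => e j τ)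
      (2 * ∑' j, e j t * e' j t) (Icc 0 T) t := fun t ht =>
    hasDerivWithinAt_sumSq ht hS fun j => hd j t ht
  have hderiv' : ∀ t ∈ Icc 0 T, ∀ w,
      HasDerivWithinAt (fun τ => sumSq (shiftDiff w fun j => e j τ))
      (2 * ∑' j, shiftDiff w (fun j => e j t) j * shiftDiff w (fun j => e' j t) j) (Icc 0 T) t :=
    fun t ht w => hasDerivWithinAt_sumSq (S := S ∪ S.image fun j => j - w)
      (e := fun j τ => shiftDiff w (fun j => e j τ) j) ht
      (fun τ hτ j hj => by
        simp only [Finset.mem_union, Finset.mem_image, not_or, not_exists, not_and] at hj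
        have h1 : j + w ∉ S := fun hjw => hj.2 _ hjw (by abel)
        simp [shiftDiff, hS τ hτ _ h1, hS τ hτ _ hj.1])
      fun j => (hd (j + w) t ht).sub (hd j t ht)
  have hG : ∀ t ∈ Icc 0 T, diffEnergy W (fun j => e j t)
      + ε ^ 2 * (sumSq (fun j => e j t) / W.card) ≤ (ε ^ 2 * d + η) * A := by
    intro t ht
    refine le_exp_of_deriv_le_below
      (f := fun t => diffEnergy W (fun j => e j t) + ε ^ 2 * (sumSq (fun j => e j t) / W.card))
      (B := ε ^ 4) hM0 hD (fun τ hτ => ((HasDerivWithinAt.fun_sum fun w (_ : w ∈ W) =>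
        hderiv' τ hτ w).div_const _).add (((hderiv τ hτ).div_const _).const_mul _)) ?_ ?_ ?_ ht
    · simp [diffEnergy, sumSq, shiftDiff, h0]
    · refine le_trans ?_ hsmall
      have : A ≤ (1 + A) * A := by nlinarith
      rw [mul_comm]
      gcongr
    · intro τ hτ hle
      exact (he τ hτ).diff_energy_le hs hle (hdb τ hτ) (hηb τ hτ)
  have hsmall' : (ε ^ 2 * d + η) * A ≤ ε ^ 4 := by
    refine le_trans ?_ hsmall
    have : A ≤ (1 + A) * A := by nlinarith
    rw [mul_comm]
    gcongr
  have e2 : ε ^ 2 ≤ 1 := pow_le_one₀ hε.le hs.eps_le_one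
  intro t ht
  have hD' : 0 < (1 + A) * (d + η) := by positivity
  -- Second pass: the barrier is chosen equal to the conclusion, since the differential inequality
  -- is now available without restriction.
  have h3 := le_exp_of_deriv_le_below (f := fun t => sumSq (fun j => e j t) / W.card) hM0 hD'
    (fun τ hτ => (hderiv τ hτ).div_const _) (by simp [sumSq, h0]) le_rfl
    (fun τ hτ _ => by
      have h4 := (he τ hτ).energy_le hs ((hG τ hτ).trans hsmall') (hdb τ hτ)
      have h5 := hG τ hτ
      rw [div_le_iff₀ hN]
      set y := sumSq (fun j => e j τ) / W.card
      set g := diffEnergy W (fun j => e j τ)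
      have hg : 0 ≤ g := diffEnergy_nonneg W _
      have hy : 0 ≤ y := div_nonneg (sumSq_nonneg _) hN.le
      have h6 : g ≤ A * (d + η) := by
        have : 0 ≤ ε ^ 2 * y := by positivity
        calc g ≤ (ε ^ 2 * d + η) * A := by linarith
          _ ≤ (1 * d + η) * A := by gcongr
          _ = _ := by ring
      calc _ ≤ W.card * (100 * K ^ 6 * (g + y + d)) := h4
        _ ≤ W.card * (800 * K ^ 6 * (A * (d + η) + y + (d + η))) := by
          gcongr
          · norm_num
          · linarith
        _ = _ := by rw [hM]; ring) ht
  refine h3.trans (le_of_eq ?_)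
  rw [← hA]; ring

end Gronwall

/-! ### Lattice sums and the trapezoidal rule -/

section Quadrature

variable {n : ℕ}

lemma gridPoint_apply (h : ℝ) (j : Fin n → ℤ) (i : Fin n) : gridPoint h j i = (j i : ℝ) * h := rfl

lemma gridPoint_eq_smul (h : ℝ) (j : Fin n → ℤ) : gridPoint h j = h • gridPoint 1 j := by
  ext i; simp [gridPoint_apply, mul_comm]

lemma gridPoint_add (h : ℝ) (j v : Fin n → ℤ) :
    gridPoint h (j + v) = gridPoint h j + gridPoint h v := by
  ext i; simp [gridPoint_apply, add_mul]

lemma gridPoint_sub (h : ℝ) (j v : Fin n → ℤ) :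
    gridPoint h (j - v) = gridPoint h j - gridPoint h v := by
  ext i; simp [gridPoint_apply, sub_mul]

lemma gridPoint_neg (h : ℝ) (j : Fin n → ℤ) : gridPoint h (-j) = -gridPoint h j := by
  ext i; simp [gridPoint_apply]

/-- The integer points of a cube with centre `z` and half side length `ρ`. -/
def box (z : Rn n) (ρ : ℝ) : Finset (Fin n → ℤ) :=
  Fintype.piFinset fun i => Finset.Icc ⌈z i - ρ⌉ ⌊z i + ρ⌋

lemma mem_box {z : Rn n} {ρ : ℝ} {j : Fin n → ℤ} : j ∈ box z ρ ↔ ∀ i, |z i - j i| ≤ ρ := by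
  simp only [box, Fintype.mem_piFinset, Finset.mem_Icc, Int.ceil_le, Int.le_floor, abs_le]
  exact forall_congr' fun i => ⟨fun h => ⟨by linarith, by linarith⟩,
    fun h => ⟨by linarith, by linarith⟩⟩

lemma mem_box_of_norm_le {z : Rn n} {ρ : ℝ} {j : Fin n → ℤ} (h : ‖z - gridPoint 1 j‖ ≤ ρ) :
    j ∈ box z ρ :=
  mem_box.2 fun i => by
    have := (PiLp.norm_apply_le (z - gridPoint 1 j) i).trans h
    simpa [gridPoint_apply] using this

lemma box_subset_box {x y : Rn n} {ρ δ : ℝ} (h : ‖x - y‖ ≤ δ) : box x ρ ⊆ box y (ρ + δ) := by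
  intro j hj
  rw [mem_box] at hj ⊢
  intro i
  have h1 := (PiLp.norm_apply_le (x - y) i).trans h
  rw [PiLp.sub_apply, Real.norm_eq_abs] at h1
  calc |y i - j i| = |(x i - j i) - (x i - y i)| := by ring_nf
    _ ≤ |x i - j i| + |x i - y i| := abs_sub _ _
    _ ≤ ρ + δ := add_le_add (hj i) h1

lemma card_box_le (z : Rn n) {ρ : ℝ} (hρ : 0 ≤ ρ) : ((box z ρ).card : ℝ) ≤ (2 * ρ + 1) ^ n := by
  rw [box, Fintype.card_piFinset, Nat.cast_prod]
  calc ∏ i : Fin n, ((Finset.Icc ⌈z i - ρ⌉ ⌊z i + ρ⌋).card : ℝ) ≤ ∏ _i : Fin n, (2 * ρ + 1) := by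
        refine Finset.prod_le_prod (fun _ _ => by positivity) fun i _ => ?_
        rw [Int.card_Icc]
        have h1 := Int.le_ceil (z i - ρ)
        have h2 := Int.floor_le (z i + ρ)
        rcases le_total 0 (⌊z i + ρ⌋ + 1 - ⌈z i - ρ⌉) with h | h
        · have : (((⌊z i + ρ⌋ + 1 - ⌈z i - ρ⌉).toNat : ℤ) : ℝ) = ⌊z i + ρ⌋ + 1 - ⌈z i - ρ⌉ := by
            rw [Int.toNat_of_nonneg h]; push_cast; ring
          rw [Int.cast_natCast] at this
          linarith
        · rw [Int.toNat_of_nonpos h]; push_cast; positivity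
    _ = _ := by simp

/-- The sum of the translates of `g` by the integer points. -/
def latticeSum (g : Rn n → ℝ) (z : Rn n) : ℝ := ∑' j, g (z - gridPoint 1 j)

/-- The derivative in the direction `v`. -/
def dirDeriv (v : Rn n) (g : Rn n → ℝ) (x : Rn n) : ℝ := fderiv ℝ g x v

lemma exists_radius {g : Rn n → ℝ} (hg : HasCompactSupport g) :
    ∃ ρ : ℝ, 1 ≤ ρ ∧ ∀ x, ρ < ‖x‖ → g x = 0 := by
  obtain ⟨ρ, hρ⟩ := hg.isCompact.isBounded.exists_norm_le
  refine ⟨max ρ 1, le_max_right _ _, fun x hx => ?_⟩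
  by_contra h
  exact absurd (hρ x (subset_tsupport g h)) (by have := le_max_left ρ 1; linarith)

lemma latticeSum_eq_sum {g : Rn n → ℝ} {ρ : ℝ} (hg : ∀ x, ρ < ‖x‖ → g x = 0) {z : Rn n}
    {B : Finset (Fin n → ℤ)} (hB : box z ρ ⊆ B) :
    latticeSum g z = ∑ j ∈ B, g (z - gridPoint 1 j) :=
  tsum_eq_sum fun j hj => hg _ (by
    by_contra h
    exact hj (hB (mem_box_of_norm_le (not_lt.1 h))))

lemma latticeSum_add_gridPoint (g : Rn n → ℝ) (z : Rn n) (v : Fin n → ℤ) :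
    latticeSum g (z + gridPoint 1 v) = latticeSum g z := by
  unfold latticeSum
  rw [← tsum_add_right _ v]
  exact tsum_congr fun j => by rw [gridPoint_add]; congr 1; abel

lemma hasCompactSupport_dirDeriv {g : Rn n → ℝ} (hg : HasCompactSupport g) (v : Rn n) :
    HasCompactSupport (dirDeriv v g) := hg.fderiv_apply ℝ v

lemma contDiff_dirDeriv {g : Rn n → ℝ} {m : ℕ} (hg : ContDiff ℝ (m + 1 : ℕ) g) (v : Rn n) :
    ContDiff ℝ m (dirDeriv v g) :=
  (hg.fderiv_right (m := m) (by norm_cast)).clm_apply contDiff_const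

/-- The sum is locally finite: near `τ` all nonzero terms lie in one box, enlarged by `1`, so the
derivative may be taken termwise. -/
lemma hasDerivAt_latticeSum {g : Rn n → ℝ} (hg : ContDiff ℝ 1 g) (hc : HasCompactSupport g)
    (z v : Rn n) (τ : ℝ) :
    HasDerivAt (fun τ => latticeSum g (z + τ • v)) (latticeSum (dirDeriv v g) (z + τ • v)) τ := by
  obtain ⟨ρ, hρ, h0⟩ := exists_radius hc
  have h0' : ∀ x, ρ < ‖x‖ → dirDeriv v g x = 0 := fun x hx => by
    have : g =ᶠ[nhds x] fun _ => 0 :=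
      Filter.eventually_of_mem ((isOpen_lt continuous_const continuous_norm).mem_nhds hx) h0
    simp [dirDeriv, this.fderiv_eq]
  rw [latticeSum_eq_sum h0' (box_subset_box (y := z + τ • v) (δ := 1) (by simp))]
  have hev : (fun τ => latticeSum g (z + τ • v)) =ᶠ[nhds τ]
      fun σ => ∑ j ∈ box (z + τ • v) (ρ + 1), g (z + σ • v - gridPoint 1 j) := by
    have hcont : Continuous fun σ : ℝ => ‖z + σ • v - (z + τ • v)‖ := by fun_prop
    have : ∀ᶠ σ in nhds τ, ‖z + σ • v - (z + τ • v)‖ < 1 :=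
      hcont.continuousAt.eventually_lt continuousAt_const (by simp)
    filter_upwards [this] with σ hσ
    exact latticeSum_eq_sum h0 (box_subset_box hσ.le)
  refine HasDerivAt.congr_of_eventuallyEq ?_ hev
  refine HasDerivAt.fun_sum fun j _ => ?_
  have h1 : HasDerivAt (fun σ : ℝ => z + σ • v - gridPoint 1 j) v τ := by
    simpa using (((hasDerivAt_id τ).smul_const v).const_add z).sub_const (gridPoint 1 j)
  exact (hg.differentiable one_ne_zero _).hasFDerivAt.comp_hasDerivAt τ h1

/-- The coordinate vectors. -/
abbrev basisVec (i : Fin n) : Rn n := EuclideanSpace.single i 1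

lemma gridPoint_single (i : Fin n) (m : ℤ) : gridPoint 1 (Pi.single i m) = (m : ℝ) • basisVec i := by
  ext q
  by_cases h : q = i
  · subst h; simp [gridPoint_apply]
  · simp [gridPoint_apply, h]

/-- By periodicity `τ` may be replaced by its fractional part; the mean value inequality is then
applied on an interval shorter than `1`. -/
lemma abs_latticeSum_sub_le_of_dirDeriv {g : Rn n → ℝ} (hg : ContDiff ℝ 1 g)
    (hc : HasCompactSupport g) {i : Fin n} {M : ℝ}
    (hM : ∀ z, |latticeSum (dirDeriv (basisVec i) g) z| ≤ M) (z : Rn n) (τ : ℝ) :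
    |latticeSum g (z + τ • basisVec i) - latticeSum g z| ≤ M := by
  have h1 : latticeSum g (z + τ • basisVec i) = latticeSum g (z + Int.fract τ • basisVec i) := by
    rw [← latticeSum_add_gridPoint g (z + Int.fract τ • basisVec i) (Pi.single i ⌊τ⌋),
      gridPoint_single, add_assoc, ← add_smul, Int.fract_add_floor]
  have hM0 : 0 ≤ M := (abs_nonneg _).trans (hM 0)
  have h2 := Convex.norm_image_sub_le_of_norm_hasDerivWithin_le (𝕜 := ℝ) (s := Set.univ)
    (f := fun τ : ℝ => latticeSum g (z + τ • basisVec i)) (C := M)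
    (fun σ _ => (hasDerivAt_latticeSum hg hc z (basisVec i) σ).hasDerivWithinAt)
    (fun σ _ => hM _) convex_univ (Set.mem_univ 0) (Set.mem_univ (Int.fract τ))
  simp only [zero_smul, add_zero, sub_zero, Real.norm_eq_abs] at h2
  rw [h1]
  refine h2.trans ?_
  have := Int.fract_nonneg τ
  have := (Int.fract_lt_one τ).le
  rw [abs_of_nonneg ‹_›]
  nlinarith

/-- By Rolle's theorem the derivative of a periodic function vanishes somewhere on each line in the
direction `i`, so its size is at most its oscillation, which the next derivative bounds. -/
lemma abs_latticeSum_dirDeriv_le {g : Rn n → ℝ} (hg : ContDiff ℝ 2 g)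
    (hc : HasCompactSupport g) {i : Fin n} {M : ℝ}
    (hM : ∀ z, |latticeSum (dirDeriv (basisVec i) (dirDeriv (basisVec i) g)) z| ≤ M) (z : Rn n) :
    |latticeSum (dirDeriv (basisVec i) g) z| ≤ M := by
  have hd := fun σ => hasDerivAt_latticeSum (hg.of_le (by norm_num)) hc z (basisVec i) σ
  obtain ⟨σ, _, hσ⟩ := exists_hasDerivAt_eq_zero (a := 0) (b := 1) one_pos
    (f := fun τ : ℝ => latticeSum g (z + τ • basisVec i))
    (fun σ _ => (hd σ).continuousAt.continuousWithinAt)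
    (by
      have := latticeSum_add_gridPoint g z (Pi.single i 1)
      rw [gridPoint_single] at this
      simpa using this.symm)
    (fun σ _ => hd σ)
  have h := abs_latticeSum_sub_le_of_dirDeriv (contDiff_dirDeriv (m := 1) (by exact_mod_cast hg)
    (basisVec i)) (hasCompactSupport_dirDeriv hc _) hM z σ
  rwa [hσ, zero_sub, abs_neg] at h

lemma contDiff_iterate_dirDeriv {g : Rn n → ℝ} (v : Rn n) (m l : ℕ)
    (hg : ContDiff ℝ (l + m : ℕ) g) : ContDiff ℝ l ((dirDeriv v)^[m] g) := by
  induction m generalizing l with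
  | zero => simpa using hg
  | succ m ih =>
    rw [Function.iterate_succ_apply']
    exact contDiff_dirDeriv (ih (l + 1) (by convert hg using 2; ring)) v

lemma hasCompactSupport_iterate_dirDeriv {g : Rn n → ℝ} (hg : HasCompactSupport g) (v : Rn n)
    (m : ℕ) : HasCompactSupport ((dirDeriv v)^[m] g) := by
  induction m with
  | zero => exact hg
  | succ m ih =>
    rw [Function.iterate_succ_apply']
    exact hasCompactSupport_dirDeriv ih v

/-- The bound on the derivative of order `l + 1` descends to the first one by repeated use of
Rolle's theorem, without loss in the constant. -/
lemma abs_latticeSum_add_smul_sub_le {g : Rn n → ℝ} {l : ℕ} (hg : ContDiff ℝ (l + 1 : ℕ) g)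
    (hc : HasCompactSupport g) {i : Fin n} {M : ℝ}
    (hM : ∀ z, |latticeSum ((dirDeriv (basisVec i))^[l + 1] g) z| ≤ M) (z : Rn n) (τ : ℝ) :
    |latticeSum g (z + τ • basisVec i) - latticeSum g z| ≤ M := by
  refine abs_latticeSum_sub_le_of_dirDeriv (hg.of_le (by norm_cast; omega)) hc (fun y => ?_) z τ
  clear z τ
  induction l generalizing y with
  | zero => exact hM y
  | succ l ih =>
    refine ih (hg.of_le (by norm_cast; omega)) (fun z => ?_) y
    rw [Function.iterate_succ_apply']
    refine abs_latticeSum_dirDeriv_le (contDiff_iterate_dirDeriv _ l 2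
      (hg.of_le (by norm_cast; omega))) (hasCompactSupport_iterate_dirDeriv hc _ _) (fun y => ?_) z
    simpa only [Function.iterate_succ_apply'] using hM y

lemma abs_latticeSum_sub_le {g : Rn n → ℝ} {l : ℕ} (hg : ContDiff ℝ (l + 1 : ℕ) g)
    (hc : HasCompactSupport g) {M : ℝ}
    (hM : ∀ i z, |latticeSum ((dirDeriv (basisVec i))^[l + 1] g) z| ≤ M) (y z : Rn n) :
    |latticeSum g y - latticeSum g z| ≤ n * M := by
  have h : ∀ s : Finset (Fin n), ∀ τ : Fin n → ℝ,
      |latticeSum g (z + ∑ i ∈ s, τ i • basisVec i) - latticeSum g z| ≤ s.card * M := by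
    classical
    intro s τ
    induction s using Finset.induction_on with
    | empty => simp
    | insert a s ha ih =>
      rw [Finset.sum_insert ha, Finset.card_insert_of_notMem ha]
      have h1 := abs_latticeSum_add_smul_sub_le hg hc (hM a) (z + ∑ i ∈ s, τ i • basisVec i) (τ a)
      have h2 : z + (τ a • basisVec a + ∑ i ∈ s, τ i • basisVec i)
          = z + ∑ i ∈ s, τ i • basisVec i + τ a • basisVec a := by abel
      rw [h2]
      push_cast
      have h3 := abs_sub_le (latticeSum g (z + ∑ i ∈ s, τ i • basisVec i + τ a • basisVec a))
        (latticeSum g (z + ∑ i ∈ s, τ i • basisVec i)) (latticeSum g z)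
      linarith
  have h1 := h Finset.univ (fun i => (y - z) i)
  have h2 : z + ∑ i, (y - z) i • basisVec i = y := by
    have : ∑ i, (y - z) i • basisVec i = y - z := by
      ext q
      simp [Finset.sum_apply, Pi.single_apply]
    rw [this]; abel
  rw [h2] at h1
  simpa using h1

/-- The unit cell of the integer lattice. -/
def unitCell (n : ℕ) : Set (Rn n) := {y | ∀ i, y i ∈ Ico (0 : ℝ) 1}

lemma measurableSet_unitCell : MeasurableSet (unitCell n) := by
  have : unitCell n = ⋂ i, (fun y : Rn n => y i) ⁻¹' Ico (0 : ℝ) 1 := by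
    ext; simp [unitCell]
  rw [this]
  exact MeasurableSet.iInter fun i =>
    (by fun_prop : Continuous fun y : Rn n => y i).measurable measurableSet_Ico

lemma volume_unitCell : volume (unitCell n) = 1 := by
  have h := (EuclideanSpace.volume_preserving_symm_measurableEquiv_toLp (Fin n)).measure_preimage
    (s := Set.univ.pi fun _ => Ico (0 : ℝ) 1)
    (MeasurableSet.univ_pi fun _ => measurableSet_Ico).nullMeasurableSet
  rw [Real.volume_pi_Ico] at h
  simp only [sub_zero, ENNReal.ofReal_one, Finset.prod_const_one] at h
  rw [← h]
  congr 1
  ext y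
  simp [unitCell, Set.mem_pi]

/-- The unit cell tiles space: the only integer translation that brings `y` into it is the negative
of its coordinatewise floor. -/
lemma sum_indicator_unitCell {y : Rn n} {B : Finset (Fin n → ℤ)}
    (hB : (fun i => -⌊y i⌋) ∈ B) :
    ∑ j ∈ B, (unitCell n).indicator (fun _ => (1 : ℝ)) (y + gridPoint 1 j) = 1 := by
  rw [Finset.sum_eq_single_of_mem _ hB]
  · rw [Set.indicator_of_mem]
    intro i
    simp only [PiLp.add_apply, gridPoint_apply, mul_one, Int.cast_neg, ← sub_eq_add_neg]
    exact ⟨Int.fract_nonneg _, Int.fract_lt_one _⟩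
  · intro j _ hj
    rw [Set.indicator_of_notMem]
    intro hmem
    apply hj
    ext i
    have h1 := hmem i
    simp only [PiLp.add_apply, gridPoint_apply, mul_one, mem_Ico] at h1
    have : ⌊y i⌋ = -j i := by
      rw [Int.floor_eq_iff]; push_cast; constructor <;> linarith
    omega

/-- The integral is cut into integer translates of the unit cell, which are moved back to the cell.
Compact support makes the sum over translates finite. -/
lemma integral_eq_integral_latticeSum {g : Rn n → ℝ} (hg : Continuous g)
    (hc : HasCompactSupport g) :
    ∫ y, g y = ∫ y in unitCell n, latticeSum g y ∧ IntegrableOn (latticeSum g) (unitCell n) := by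
  obtain ⟨ρ, hρ, h0⟩ := exists_radius hc
  have hi : ∀ j : Fin n → ℤ, Integrable (fun y : Rn n => g (y - gridPoint 1 j)) := fun j =>
    (hg.integrable_of_hasCompactSupport hc).comp_sub_right _
  set B := box (0 : Rn n) (ρ + 1) with hB
  have h1 : Set.EqOn (latticeSum g) (fun y => ∑ j ∈ B, g (y - gridPoint 1 j)) (unitCell n) := by
    intro y hy
    refine latticeSum_eq_sum h0 fun j hj => ?_
    rw [hB, mem_box]
    rw [mem_box] at hj
    intro i
    have := hj i
    have := hy i
    rw [mem_Ico] at this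
    simp only [PiLp.zero_apply, abs_le] at *
    constructor <;> linarith
  constructor
  · rw [setIntegral_congr_fun measurableSet_unitCell h1,
      integral_finsetSum _ fun j _ => (hi j).integrableOn]
    have h2 : ∀ j ∈ B, ∫ y in unitCell n, g (y - gridPoint 1 j)
        = ∫ y, (unitCell n).indicator (fun _ => (1 : ℝ)) (y + gridPoint 1 j) * g y := fun j _ => by
      rw [← integral_indicator measurableSet_unitCell,
        ← integral_sub_right_eq_self (fun y => (unitCell n).indicator (fun _ => (1 : ℝ))
          (y + gridPoint 1 j) * g y) (gridPoint 1 j)]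
      refine integral_congr_ae (Filter.Eventually.of_forall fun y => ?_)
      by_cases hy : y ∈ unitCell n <;> simp [hy]
    rw [Finset.sum_congr rfl h2, ← integral_finsetSum]
    · refine integral_congr_ae (Filter.Eventually.of_forall fun y => ?_)
      simp only
      rw [← Finset.sum_mul]
      by_cases hy : ρ < ‖y‖
      · simp [h0 y hy]
      · rw [sum_indicator_unitCell, one_mul]
        rw [hB, mem_box]
        intro i
        have h3 := (PiLp.norm_apply_le y i).trans (not_lt.1 hy)
        rw [Real.norm_eq_abs, abs_le] at h3
        have h4 := Int.floor_le (y i)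
        have h5 := Int.lt_floor_add_one (y i)
        rw [PiLp.zero_apply, abs_le]
        push_cast
        constructor <;> linarith
    · intro j _
      have : (fun y => (unitCell n).indicator (fun _ => (1 : ℝ)) (y + gridPoint 1 j) * g y)
          = ((fun y => y + gridPoint 1 j) ⁻¹' unitCell n).indicator g := by
        ext y; by_cases h : y + gridPoint 1 j ∈ unitCell n <;> simp [h]
      rw [this]
      exact (hg.integrable_of_hasCompactSupport hc).indicator
        (measurableSet_unitCell.preimage (by fun_prop))
  · exact (integrable_finsetSum _ fun j _ => (hi j).integrableOn).congr
      ((ae_restrict_mem measurableSet_unitCell).mono fun y hy => (h1 hy).symm)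

/-- The error of the trapezoidal rule on the integer lattice. -/
lemma abs_latticeSum_sub_integral_le {g : Rn n → ℝ} {l : ℕ} (hg : ContDiff ℝ (l + 1 : ℕ) g)
    (hc : HasCompactSupport g) {M : ℝ}
    (hM : ∀ i z, |latticeSum ((dirDeriv (basisVec i))^[l + 1] g) z| ≤ M) (z : Rn n) :
    |latticeSum g z - ∫ y, g y| ≤ n * M := by
  obtain ⟨h1, h2⟩ := integral_eq_integral_latticeSum hg.continuous hc
  have hv : volume.real (unitCell n) = 1 := by simp [Measure.real, volume_unitCell]
  -- The cell has measure one, so the error is the mean of the differences and is bounded by the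
  -- oscillation.
  have h3 : ∫ y in unitCell n, (latticeSum g z - latticeSum g y) = latticeSum g z - ∫ y, g y := by
    have hfin : IsFiniteMeasure (volume.restrict (unitCell n)) := ⟨by simp [volume_unitCell]⟩
    rw [integral_sub (integrable_const _) h2, h1]
    simp [hv]
  have h4 := norm_setIntegral_le_of_norm_le_const (μ := volume) (s := unitCell n)
    (f := fun y => latticeSum g z - latticeSum g y) (C := n * M)
    (by simp [volume_unitCell]) fun y _ => abs_latticeSum_sub_le hg hc hM z y
  rw [h3, hv, mul_one] at h4
  exact h4

lemma dirDeriv_comp_smul (g : Rn n → ℝ) (v : Rn n) (c : ℝ) :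
    dirDeriv v (fun x => g (c • x)) = fun x => c * dirDeriv v g (c • x) := by
  ext x
  simp [dirDeriv, fderiv_comp_smul]

lemma dirDeriv_const_mul (g : Rn n → ℝ) (v : Rn n) (c : ℝ) :
    dirDeriv v (fun x => c * g x) = fun x => c * dirDeriv v g x := by
  ext x
  have : (fun x => c * g x) = c • g := rfl
  rw [dirDeriv, this, fderiv_const_smul_field]
  rfl

lemma iterate_dirDeriv_comp_smul (g : Rn n → ℝ) (v : Rn n) (c : ℝ) (m : ℕ) :
    (dirDeriv v)^[m] (fun x => g (c • x)) = fun x => c ^ m * (dirDeriv v)^[m] g (c • x) := by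
  induction m with
  | zero => simp
  | succ m ih =>
    rw [Function.iterate_succ_apply', ih, dirDeriv_const_mul, dirDeriv_comp_smul,
      Function.iterate_succ_apply']
    ext x; ring

/-- The number of grid points in a ball. -/
lemma pow_mul_abs_latticeSum_le {g : Rn n → ℝ} {ρ B lam : ℝ} (hρ : 0 ≤ ρ)
    (h0 : ∀ x, ρ < ‖x‖ → g x = 0) (hB : ∀ x, |g x| ≤ B) (hl : 0 < lam) (hl1 : lam ≤ 1) (z : Rn n) :
    lam ^ n * |latticeSum (fun x => g (lam • x)) z| ≤ (2 * ρ + 1) ^ n * B := by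
  have hB0 : 0 ≤ B := (abs_nonneg _).trans (hB 0)
  have h1 : ∀ x : Rn n, ρ / lam < ‖x‖ → g (lam • x) = 0 := fun x hx => h0 _ (by
    rw [norm_smul, Real.norm_eq_abs, abs_of_pos hl]
    rwa [div_lt_iff₀' hl] at hx)
  rw [latticeSum_eq_sum h1 subset_rfl]
  calc lam ^ n * |∑ j ∈ box z (ρ / lam), g (lam • (z - gridPoint 1 j))|
      ≤ lam ^ n * ((box z (ρ / lam)).card * B) := by
        gcongr
        refine (Finset.abs_sum_le_sum_abs _ _).trans ?_
        rw [← nsmul_eq_mul, ← Finset.sum_const]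
        exact Finset.sum_le_sum fun j _ => hB _
    _ ≤ lam ^ n * ((2 * (ρ / lam) + 1) ^ n * B) := by
        gcongr
        exact card_box_le z (by positivity)
    _ = (2 * ρ + lam) ^ n * B := by
        rw [← mul_assoc, ← mul_pow]; congr 2; field_simp
    _ ≤ _ := by gcongr

/-- The error of the trapezoidal rule on the lattice of mesh size `lam`. -/
lemma exists_quadrature_bound {g : Rn n → ℝ} {l : ℕ} (hl : 1 ≤ l) (hg : ContDiff ℝ l g)
    (hc : HasCompactSupport g) : ∃ C : ℝ, 0 ≤ C ∧ ∀ lam : ℝ, 0 < lam → lam ≤ 1 → ∀ z : Rn n,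
      |lam ^ n * latticeSum (fun x => g (lam • x)) z - ∫ y, g y| ≤ C * lam ^ l := by
  obtain ⟨l, rfl⟩ : ∃ m, l = m + 1 := ⟨l - 1, by omega⟩
  have hk : ∀ i : Fin n, ∃ C : ℝ, 0 ≤ C ∧ ∀ lam : ℝ, 0 < lam → lam ≤ 1 → ∀ z : Rn n,
      lam ^ n * |latticeSum (fun x => (dirDeriv (basisVec i))^[l + 1] g (lam • x)) z| ≤ C := by
    intro i
    have hc' := hasCompactSupport_iterate_dirDeriv hc (basisVec i) (l + 1)
    have hg' := (contDiff_iterate_dirDeriv (basisVec i) (l + 1) 0 (by simpa using hg)).continuous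
    obtain ⟨ρ, hρ, h0⟩ := exists_radius hc'
    obtain ⟨B, hB⟩ := hc'.exists_bound_of_continuous hg'
    have hB0 : 0 ≤ B := (norm_nonneg _).trans (hB 0)
    exact ⟨(2 * ρ + 1) ^ n * B, by positivity, fun lam h1 h2 z =>
      pow_mul_abs_latticeSum_le (by linarith) h0 hB h1 h2 z⟩
  choose C hC0 hC using hk
  refine ⟨n * ∑ i, C i, by have := Finset.sum_nonneg fun i (_ : i ∈ Finset.univ) => hC0 i; positivity,
    fun lam h1 h2 z => ?_⟩
  have hsmooth : ContDiff ℝ (l + 1 : ℕ) fun x : Rn n => g (lam • x) := by fun_prop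
  have hsupp : HasCompactSupport fun x : Rn n => g (lam • x) :=
    hc.comp_homeomorph (Homeomorph.smulOfNeZero lam h1.ne')
  -- In `M`, the power `lam ^ (l + 1)` comes from the chain rule and `(lam ^ n)⁻¹` from the number
  -- of lattice points in the rescaled support.
  have h3 := abs_latticeSum_sub_integral_le hsmooth hsupp
    (M := lam ^ (l + 1) * ((lam ^ n)⁻¹ * ∑ i, C i)) (fun i z => by
      rw [iterate_dirDeriv_comp_smul]
      unfold latticeSum
      rw [tsum_mul_left, abs_mul, abs_of_pos (pow_pos h1 _)]
      refine mul_le_mul_of_nonneg_left ?_ (by positivity)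
      rw [← div_eq_inv_mul, le_div_iff₀ (by positivity), mul_comm]
      exact (hC i lam h1 h2 z).trans
        (Finset.single_le_sum (fun i _ => hC0 i) (Finset.mem_univ i))) z
  have h4 : ∫ y : Rn n, g (lam • y) = (lam ^ n)⁻¹ * ∫ y, g y := by
    rw [Measure.integral_comp_smul_of_nonneg _ _ _ (hR := h1.le)]
    simp
  rw [h4] at h3
  have hp : 0 < lam ^ n := by positivity
  calc |lam ^ n * latticeSum (fun x => g (lam • x)) z - ∫ y, g y|
      = lam ^ n * |latticeSum (fun x => g (lam • x)) z - (lam ^ n)⁻¹ * ∫ y, g y| := by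
        rw [← abs_of_pos hp, ← abs_mul, abs_of_pos hp, mul_sub, ← mul_assoc,
          mul_inv_cancel₀ hp.ne', one_mul]
    _ ≤ lam ^ n * (n * (lam ^ (l + 1) * ((lam ^ n)⁻¹ * ∑ i, C i))) := by gcongr
    _ = _ := by field_simp

end Quadrature

/-! ### Quasi-interpolants with general kernels -/

section KernelSum

variable {n : ℕ} {F : Type*} [NormedAddCommGroup F] [NormedSpace ℝ F]

/-- The quasi-interpolant with an arbitrary vector valued kernel. -/
def kernelSum (φ : Rn n → F) (ε h : ℝ) (c : (Fin n → ℤ) → ℝ) (x : Rn n) : F :=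
  (h / ε) ^ n • ∑' j, c j • φ (ε⁻¹ • (x - gridPoint h j))

lemma quasiInterpolant_eq_kernelSum (ζ : Rn n → ℝ) (ε h : ℝ) (c : (Fin n → ℤ) → ℝ) :
    quasiInterpolant ζ ε h c = kernelSum ζ ε h c := by
  ext x
  simp only [quasiInterpolant, kernelSum, scaledKernel, smul_eq_mul]
  rw [div_pow, div_eq_mul_inv, mul_assoc, ← tsum_mul_left (a := (ε ^ n)⁻¹)]
  congr 1
  exact tsum_congr fun j => by ring

lemma smul_sub_gridPoint {ε h : ℝ} (hh : 0 < h) (x : Rn n) (j : Fin n → ℤ) :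
    ε⁻¹ • (x - gridPoint h j) = (h / ε) • (h⁻¹ • x - gridPoint 1 j) := by
  rw [gridPoint_eq_smul h, smul_sub, smul_sub, smul_smul, smul_smul]
  congr 2 <;> field_simp

lemma kernel_eq_zero {F : Type*} [Zero F] {φ : Rn n → F} {R : ℝ} (hφ : ∀ z, R < ‖z‖ → φ z = 0) {ε h : ℝ}
    (hε : 0 < ε) (hh : 0 < h) {x : Rn n} {j : Fin n → ℤ} (hj : j ∉ box (h⁻¹ • x) (R * (ε / h))) :
    φ (ε⁻¹ • (x - gridPoint h j)) = 0 := by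
  apply hφ
  by_contra hle
  apply hj
  apply mem_box_of_norm_le
  rw [smul_sub_gridPoint hh, norm_smul, Real.norm_eq_abs, abs_of_pos (by positivity), not_lt] at hle
  calc ‖h⁻¹ • x - gridPoint 1 j‖ = (h / ε * ‖h⁻¹ • x - gridPoint 1 j‖) * (ε / h) := by field_simp
    _ ≤ _ := by gcongr

lemma kernelSum_eq_sum {φ : Rn n → F} {R : ℝ} (hφ : ∀ z, R < ‖z‖ → φ z = 0) {ε h : ℝ}
    (hε : 0 < ε) (hh : 0 < h) (c : (Fin n → ℤ) → ℝ) {x : Rn n} {B : Finset (Fin n → ℤ)}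
    (hB : box (h⁻¹ • x) (R * (ε / h)) ⊆ B) :
    kernelSum φ ε h c x = (h / ε) ^ n • ∑ j ∈ B, c j • φ (ε⁻¹ • (x - gridPoint h j)) := by
  unfold kernelSum
  rw [tsum_eq_sum fun j hj => by rw [kernel_eq_zero hφ hε hh fun h' => hj (hB h'), smul_zero]]

lemma gradient_eq_zero {ζ : Rn n → ℝ} {R : ℝ} (h0 : ∀ z, R < ‖z‖ → ζ z = 0) (z : Rn n)
    (hz : R < ‖z‖) : gradient ζ z = 0 := by
  have : ζ =ᶠ[nhds z] fun _ => 0 :=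
    Filter.eventually_of_mem ((isOpen_lt continuous_const continuous_norm).mem_nhds hz) h0
  simp [gradient, this.fderiv_eq]

lemma gradient_neg_of_even {ζ : Rn n → ℝ} (hd : Differentiable ℝ ζ) (heven : ∀ x, ζ (-x) = ζ x)
    (z : Rn n) : gradient ζ (-z) = -gradient ζ z := by
  have h1 : HasFDerivAt (fun y => ζ (-y)) ((fderiv ℝ ζ (-z)).comp (-ContinuousLinearMap.id ℝ _)) z :=
    (hd (-z)).hasFDerivAt.comp z (hasFDerivAt_id z).neg
  simp only [heven] at h1
  have h2 : fderiv ℝ ζ z = -fderiv ℝ ζ (-z) := by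
    rw [h1.fderiv]; ext v; simp
  simp only [gradient]
  rw [h2, map_neg, neg_neg]

lemma gradient_apply (g : Rn n → ℝ) (x : Rn n) (i : Fin n) :
    gradient g x i = dirDeriv (basisVec i) g x := by
  have h := InnerProductSpace.toDual_symm_apply (𝕜 := ℝ) (x := basisVec i) (y := fderiv ℝ g x)
  rw [dirDeriv, ← h, basisVec, EuclideanSpace.inner_single_right]
  simp [gradient]

lemma hasGradientAt_quasiInterpolant {ζ : Rn n → ℝ} (hζ : Differentiable ℝ ζ)
    {R : ℝ} (h0 : ∀ z, R < ‖z‖ → ζ z = 0) {ε h : ℝ} (hε : 0 < ε) (hh : 0 < h)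
    (c : (Fin n → ℤ) → ℝ) (x : Rn n) :
    HasGradientAt (quasiInterpolant ζ ε h c) (ε⁻¹ • kernelSum (gradient ζ) ε h c x) x := by
  rw [quasiInterpolant_eq_kernelSum]
  set B := box (h⁻¹ • x) (R * (ε / h) + 1)
  have hev : kernelSum ζ ε h c =ᶠ[nhds x]
      fun y => (h / ε) ^ n • ∑ j ∈ B, c j • ζ (ε⁻¹ • (y - gridPoint h j)) := by
    have hcont : Continuous fun y : Rn n => ‖h⁻¹ • y - h⁻¹ • x‖ := by fun_prop
    have : ∀ᶠ y in nhds x, ‖h⁻¹ • y - h⁻¹ • x‖ < 1 :=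
      hcont.continuousAt.eventually_lt continuousAt_const (by simp)
    filter_upwards [this] with y hy
    exact kernelSum_eq_sum h0 hε hh c (box_subset_box hy.le)
  rw [hasGradientAt_iff_hasFDerivAt]
  refine HasFDerivAt.congr_of_eventuallyEq ?_ hev
  rw [kernelSum_eq_sum (gradient_eq_zero h0) hε hh c
    (show box (h⁻¹ • x) (R * (ε / h)) ⊆ B from fun j hj => by
      rw [mem_box] at hj ⊢; exact fun i => (hj i).trans (by linarith))]
  have h1 : ∀ j ∈ B, HasFDerivAt (fun y : Rn n => c j • ζ (ε⁻¹ • (y - gridPoint h j)))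
      (c j • ε⁻¹ • fderiv ℝ ζ (ε⁻¹ • (x - gridPoint h j))) x := fun j _ => by
    have h2 : HasFDerivAt (fun y : Rn n => ε⁻¹ • (y - gridPoint h j))
        (ε⁻¹ • ContinuousLinearMap.id ℝ (Rn n)) x :=
      ((hasFDerivAt_id x).sub_const _).fun_const_smul _
    have h3 := (hζ (ε⁻¹ • (x - gridPoint h j))).hasFDerivAt.comp x h2
    refine (h3.const_smul (c j)).congr_fderiv ?_
    ext v
    simp
  refine ((HasFDerivAt.fun_sum h1).fun_const_smul _).congr_fderiv ?_
  ext v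
  simp only [map_smul, map_sum, gradient, LinearIsometryEquiv.apply_symm_apply,
    _root_.smul_apply, _root_.sum_apply, smul_eq_mul]
  simp only [Finset.mul_sum]
  exact Finset.sum_congr rfl fun j _ => by ring

lemma kernelSum_gradient_apply {ζ : Rn n → ℝ} {R : ℝ} (h0 : ∀ z, R < ‖z‖ → ζ z = 0) {ε h : ℝ}
    (hε : 0 < ε) (hh : 0 < h) (c : (Fin n → ℤ) → ℝ) (x : Rn n) (i : Fin n) :
    kernelSum (gradient ζ) ε h c x i = kernelSum (dirDeriv (basisVec i) ζ) ε h c x := by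
  have h1 := gradient_eq_zero h0
  rw [kernelSum_eq_sum h1 hε hh c subset_rfl,
    kernelSum_eq_sum (fun z hz => by rw [← gradient_apply, h1 z hz]; rfl) hε hh c subset_rfl]
  simp [gradient_apply]

lemma kernelSum_sub {φ : Rn n → F} {R : ℝ} (hφ : ∀ z, R < ‖z‖ → φ z = 0) {ε h : ℝ}
    (hε : 0 < ε) (hh : 0 < h) (c c' : (Fin n → ℤ) → ℝ) (x : Rn n) :
    kernelSum φ ε h (fun j => c j - c' j) x = kernelSum φ ε h c x - kernelSum φ ε h c' x := by
  simp only [kernelSum_eq_sum hφ hε hh _ (subset_refl (box (h⁻¹ • x) (R * (ε / h)))), sub_smul,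
    Finset.sum_sub_distrib, smul_sub]

/-- At grid points the quasi-interpolant is a stencil operator. -/
lemma kernelSum_gridPoint {φ : Rn n → F} {R : ℝ} (hφ : ∀ z, R < ‖z‖ → φ z = 0) {ε h : ℝ}
    (hε : 0 < ε) (hh : 0 < h) (c : (Fin n → ℤ) → ℝ) (i : Fin n → ℤ) :
    kernelSum φ ε h c (gridPoint h i) = stencil (box 0 (R * (ε / h)))
      (fun v => (h / ε) ^ n • φ (ε⁻¹ • gridPoint h v)) c i := by
  rw [kernelSum_eq_sum hφ hε hh c subset_rfl, stencil, Finset.smul_sum]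
  have hi : h⁻¹ • gridPoint h i = gridPoint 1 i := by
    rw [gridPoint_eq_smul h, smul_smul, inv_mul_cancel₀ hh.ne', one_smul]
  rw [hi]
  have hmem : ∀ j, j ∈ box (gridPoint 1 i) (R * (ε / h)) ↔ i - j ∈ box (0 : Rn n) (R * (ε / h)) := by
    intro j
    simp only [mem_box]
    refine forall_congr' fun q => ?_
    rw [gridPoint_apply, ← abs_neg]
    simp
  refine Finset.sum_bij' (fun j _ => i - j) (fun v _ => i - v) (fun j hj => (hmem j).1 hj)
    (fun v hv => (hmem _).2 (by simpa using hv)) (by simp) (by simp) fun j _ => ?_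
  rw [← gridPoint_sub, smul_comm, sub_sub_cancel]

lemma norm_kernelSum_le {φ : Rn n → F} {R K : ℝ} (hR : 0 ≤ R) (hφ : ∀ z, R < ‖z‖ → φ z = 0)
    (hK : ∀ z, ‖φ z‖ ≤ K) {ε h : ℝ} (hh : 0 < h) (hε : h ≤ ε) {c : (Fin n → ℤ) → ℝ} {M : ℝ}
    (hc : ∀ j, |c j| ≤ M) (x : Rn n) : ‖kernelSum φ ε h c x‖ ≤ (2 * R + 1) ^ n * (K * M) := by
  have hε0 : 0 < ε := hh.trans_le hε
  have hM : 0 ≤ M := (abs_nonneg _).trans (hc 0)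
  have hK0 : 0 ≤ K := (norm_nonneg _).trans (hK 0)
  rw [kernelSum_eq_sum hφ hε0 hh c subset_rfl, norm_smul, Real.norm_eq_abs,
    abs_of_pos (by positivity)]
  calc _ ≤ (h / ε) ^ n * (((box (h⁻¹ • x) (R * (ε / h))).card : ℝ) * (K * M)) := by
        gcongr
        refine (norm_sum_le _ _).trans ?_
        rw [← nsmul_eq_mul, ← Finset.sum_const]
        refine Finset.sum_le_sum fun j _ => ?_
        rw [norm_smul, mul_comm]
        gcongr
        · exact hK _
        · exact hc j
    _ ≤ (h / ε) ^ n * ((2 * (R * (ε / h)) + 1) ^ n * (K * M)) := by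
        gcongr; exact card_box_le _ (by positivity)
    _ = (2 * R + h / ε) ^ n * (K * M) := by
        rw [← mul_assoc, ← mul_pow]; congr 2; field_simp
    _ ≤ _ := by
        gcongr
        rwa [div_le_one hε0]

/-- Taylor's formula with a bound for the remainder. -/
lemma abs_sub_taylor_le {g : Rn n → ℝ} {m : ℕ} (hm : 1 ≤ m) (hg : ContDiff ℝ m g) {B : ℝ}
    (hB : ∀ y, ‖iteratedFDeriv ℝ m g y‖ ≤ B) (x y : Rn n) :
    |g (x + y) - ∑ q ∈ Finset.range m, ((q.factorial : ℝ)⁻¹ * iteratedFDeriv ℝ q g x fun _ => y)|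
      ≤ B * ‖y‖ ^ m := by
  obtain ⟨m, rfl⟩ : ∃ q, m = q + 1 := ⟨m - 1, by omega⟩
  have hB0 : 0 ≤ B := (norm_nonneg _).trans (hB 0)
  rw [map_add_eq_sum_add_integral_iteratedFDeriv (f := g) (x := x) (y := y) (n := m)
    fun t _ => by exact_mod_cast hg.contDiffAt]
  simp only [smul_eq_mul, add_sub_cancel_left]
  rw [abs_mul, abs_of_pos (by positivity)]
  have h1 : ‖∫ t in (0 : ℝ)..1, (1 - t) ^ m * iteratedFDeriv ℝ (m + 1) g (x + t • y) fun _ => y‖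
      ≤ B * ‖y‖ ^ (m + 1) * |1 - 0| := by
    refine intervalIntegral.norm_integral_le_of_norm_le_const fun t ht => ?_
    rw [Set.uIoc_of_le zero_le_one] at ht
    have h2 : ‖iteratedFDeriv ℝ (m + 1) g (x + t • y) fun _ => y‖ ≤ B * ‖y‖ ^ (m + 1) := by
      refine (ContinuousMultilinearMap.le_opNorm _ _).trans ?_
      simp only [Finset.prod_const, Finset.card_univ, Fintype.card_fin]
      gcongr
      exact hB _
    have h3 : |(1 - t) ^ m| ≤ 1 := by
      rw [abs_pow]
      exact pow_le_one₀ (abs_nonneg _) (abs_le.2 ⟨by linarith [ht.2], by linarith [ht.1]⟩)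
    rw [norm_mul, Real.norm_eq_abs]
    calc _ ≤ 1 * (B * ‖y‖ ^ (m + 1)) := by gcongr
      _ = _ := one_mul _
  rw [sub_zero, abs_one, mul_one, Real.norm_eq_abs] at h1
  calc _ ≤ 1 * (B * ‖y‖ ^ (m + 1)) := by
        gcongr
        exact inv_le_one_of_one_le₀ (by exact_mod_cast Nat.one_le_iff_ne_zero.2 m.factorial_ne_zero)
    _ = _ := one_mul _

/-- Expansion into monomials serves two purposes: the moment conditions concern monomials, and
finitely many fixed integrands give quadrature constants independent of `A`. -/
lemma multilinear_apply_const {m : ℕ}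
    (A : ContinuousMultilinearMap ℝ (fun _ : Fin m => Rn n) ℝ) (z : Rn n) :
    (A fun _ => z) = ∑ i : Fin m → Fin n, (∏ p, z (i p)) * A fun p => basisVec (i p) := by
  have hz : z = ∑ q, z q • basisVec q := by
    ext q
    simp [Finset.sum_apply, Pi.single_apply]
  conv_lhs => rw [hz]
  rw [A.map_sum]
  exact Finset.sum_congr rfl fun i _ => A.map_smul_univ _ _

/-- The number of occurrences of each coordinate. -/
def countIndex {m : ℕ} (i : Fin m → Fin n) (q : Fin n) : ℕ := Fintype.card {p // i p = q}

lemma order_countIndex {m : ℕ} (i : Fin m → Fin n) : order (countIndex i) = m := by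
  unfold order countIndex
  rw [← Fintype.card_sigma]
  simpa using Fintype.card_congr (Equiv.sigmaFiberEquiv i)

lemma prod_eq_monomial {m : ℕ} (i : Fin m → Fin n) (z : Rn n) :
    ∏ p, z (i p) = monomial (countIndex i) z := by
  unfold monomial countIndex
  rw [← Fintype.prod_fiberwise' i fun q => z q]
  refine Finset.prod_congr rfl fun q _ => ?_
  rw [Finset.prod_const, Finset.card_univ]

lemma contDiff_monomial (α : Fin n → ℕ) {m : WithTop ℕ∞} : ContDiff ℝ m (monomial α) := by
  unfold monomial
  fun_prop

/-- Quadrature for the product of a homogeneous polynomial and a fixed function. -/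
lemma exists_quadrature_multilinear {φ : Rn n → ℝ} {l : ℕ} (hl : 1 ≤ l) (hφ : ContDiff ℝ l φ)
    (hc : HasCompactSupport φ) (m : ℕ) :
    ∃ C : ℝ, 0 ≤ C ∧ ∀ lam : ℝ, 0 < lam → lam ≤ 1 → ∀ z : Rn n,
      ∀ A : ContinuousMultilinearMap ℝ (fun _ : Fin m => Rn n) ℝ,
      |lam ^ n * latticeSum (fun x => (A fun _ => lam • x) * φ (lam • x)) z
        - ∫ y, (A fun _ => y) * φ y| ≤ C * lam ^ l * ‖A‖ := by
  have hk : ∀ i : Fin m → Fin n, ∃ C : ℝ, 0 ≤ C ∧ ∀ lam : ℝ, 0 < lam → lam ≤ 1 → ∀ z : Rn n,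
      |lam ^ n * latticeSum (fun x => monomial (countIndex i) (lam • x) * φ (lam • x)) z
        - ∫ y, monomial (countIndex i) y * φ y| ≤ C * lam ^ l := fun i =>
    exists_quadrature_bound (g := fun y => monomial (countIndex i) y * φ y) hl
      ((contDiff_monomial _).mul hφ) hc.mul_left
  choose C hC0 hC using hk
  refine ⟨∑ i, C i, Finset.sum_nonneg fun i _ => hC0 i, fun lam h1 h2 z A => ?_⟩
  obtain ⟨R, hR, h0⟩ := exists_radius hc
  have hint : ∀ i : Fin m → Fin n, Integrable fun y => monomial (countIndex i) y * φ y := fun i =>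
    (((contDiff_monomial (m := 0) _).continuous).mul hφ.continuous).integrable_of_hasCompactSupport
      hc.mul_left
  have hsum : ∀ i : Fin m → Fin n, Summable fun j : Fin n → ℤ =>
      monomial (countIndex i) (lam • (z - gridPoint 1 j)) * φ (lam • (z - gridPoint 1 j)) := fun i =>
    summable_of_ne_finset_zero (s := box z (R / lam)) fun j hj => by
      rw [h0, mul_zero]
      by_contra hle
      rw [not_lt, norm_smul, Real.norm_eq_abs, abs_of_pos h1, mul_comm, ← le_div_iff₀ h1] at hle
      exact hj (mem_box_of_norm_le hle)
  have e1 : ∀ y, (A fun _ => y) * φ y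
      = ∑ i, (A fun p => basisVec (i p)) * (monomial (countIndex i) y * φ y) := fun y => by
    rw [multilinear_apply_const, Finset.sum_mul]
    exact Finset.sum_congr rfl fun i _ => by rw [prod_eq_monomial]; ring
  have e2 : ∫ y, (A fun _ => y) * φ y
      = ∑ i, (A fun p => basisVec (i p)) * ∫ y, monomial (countIndex i) y * φ y := by
    simp only [e1]
    rw [integral_finsetSum _ fun i _ => (hint i).const_mul _]
    simp only [integral_const_mul]
  have e3 : latticeSum (fun x => (A fun _ => lam • x) * φ (lam • x)) z
      = ∑ i, (A fun p => basisVec (i p)) *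
        latticeSum (fun x => monomial (countIndex i) (lam • x) * φ (lam • x)) z := by
    unfold latticeSum
    simp only [e1]
    rw [Summable.tsum_finsetSum fun i _ => (hsum i).mul_left _]
    simp only [tsum_mul_left]
  rw [e2, e3, Finset.mul_sum, ← Finset.sum_sub_distrib, Finset.sum_mul, Finset.sum_mul]
  refine (Finset.abs_sum_le_sum_abs _ _).trans (Finset.sum_le_sum fun i _ => ?_)
  rw [mul_left_comm, ← mul_sub, abs_mul, mul_comm]
  have hA : |A fun p => basisVec (i p)| ≤ ‖A‖ := by
    simpa using A.le_opNorm fun p => basisVec (i p)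
  have := hC0 i
  exact mul_le_mul (hC i lam h1 h2 z) hA (abs_nonneg _) (by positivity)

/-- The generalised quasi-interpolant is, up to a small error, given by the moments of its
kernel. -/
lemma exists_kernelSum_bound {φ : Rn n → ℝ} {l : ℕ} (hl : 1 ≤ l) (hφ : ContDiff ℝ l φ)
    (hc : HasCompactSupport φ) {m : ℕ} (hm : 1 ≤ m) :
    ∃ C : ℝ, 0 ≤ C ∧ ∀ ε h : ℝ, 0 < h → h ≤ ε → ∀ g : Rn n → ℝ, ContDiff ℝ m g → ∀ B : ℝ,
      (∀ y, ‖iteratedFDeriv ℝ m g y‖ ≤ B) → ∀ x,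
      |kernelSum φ ε h (fun j => g (gridPoint h j)) x - ∑ q ∈ Finset.range m,
          (q.factorial : ℝ)⁻¹ * ((-ε) ^ q * ∫ z, (iteratedFDeriv ℝ q g x fun _ => z) * φ z)|
        ≤ C * (ε ^ m * B + (h / ε) ^ l * ∑ q ∈ Finset.range m, ε ^ q * ‖iteratedFDeriv ℝ q g x‖) := by
  obtain ⟨R, hR, h0⟩ := exists_radius hc
  choose C hC0 hC using exists_quadrature_multilinear hl hφ hc
  have hG : Continuous fun z : Rn n => ‖z‖ ^ m * |φ z| := by
    have := hφ.continuous; fun_prop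
  have hGc : HasCompactSupport fun z : Rn n => ‖z‖ ^ m * |φ z| := by
    have : HasCompactSupport fun z => |φ z| := hc.abs
    exact this.mul_left
  obtain ⟨D, hD⟩ := hGc.exists_bound_of_continuous hG
  have hD0 : 0 ≤ D := (norm_nonneg _).trans (hD 0)
  set C' := (2 * R + 1) ^ n * D + ∑ q ∈ Finset.range m, C q with hC'
  have hCs : 0 ≤ ∑ q ∈ Finset.range m, C q := Finset.sum_nonneg fun q _ => hC0 q
  have hp0 : 0 ≤ (2 * R + 1) ^ n * D := by positivity
  refine ⟨C', by positivity, fun ε h hh hε g hg B hB x => ?_⟩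
  have hε0 : 0 < ε := hh.trans_le hε
  have hB0 : 0 ≤ B := (norm_nonneg _).trans (hB 0)
  set lam := h / ε with hlam
  have hl0 : 0 < lam := by positivity
  have hl1 : lam ≤ 1 := (div_le_one hε0).2 hε
  set w := h⁻¹ • x
  set T := box w (R * (ε / h)) with hT
  have hTb : R * (ε / h) = R / lam := by rw [hlam]; field_simp
  have hz : ∀ j, ε⁻¹ • (x - gridPoint h j) = lam • (w - gridPoint 1 j) := fun j =>
    smul_sub_gridPoint hh x j
  have hlat : ∀ p : Rn n → ℝ, latticeSum (fun y => p (lam • y) * φ (lam • y)) w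
      = ∑ j ∈ T, p (lam • (w - gridPoint 1 j)) * φ (lam • (w - gridPoint 1 j)) := fun p => by
    refine latticeSum_eq_sum (ρ := R / lam) (fun y hy => ?_) (by rw [hT, hTb])
    rw [h0, mul_zero]
    rw [norm_smul, Real.norm_eq_abs, abs_of_pos hl0]
    rwa [div_lt_iff₀' hl0] at hy
  -- The grid point is `x - ε z`, where `z = lam • (w - gridPoint 1 j)` is the argument of the
  -- kernel; hence the powers of `-ε`.
  set rem : (Fin n → ℤ) → ℝ := fun j => g (gridPoint h j) - ∑ q ∈ Finset.range m,
    ((q.factorial : ℝ)⁻¹ * iteratedFDeriv ℝ q g x fun _ => -ε • lam • (w - gridPoint 1 j)) with hrem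
  have hremb : ∀ j, |rem j| ≤ B * (ε ^ m * ‖lam • (w - gridPoint 1 j)‖ ^ m) := fun j => by
    have h1 := abs_sub_taylor_le hm hg hB x (-ε • lam • (w - gridPoint 1 j))
    have h2 : x + -ε • lam • (w - gridPoint 1 j) = gridPoint h j := by
      rw [← hz, neg_smul, smul_smul, mul_inv_cancel₀ hε0.ne', one_smul]; abel
    rw [h2, norm_smul, norm_neg, Real.norm_eq_abs, abs_of_pos hε0, mul_pow] at h1
    exact h1
  have hks : kernelSum φ ε h (fun j => g (gridPoint h j)) x
      = lam ^ n * ∑ j ∈ T, rem j * φ (lam • (w - gridPoint 1 j))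
        + ∑ q ∈ Finset.range m, (q.factorial : ℝ)⁻¹ * ((-ε) ^ q *
          (lam ^ n * latticeSum (fun y => (iteratedFDeriv ℝ q g x fun _ => lam • y)
            * φ (lam • y)) w)) := by
    rw [kernelSum_eq_sum h0 hε0 hh _ subset_rfl]
    simp only [fun q => hlat (fun y => iteratedFDeriv ℝ q g x fun _ => y), smul_eq_mul]
    have h3 : ∀ q j, (iteratedFDeriv ℝ q g x fun _ => -ε • lam • (w - gridPoint 1 j))
        = (-ε) ^ q * iteratedFDeriv ℝ q g x fun _ => lam • (w - gridPoint 1 j) := fun q j => by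
      rw [ContinuousMultilinearMap.map_smul_univ (iteratedFDeriv ℝ q g x) (fun _ => -ε)]
      simp
    simp only [Finset.mul_sum]
    rw [Finset.sum_comm, ← Finset.sum_add_distrib]
    refine Finset.sum_congr rfl fun j _ => ?_
    rw [hz, hrem]
    simp only [h3]
    rw [sub_mul, mul_sub, Finset.sum_mul, Finset.mul_sum]
    have : ∀ a b c : ℝ, b = c → a = a - b + c := fun a b c h => by rw [h]; ring
    exact this _ _ _ (Finset.sum_congr rfl fun q _ => by ring)
  rw [hks, add_sub_assoc, ← Finset.sum_sub_distrib]
  -- The Taylor remainder is summed against the kernel: there are about `lam ^ (-n)` active points,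
  -- and `‖z‖ ^ m * |φ z|` is bounded.
  have hfirst : |lam ^ n * ∑ j ∈ T, rem j * φ (lam • (w - gridPoint 1 j))|
      ≤ (2 * R + 1) ^ n * D * (ε ^ m * B) := by
    have h4 := pow_mul_abs_latticeSum_le (n := n) (g := fun z : Rn n => ‖z‖ ^ m * |φ z|) (ρ := R)
      (B := D) (by linarith) (fun z hz => by simp [h0 z hz]) hD hl0 hl1 w
    have h5 : |∑ j ∈ T, rem j * φ (lam • (w - gridPoint 1 j))|
        ≤ (ε ^ m * B) * latticeSum (fun y : Rn n => ‖lam • y‖ ^ m * |φ (lam • y)|) w := by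
      have h6 : latticeSum (fun y : Rn n => ‖lam • y‖ ^ m * |φ (lam • y)|) w
          = ∑ j ∈ T, ‖lam • (w - gridPoint 1 j)‖ ^ m * |φ (lam • (w - gridPoint 1 j))| := by
        refine latticeSum_eq_sum (ρ := R / lam) (fun y hy => ?_) (by rw [hT, hTb])
        rw [h0, abs_zero, mul_zero]
        rw [norm_smul, Real.norm_eq_abs, abs_of_pos hl0]
        rwa [div_lt_iff₀' hl0] at hy
      rw [h6, Finset.mul_sum]
      refine (Finset.abs_sum_le_sum_abs _ _).trans (Finset.sum_le_sum fun j _ => ?_)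
      rw [abs_mul]
      calc _ ≤ B * (ε ^ m * ‖lam • (w - gridPoint 1 j)‖ ^ m) * |φ (lam • (w - gridPoint 1 j))| := by
            gcongr; exact hremb j
        _ = _ := by ring
    rw [abs_mul, abs_of_pos (by positivity : 0 < lam ^ n)]
    calc _ ≤ lam ^ n * ((ε ^ m * B)
          * latticeSum (fun y : Rn n => ‖lam • y‖ ^ m * |φ (lam • y)|) w) := by gcongr
      _ ≤ lam ^ n * ((ε ^ m * B)
          * |latticeSum (fun y : Rn n => ‖lam • y‖ ^ m * |φ (lam • y)|) w|) := by
          gcongr; exact le_abs_self _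
      _ = (ε ^ m * B) * (lam ^ n
          * |latticeSum (fun y : Rn n => ‖lam • y‖ ^ m * |φ (lam • y)|) w|) := by ring
      _ ≤ (ε ^ m * B) * ((2 * R + 1) ^ n * D) := by gcongr
      _ = _ := by ring
  have hsecond : ∀ q ∈ Finset.range m, |(q.factorial : ℝ)⁻¹ * ((-ε) ^ q * (lam ^ n
      * latticeSum (fun y => (iteratedFDeriv ℝ q g x fun _ => lam • y) * φ (lam • y)) w))
      - (q.factorial : ℝ)⁻¹ * ((-ε) ^ q * ∫ z, (iteratedFDeriv ℝ q g x fun _ => z) * φ z)|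
      ≤ (∑ q ∈ Finset.range m, C q) * (lam ^ l * (ε ^ q * ‖iteratedFDeriv ℝ q g x‖)) := by
    intro q hq
    rw [← mul_sub, ← mul_sub, abs_mul, abs_mul, abs_pow, abs_neg, abs_of_pos hε0,
      abs_of_pos (by positivity)]
    have h7 := hC q lam hl0 hl1 w (iteratedFDeriv ℝ q g x)
    have h8 : C q ≤ ∑ q ∈ Finset.range m, C q := Finset.single_le_sum (fun q _ => hC0 q) hq
    have h9 : (q.factorial : ℝ)⁻¹ ≤ 1 :=
      inv_le_one_of_one_le₀ (by exact_mod_cast Nat.one_le_iff_ne_zero.2 q.factorial_ne_zero)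
    calc _ ≤ 1 * (ε ^ q * (C q * lam ^ l * ‖iteratedFDeriv ℝ q g x‖)) := by gcongr
      _ = C q * (lam ^ l * (ε ^ q * ‖iteratedFDeriv ℝ q g x‖)) := by ring
      _ ≤ _ := by gcongr
  have hs0 : 0 ≤ lam ^ l * ∑ q ∈ Finset.range m, ε ^ q * ‖iteratedFDeriv ℝ q g x‖ := by positivity
  have hb0 : 0 ≤ ε ^ m * B := by positivity
  calc _ ≤ (2 * R + 1) ^ n * D * (ε ^ m * B) + ∑ q ∈ Finset.range m,
        (∑ q ∈ Finset.range m, C q) * (lam ^ l * (ε ^ q * ‖iteratedFDeriv ℝ q g x‖)) :=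
        (abs_add_le _ _).trans (add_le_add hfirst ((Finset.abs_sum_le_sum_abs _ _).trans
          (Finset.sum_le_sum hsecond)))
    _ = (2 * R + 1) ^ n * D * (ε ^ m * B) + (∑ q ∈ Finset.range m, C q)
        * (lam ^ l * ∑ q ∈ Finset.range m, ε ^ q * ‖iteratedFDeriv ℝ q g x‖) := by
        rw [← Finset.mul_sum, ← Finset.mul_sum]
    _ ≤ C' * (ε ^ m * B) + C'
        * (lam ^ l * ∑ q ∈ Finset.range m, ε ^ q * ‖iteratedFDeriv ℝ q g x‖) := by
        gcongr <;> rw [hC'] <;> linarith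
    _ = _ := by ring

end KernelSum

/-! ### Moments of the kernel and consistency -/

section Consistency

variable {n : ℕ}

/-- For `α i = 0` the truncated exponent is irrelevant, because the factor `α i` vanishes. -/
lemma dirDeriv_monomial (α : Fin n → ℕ) (i : Fin n) (x : Rn n) :
    dirDeriv (basisVec i) (monomial α) x
      = α i * monomial (Function.update α i (α i - 1)) x := by
  have hd : DifferentiableAt ℝ (monomial α) x :=
    (contDiff_monomial (m := 1) α).differentiable one_ne_zero x
  rw [dirDeriv, ← hd.lineDeriv_eq_fderiv]
  have h1 : ∀ β : Fin n → ℕ, ∀ y : Rn n,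
      monomial β y = y i ^ β i * ∏ q ∈ Finset.univ.erase i, y q ^ β q := fun β y =>
    (Finset.mul_prod_erase _ _ (Finset.mem_univ i)).symm
  have h2 : (fun t : ℝ => monomial α (x + t • basisVec i))
      = fun t : ℝ => (x i + t) ^ α i * ∏ q ∈ Finset.univ.erase i, x q ^ α q := by
    ext t
    rw [h1]
    congr 1
    · simp
    · refine Finset.prod_congr rfl fun q hq => ?_
      simp [Finset.ne_of_mem_erase hq]
  have h3 : HasDerivAt (fun t : ℝ => monomial α (x + t • basisVec i))
      (α i * (x i + 0) ^ (α i - 1) * 1 * ∏ q ∈ Finset.univ.erase i, x q ^ α q) 0 := by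
    rw [h2]
    exact (((hasDerivAt_id (0 : ℝ)).const_add (x i)).pow (α i)).mul_const _
  rw [lineDeriv, h3.deriv, h1]
  simp only [Function.update_self, add_zero, mul_one]
  rw [mul_assoc]
  congr 2
  exact Finset.prod_congr rfl fun q hq => by
    rw [Function.update_of_ne (Finset.ne_of_mem_erase hq)]

/-- Integration by parts transfers the moment conditions from `ζ` to its derivatives. -/
lemma integral_monomial_mul_dirDeriv {ζ : Rn n → ℝ} (hζ : ContDiff ℝ 1 ζ)
    (hc : HasCompactSupport ζ) (α : Fin n → ℕ) (i : Fin n) :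
    ∫ z, monomial α z * dirDeriv (basisVec i) ζ z
      = -(α i * ∫ z, monomial (Function.update α i (α i - 1)) z * ζ z) := by
  have hm : ∀ β : Fin n → ℕ, Continuous (monomial β) := fun β =>
    (contDiff_monomial (m := 0) β).continuous
  have hz := hζ.continuous
  have hd : Continuous (dirDeriv (basisVec i) ζ) :=
    (contDiff_dirDeriv (m := 0) (by simpa using hζ) (basisVec i)).continuous
  have hdc := hasCompactSupport_dirDeriv hc (basisVec i)
  have key := integral_mul_fderiv_eq_neg_fderiv_mul_of_integrable (𝕜 := ℝ) (μ := volume)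
    (f := monomial α) (g := ζ) (v := basisVec i)
    (by
      have h1 : (fun x => fderiv ℝ (monomial α) x (basisVec i) * ζ x)
          = fun x => α i * monomial (Function.update α i (α i - 1)) x * ζ x := by
        ext x; rw [← dirDeriv_monomial]; rfl
      rw [h1]
      exact ((continuous_const.mul (hm _)).mul hz).integrable_of_hasCompactSupport hc.mul_left)
    (((hm α).mul hd).integrable_of_hasCompactSupport hdc.mul_left)
    (((hm α).mul hz).integrable_of_hasCompactSupport hc.mul_left)
    (fun x _ => (contDiff_monomial (m := 1) α).differentiable one_ne_zero x)
    (fun x _ => hζ.differentiable one_ne_zero x)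
  change ∫ z, monomial α z * dirDeriv (basisVec i) ζ z
    = -∫ z, dirDeriv (basisVec i) (monomial α) z * ζ z at key
  rw [key]
  simp only [dirDeriv_monomial, mul_assoc, integral_const_mul]

lemma order_update {α : Fin n → ℕ} {i : Fin n} (h : α i ≠ 0) :
    order (Function.update α i (α i - 1)) + 1 = order α := by
  unfold order
  rw [← Finset.add_sum_erase _ _ (Finset.mem_univ i),
    ← Finset.add_sum_erase _ α (Finset.mem_univ i), Function.update_self]
  have : ∑ q ∈ Finset.univ.erase i, Function.update α i (α i - 1) q
      = ∑ q ∈ Finset.univ.erase i, α q := Finset.sum_congr rfl fun q hq => by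
    rw [Function.update_of_ne (Finset.ne_of_mem_erase hq)]
  rw [this]
  omega

lemma integral_multilinear_mul {φ : Rn n → ℝ} (hφ : Continuous φ) (hc : HasCompactSupport φ)
    {m : ℕ} (A : ContinuousMultilinearMap ℝ (fun _ : Fin m => Rn n) ℝ) :
    ∫ z, (A fun _ => z) * φ z = ∑ i : Fin m → Fin n,
      (A fun p => basisVec (i p)) * ∫ z, monomial (countIndex i) z * φ z := by
  have hint : ∀ i : Fin m → Fin n, Integrable fun y => monomial (countIndex i) y * φ y := fun i =>
    (((contDiff_monomial (m := 0) _).continuous).mul hφ).integrable_of_hasCompactSupport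
      hc.mul_left
  have e1 : ∀ y, (A fun _ => y) * φ y
      = ∑ i, (A fun p => basisVec (i p)) * (monomial (countIndex i) y * φ y) := fun y => by
    rw [multilinear_apply_const, Finset.sum_mul]
    exact Finset.sum_congr rfl fun i _ => by rw [prod_eq_monomial]; ring
  simp only [e1]
  rw [integral_finsetSum _ fun i _ => (hint i).const_mul _]
  simp only [integral_const_mul]

lemma monomial_eq_one {α : Fin n → ℕ} (h : order α = 0) (z : Rn n) : monomial α z = 1 := by
  have : ∀ i, α i = 0 := fun i => (Finset.sum_eq_zero_iff.1 h) i (Finset.mem_univ i)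
  simp [monomial, this]

namespace IsCompactKernel

variable {k s : ℕ} {ζ : Rn n → ℝ}

lemma integral_multilinear_eq_zero (hζ : IsCompactKernel k s ζ) {m : ℕ} (h1 : 1 ≤ m)
    (h2 : m ≤ k - 1) (A : ContinuousMultilinearMap ℝ (fun _ : Fin m => Rn n) ℝ) :
    ∫ z, (A fun _ => z) * ζ z = 0 := by
  rw [integral_multilinear_mul hζ.continuous hζ.compact_support]
  refine Finset.sum_eq_zero fun i _ => ?_
  rw [hζ.moments _ (by rwa [order_countIndex]) (by rwa [order_countIndex]), mul_zero]

/-- Integration by parts lowers the order by one, so orders up to `k` are admissible. Order `1` is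
excluded because it may lead to `∫ ζ = 1`; in order `0` the derivative of the monomial is zero. -/
lemma integral_monomial_dirDeriv_eq_zero (hζ : IsCompactKernel k s ζ) (hs : 1 ≤ s)
    {α : Fin n → ℕ} (hα : order α ≤ k) (hα1 : order α ≠ 1) (i : Fin n) :
    ∫ z, monomial α z * dirDeriv (basisVec i) ζ z = 0 := by
  rw [integral_monomial_mul_dirDeriv (hζ.smooth.of_le (by exact_mod_cast hs)) hζ.compact_support,
    neg_eq_zero]
  by_cases h : α i = 0
  · simp [h]
  · have h1 := order_update h
    rw [hζ.moments _ (by omega) (by omega), mul_zero]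

lemma integral_multilinear_dirDeriv_eq_zero (hζ : IsCompactKernel k s ζ) (hs : 1 ≤ s) {m : ℕ}
    (h1 : m ≤ k) (h2 : m ≠ 1) (i : Fin n)
    (A : ContinuousMultilinearMap ℝ (fun _ : Fin m => Rn n) ℝ) :
    ∫ z, (A fun _ => z) * dirDeriv (basisVec i) ζ z = 0 := by
  rw [integral_multilinear_mul
    (contDiff_dirDeriv (m := 0) (hζ.smooth.of_le (by exact_mod_cast hs)) _).continuous
    (hasCompactSupport_dirDeriv hζ.compact_support _)]
  refine Finset.sum_eq_zero fun q _ => ?_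
  rw [hζ.integral_monomial_dirDeriv_eq_zero hs (by rwa [order_countIndex])
    (by rwa [order_countIndex]), mul_zero]

lemma integral_linear_dirDeriv (hζ : IsCompactKernel k s ζ) (hs : 1 ≤ s) (i : Fin n)
    (A : ContinuousMultilinearMap ℝ (fun _ : Fin 1 => Rn n) ℝ) :
    ∫ z, (A fun _ => z) * dirDeriv (basisVec i) ζ z = -A fun _ => basisVec i := by
  rw [integral_multilinear_mul
    (contDiff_dirDeriv (m := 0) (hζ.smooth.of_le (by exact_mod_cast hs)) _).continuous
    (hasCompactSupport_dirDeriv hζ.compact_support _)]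
  have hz := hζ.smooth.of_le (show ((1 : ℕ) : WithTop ℕ∞) ≤ s by exact_mod_cast hs)
  have hval : ∀ q : Fin 1 → Fin n, ∫ z, monomial (countIndex q) z * dirDeriv (basisVec i) ζ z
      = if q 0 = i then -1 else 0 := fun q => by
    rw [integral_monomial_mul_dirDeriv hz hζ.compact_support]
    have hcount : countIndex q i = if q 0 = i then 1 else 0 := by
      unfold countIndex
      split_ifs with h
      · rw [Fintype.card_eq_one_iff]
        exact ⟨⟨0, h⟩, fun p => Subtype.ext (Subsingleton.elim _ _)⟩
      · rw [Fintype.card_eq_zero_iff]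
        exact ⟨fun p => h (by rw [Subsingleton.elim 0 p.1]; exact p.2)⟩
    split_ifs with h
    · have h0 : order (Function.update (countIndex q) i (countIndex q i - 1)) = 0 := by
        have := order_update (α := countIndex q) (i := i) (by rw [hcount, if_pos h]; norm_num)
        rw [order_countIndex] at this
        omega
      simp only [monomial_eq_one h0, one_mul, hζ.integral_eq_one]
      simp [hcount, h]
    · simp [hcount, h]
  rw [Finset.sum_eq_single fun _ => i]
  · rw [hval, if_pos rfl]; ring
  · intro q _ hq
    rw [hval, if_neg, mul_zero]
    intro h
    exact hq (funext fun p => by rw [Subsingleton.elim p 0]; exact h)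
  · simp

/-- Consistency of the quasi-interpolant. -/
lemma exists_consistency_value (hζ : IsCompactKernel k s ζ) {l : ℕ} (hl : 1 ≤ l) (hls : l ≤ s) :
    ∃ C : ℝ, 0 ≤ C ∧ ∀ ε h : ℝ, 0 < h → h ≤ ε → ε ≤ 1 → ∀ g : Rn n → ℝ, ContDiff ℝ k g →
      ∀ B M : ℝ, (∀ y, ‖iteratedFDeriv ℝ k g y‖ ≤ B) → ∀ x,
      (∀ q < k, ‖iteratedFDeriv ℝ q g x‖ ≤ M) →
      |quasiInterpolant ζ ε h (fun j => g (gridPoint h j)) x - g x|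
        ≤ C * (ε ^ k * B + (h / ε) ^ l * M) := by
  obtain ⟨C, hC0, hC⟩ := exists_kernelSum_bound hl (hζ.smooth.of_le (by exact_mod_cast hls))
    hζ.compact_support hζ.one_le_order
  refine ⟨C * k, by positivity, fun ε h hh hε hε1 g hg B M hB x hM => ?_⟩
  have hε0 : 0 < ε := hh.trans_le hε
  have hB0 : 0 ≤ B := (norm_nonneg _).trans (hB 0)
  have h1 := hC ε h hh hε g hg B hB x
  have hk := hζ.one_le_order
  rw [Finset.sum_eq_single_of_mem 0 (Finset.mem_range.2 hk) fun q hq hq0 => by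
    rw [hζ.integral_multilinear_eq_zero (by omega) (by rw [Finset.mem_range] at hq; omega),
      mul_zero, mul_zero]] at h1
  simp only [Nat.factorial_zero, Nat.cast_one, inv_one, pow_zero, one_mul,
    iteratedFDeriv_zero_apply, integral_const_mul, hζ.integral_eq_one, mul_one] at h1
  rw [quasiInterpolant_eq_kernelSum]
  refine h1.trans ?_
  have h2 : ∑ q ∈ Finset.range k, ε ^ q * ‖iteratedFDeriv ℝ q g x‖ ≤ k * M := by
    calc _ ≤ ∑ _q ∈ Finset.range k, M := Finset.sum_le_sum fun q hq =>
          (mul_le_of_le_one_left (norm_nonneg _) (pow_le_one₀ hε0.le hε1)).trans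
            (hM q (Finset.mem_range.1 hq))
      _ = _ := by simp
  have hk' : (1 : ℝ) ≤ k := by exact_mod_cast hk
  calc _ ≤ C * (k * (ε ^ k * B) + (h / ε) ^ l * (k * M)) := by
        have : 0 ≤ ε ^ k * B := by positivity
        have : ε ^ k * B ≤ k * (ε ^ k * B) := le_mul_of_one_le_left this hk'
        gcongr
    _ = _ := by ring

/-- The Taylor expansion goes one order further than for the values. Only the first moment survives,
and its sign cancels that of `-ε`, leaving `ε` times the derivative of `g`. -/
lemma exists_consistency_dirDeriv (hζ : IsCompactKernel k s ζ) {l : ℕ} (hl : 1 ≤ l)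
    (hls : l + 1 ≤ s) (i : Fin n) :
    ∃ C : ℝ, 0 ≤ C ∧ ∀ ε h : ℝ, 0 < h → h ≤ ε → ∀ g : Rn n → ℝ, ContDiff ℝ (k + 1 : ℕ) g →
      ∀ B : ℝ, (∀ y, ‖iteratedFDeriv ℝ (k + 1) g y‖ ≤ B) → ∀ x,
      |kernelSum (dirDeriv (basisVec i) ζ) ε h (fun j => g (gridPoint h j)) x
          - ε * dirDeriv (basisVec i) g x|
        ≤ C * (ε ^ (k + 1) * B
          + (h / ε) ^ l * ∑ q ∈ Finset.range (k + 1), ε ^ q * ‖iteratedFDeriv ℝ q g x‖) := by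
  obtain ⟨C, hC0, hC⟩ := exists_kernelSum_bound hl
    (contDiff_dirDeriv (hζ.smooth.of_le (by exact_mod_cast hls)) (basisVec i))
    (hasCompactSupport_dirDeriv hζ.compact_support (basisVec i)) (show 1 ≤ k + 1 by omega)
  refine ⟨C, hC0, fun ε h hh hε g hg B hB x => ?_⟩
  have h1 := hC ε h hh hε g hg B hB x
  have hk := hζ.one_le_order
  have hs : 1 ≤ s := by omega
  rw [Finset.sum_eq_single_of_mem 1 (Finset.mem_range.2 (by omega)) fun q hq hq1 => by
    rw [hζ.integral_multilinear_dirDeriv_eq_zero hs (by rw [Finset.mem_range] at hq; omega) hq1,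
      mul_zero, mul_zero], hζ.integral_linear_dirDeriv hs] at h1
  simp only [Nat.factorial_one, Nat.cast_one, inv_one, pow_one, one_mul, iteratedFDeriv_one_apply,
    neg_mul_neg] at h1
  exact h1

/-- Consistency of the gradient of the quasi-interpolant. -/
lemma exists_consistency_gradient (hζ : IsCompactKernel k s ζ) {l : ℕ} (hl : 1 ≤ l)
    (hls : l + 1 ≤ s) :
    ∃ C : ℝ, 0 ≤ C ∧ ∀ ε h : ℝ, 0 < h → h ≤ ε → ∀ g : Rn n → ℝ, ContDiff ℝ (k + 1 : ℕ) g →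
      ∀ B : ℝ, (∀ y, ‖iteratedFDeriv ℝ (k + 1) g y‖ ≤ B) → ∀ x,
      ‖ε⁻¹ • kernelSum (gradient ζ) ε h (fun j => g (gridPoint h j)) x - gradient g x‖
        ≤ C * (ε ^ k * B
          + (h / ε) ^ l * (ε⁻¹ * ∑ q ∈ Finset.range (k + 1), ε ^ q * ‖iteratedFDeriv ℝ q g x‖)) := by
  choose C hC0 hC using hζ.exists_consistency_dirDeriv hl hls
  obtain ⟨R, hR, h0⟩ := exists_radius hζ.compact_support
  refine ⟨∑ i, C i, Finset.sum_nonneg fun i _ => hC0 i, fun ε h hh hε g hg B hB x => ?_⟩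
  have hε0 : 0 < ε := hh.trans_le hε
  have h1 : ∀ i, ‖(kernelSum (gradient ζ) ε h (fun j => g (gridPoint h j)) x
      - ε • gradient g x) i‖ ≤ C i * (ε ^ (k + 1) * B
          + (h / ε) ^ l * ∑ q ∈ Finset.range (k + 1), ε ^ q * ‖iteratedFDeriv ℝ q g x‖) := fun i => by
    have := hC i ε h hh hε g hg B hB x
    rw [PiLp.sub_apply, PiLp.smul_apply, kernelSum_gradient_apply h0 hε0 hh, gradient_apply]
    exact this
  have h2 : ∀ v : Rn n, ‖v‖ ≤ ∑ i, ‖v i‖ := fun v => by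
    conv_lhs => rw [show v = ∑ i, v i • basisVec i by ext q; simp [Finset.sum_apply, Pi.single_apply]]
    refine (norm_sum_le _ _).trans (Finset.sum_le_sum fun i _ => ?_)
    rw [norm_smul]; simp
  have h3 : ε⁻¹ • kernelSum (gradient ζ) ε h (fun j => g (gridPoint h j)) x - gradient g x
      = ε⁻¹ • (kernelSum (gradient ζ) ε h (fun j => g (gridPoint h j)) x - ε • gradient g x) := by
    rw [smul_sub, smul_smul, inv_mul_cancel₀ hε0.ne', one_smul]
  rw [h3, norm_smul, norm_inv, Real.norm_eq_abs, abs_of_pos hε0]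
  calc _ ≤ ε⁻¹ * ∑ i, C i * (ε ^ (k + 1) * B
          + (h / ε) ^ l * ∑ q ∈ Finset.range (k + 1), ε ^ q * ‖iteratedFDeriv ℝ q g x‖) := by
        gcongr
        exact (h2 _).trans (Finset.sum_le_sum fun i _ => h1 i)
    _ = _ := by
        rw [← Finset.sum_mul, pow_succ]
        field_simp

/-- For even kernels the quadrature error of the gradient is smaller at the grid points. -/
lemma exists_consistency_gradient_gridPoint (hζ : IsCompactKernel k s ζ)
    (heven : ∀ x, ζ (-x) = ζ x) {l : ℕ} (hl : 1 ≤ l) (hls : l + 1 ≤ s) :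
    ∃ C : ℝ, 0 ≤ C ∧ ∀ ε h : ℝ, 0 < h → h ≤ ε → ε ≤ 1 → ∀ g : Rn n → ℝ, ContDiff ℝ (k + 1 : ℕ) g →
      ∀ B M : ℝ, (∀ y, ‖iteratedFDeriv ℝ (k + 1) g y‖ ≤ B) → ∀ i,
      (∀ q, 1 ≤ q → q ≤ k → ‖iteratedFDeriv ℝ q g (gridPoint h i)‖ ≤ M) →
      ‖gradient (quasiInterpolant ζ ε h fun j => g (gridPoint h j)) (gridPoint h i)
          - gradient g (gridPoint h i)‖
        ≤ C * (ε ^ k * B + (h / ε) ^ l * M) := by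
  obtain ⟨C, hC0, hC⟩ := hζ.exists_consistency_gradient hl hls
  obtain ⟨R, hR, h0⟩ := exists_radius hζ.compact_support
  have hd : Differentiable ℝ ζ := hζ.smooth.differentiable (by
    have : s ≠ 0 := by omega
    exact_mod_cast this)
  refine ⟨C * k, by positivity, fun ε h hh hε hε1 g hg B M hB i hM => ?_⟩
  have hε0 : 0 < ε := hh.trans_le hε
  have hB0 : 0 ≤ B := (norm_nonneg _).trans (hB 0)
  set x := gridPoint h i with hx
  rw [(hasGradientAt_quasiInterpolant hd h0 hε0 hh _ _).gradient]
  -- At a grid point the odd gradient stencil annihilates constants exactly, so `g` may be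
  -- normalised to vanish at `x`. This removes the term of order zero from the quadrature error.
  set g' : Rn n → ℝ := fun y => g y - g x with hg'
  have hder : ∀ q, 1 ≤ q → q ≤ k + 1 → ∀ y, iteratedFDeriv ℝ q g' y = iteratedFDeriv ℝ q g y :=
    fun q hq1 hq2 y => by
      have h1 := iteratedFDeriv_sub_apply (i := q) (x := y) (f := g) (g := fun _ => g x)
        (hg.contDiffAt.of_le (by exact_mod_cast hq2)) contDiffAt_const
      rw [iteratedFDeriv_const_of_ne (by omega)] at h1
      rw [show g' = g - fun _ => g x from rfl, h1]
      simp
  have h1 := hC ε h hh hε g' (hg.sub contDiff_const) B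
    (fun y => by rw [hder _ (by omega) le_rfl]; exact hB y) x
  have hgrad : gradient g' x = gradient g x := by
    simp only [gradient, hg', fderiv_sub_const]
  have hV : ∀ v ∈ box (0 : Rn n) (R * (ε / h)), -v ∈ box (0 : Rn n) (R * (ε / h)) := fun v hv => by
    rw [mem_box] at hv ⊢
    intro q
    have := hv q
    simpa using this
  have hks : kernelSum (gradient ζ) ε h (fun j => g' (gridPoint h j)) x
      = kernelSum (gradient ζ) ε h (fun j => g (gridPoint h j)) x := by
    rw [hg', kernelSum_sub (gradient_eq_zero h0) hε0 hh, hx,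
      kernelSum_gridPoint (gradient_eq_zero h0) hε0 hh (fun _ => g (gridPoint h i))]
    simp only [stencil]
    rw [← Finset.smul_sum, sum_eq_zero_of_odd hV, smul_zero, sub_zero]
    intro v
    rw [gridPoint_neg, smul_neg, gradient_neg_of_even hd heven, smul_neg]
  rw [hks, hgrad] at h1
  refine h1.trans ?_
  -- All remaining terms have `q ≥ 1`, and one power of `ε` compensates `ε⁻¹`.
  have h2 : ε⁻¹ * ∑ q ∈ Finset.range (k + 1), ε ^ q * ‖iteratedFDeriv ℝ q g' x‖ ≤ k * M := by
    rw [Finset.sum_range_succ']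
    have h3 : ‖iteratedFDeriv ℝ 0 g' x‖ = 0 := by simp [hg']
    rw [h3, mul_zero, add_zero, Finset.mul_sum]
    calc _ ≤ ∑ _q ∈ Finset.range k, M := Finset.sum_le_sum fun q hq => by
          rw [Finset.mem_range] at hq
          rw [hder (q + 1) (by omega) (by omega)]
          calc ε⁻¹ * (ε ^ (q + 1) * ‖iteratedFDeriv ℝ (q + 1) g x‖)
              = ε ^ q * ‖iteratedFDeriv ℝ (q + 1) g x‖ := by rw [pow_succ]; field_simp
            _ ≤ 1 * ‖iteratedFDeriv ℝ (q + 1) g x‖ := by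
                gcongr; exact pow_le_one₀ hε0.le hε1
            _ ≤ M := by rw [one_mul]; exact hM (q + 1) (by omega) (by omega)
      _ = _ := by simp
  have hk' : (1 : ℝ) ≤ k := by exact_mod_cast hζ.one_le_order
  calc _ ≤ C * (k * (ε ^ k * B) + (h / ε) ^ l * (k * M)) := by
        have : 0 ≤ ε ^ k * B := by positivity
        have : ε ^ k * B ≤ k * (ε ^ k * B) := le_mul_of_one_le_left this hk'
        gcongr
    _ = _ := by ring

end IsCompactKernel

end Consistency

/-! ### Global bounds for the nonlinearity -/

section Nonlinearity

variable {Z : Type*} [NormedAddCommGroup Z] [NormedSpace ℝ Z]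

lemma exists_bound_of_zero_off {X F : Type*} [TopologicalSpace X] [NormedAddCommGroup F] {T : ℝ}
    {H : ℝ × X → F} (hH : ContinuousOn H (Icc 0 T ×ˢ univ)) {K : Set X} (hK : IsCompact K)
    (h0 : ∀ t ∈ Icc 0 T, ∀ z ∉ K, H (t, z) = 0) :
    ∃ L : ℝ, 0 ≤ L ∧ ∀ t ∈ Icc 0 T, ∀ z, ‖H (t, z)‖ ≤ L := by
  obtain ⟨L, hL⟩ := (isCompact_Icc.prod hK).exists_bound_of_continuousOn
    (hH.mono (prod_mono subset_rfl (subset_univ K)))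
  refine ⟨max L 0, le_max_right _ _, fun t ht z => ?_⟩
  by_cases hz : z ∈ K
  · exact (hL _ ⟨ht, hz⟩).trans (le_max_left _ _)
  · simp [h0 t ht z hz]

lemma fderivWithin_eq_zero_off {F : Type*} [NormedAddCommGroup F] [NormedSpace ℝ F] {T : ℝ}
    {H : ℝ × Z → F} {K : Set Z} (hK : IsClosed K)
    (h0 : ∀ t ∈ Icc 0 T, ∀ z ∉ K, H (t, z) = 0) {t : ℝ} (ht : t ∈ Icc 0 T) {z : Z} (hz : z ∉ K) :
    fderivWithin ℝ H (Icc 0 T ×ˢ univ) (t, z) = 0 := by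
  have hev : H =ᶠ[nhdsWithin (t, z) (Icc 0 T ×ˢ univ)] fun _ => 0 := by
    have h1 : ∀ᶠ p : ℝ × Z in nhdsWithin (t, z) (Icc 0 T ×ˢ univ), p.2 ∉ K :=
      mem_nhdsWithin_of_mem_nhds
        ((hK.isOpen_compl.preimage continuous_snd).mem_nhds hz)
    filter_upwards [h1, self_mem_nhdsWithin] with p hp hp'
    exact h0 p.1 hp'.1 p.2 hp
  rw [hev.fderivWithin_eq (h0 t ht z hz)]
  simp

/-- Compact support makes the derivatives of order at most two bounded on the whole strip. The
differential is taken within `[0, T] × Z`, where it is unique, and then restricted to the directions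
of `Z` by `inr`. -/
lemma exists_nonlinearity_bound {T : ℝ} (hT : 0 < T) {G : ℝ × Z → ℝ}
    (hG : ContDiffOn ℝ 2 G (Icc 0 T ×ˢ univ)) {K : Set Z} (hK : IsCompact K)
    (h0 : ∀ t ∈ Icc 0 T, ∀ z ∉ K, G (t, z) = 0) :
    ∃ L : ℝ, 0 ≤ L ∧ (∀ t ∈ Icc 0 T, ∀ z, |G (t, z)| ≤ L) ∧
      ∃ D : ℝ → Z → Z →L[ℝ] ℝ, (∀ t ∈ Icc 0 T, ∀ z ∉ K, D t z = 0) ∧ ∀ t ∈ Icc 0 T,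
        (∀ z, ‖D t z‖ ≤ L) ∧ (∀ z z', ‖D t z' - D t z‖ ≤ L * ‖z' - z‖) ∧
        ∀ z z', |G (t, z') - G (t, z) - D t z (z' - z)| ≤ L * ‖z' - z‖ ^ 2 := by
  set s : Set (ℝ × Z) := Icc 0 T ×ˢ univ with hs
  have hu : UniqueDiffOn ℝ s := (uniqueDiffOn_Icc hT).prod uniqueDiffOn_univ
  have hconv : Convex ℝ s := (convex_Icc 0 T).prod convex_univ
  set H := fderivWithin ℝ G s with hH
  have hHd : ContDiffOn ℝ 1 H s := hG.fderivWithin hu (by norm_num)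
  have hH'c : ContinuousOn (fderivWithin ℝ H s) s := hHd.continuousOn_fderivWithin hu le_rfl
  have hH0 : ∀ t ∈ Icc 0 T, ∀ z ∉ K, H (t, z) = 0 := fun t ht z hz =>
    fderivWithin_eq_zero_off hK.isClosed h0 ht hz
  have hH'0 : ∀ t ∈ Icc 0 T, ∀ z ∉ K, fderivWithin ℝ H s (t, z) = 0 := fun t ht z hz =>
    fderivWithin_eq_zero_off hK.isClosed hH0 ht hz
  obtain ⟨L₀, hL₀, hb₀⟩ := exists_bound_of_zero_off hG.continuousOn hK h0
  obtain ⟨L₁, hL₁, hb₁⟩ := exists_bound_of_zero_off hHd.continuousOn hK hH0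
  obtain ⟨L₂, hL₂, hb₂⟩ := exists_bound_of_zero_off (T := T) (H := fderivWithin ℝ H s) hH'c hK hH'0
  set L := L₀ + L₁ + L₂
  have hlip : ∀ t ∈ Icc 0 T, ∀ z z', ‖H (t, z') - H (t, z)‖ ≤ L * ‖z' - z‖ := by
    intro t ht z z'
    have h1 := hconv.norm_image_sub_le_of_norm_fderivWithin_le (C := L₂)
      (hHd.differentiableOn one_ne_zero) (fun p hp => hb₂ p.1 hp.1 p.2)
      (show (t, z) ∈ s from ⟨ht, mem_univ _⟩) (show (t, z') ∈ s from ⟨ht, mem_univ _⟩)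
    have h2 : ‖((t, z') : ℝ × Z) - (t, z)‖ = ‖z' - z‖ := by simp [Prod.norm_def]
    rw [h2] at h1
    exact h1.trans (by gcongr; linarith)
  have hinr : ∀ v : Z, ‖ContinuousLinearMap.inr ℝ ℝ Z v‖ = ‖v‖ := fun v => by simp [Prod.norm_def]
  have hcomp : ∀ A : ℝ × Z →L[ℝ] ℝ, ‖A.comp (ContinuousLinearMap.inr ℝ ℝ Z)‖ ≤ ‖A‖ := fun A =>
    ContinuousLinearMap.opNorm_le_bound _ (norm_nonneg _) fun v => by
      refine (A.le_opNorm _).trans (le_of_eq ?_)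
      exact congrArg (‖A‖ * ·) (hinr v)
  refine ⟨L, by positivity, fun t ht z => (hb₀ t ht z).trans (by linarith),
    fun t z => (H (t, z)).comp (ContinuousLinearMap.inr ℝ ℝ Z),
    fun t ht z hz => by simp [hH0 t ht z hz], fun t ht => ?_⟩
  have hlip' : ∀ z z', ‖(H (t, z')).comp (ContinuousLinearMap.inr ℝ ℝ Z)
      - (H (t, z)).comp (ContinuousLinearMap.inr ℝ ℝ Z)‖ ≤ L * ‖z' - z‖ := fun z z' => by
    rw [← ContinuousLinearMap.sub_comp]
    exact (hcomp _).trans (hlip t ht z z')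
  refine ⟨fun z => (hcomp _).trans ((hb₁ t ht z).trans (by linarith)), hlip', fun z z' => ?_⟩
  have hd : ∀ y, HasFDerivAt (fun z => G (t, z)) ((H (t, y)).comp (ContinuousLinearMap.inr ℝ ℝ Z)) y :=
    fun y => by
      have h1 : HasFDerivWithinAt G (H (t, y)) s (t, y) :=
        (hG.differentiableOn two_ne_zero (t, y) ⟨ht, mem_univ _⟩).hasFDerivWithinAt
      have h2 := h1.comp y (hasFDerivAt_prodMk_right t y).hasFDerivWithinAt
        (s := univ) fun v _ => ⟨ht, mem_univ _⟩
      exact h2.hasFDerivAt Filter.univ_mem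
  -- Along the segment the differential stays within `L * ‖z' - z‖` of its value at `z`, which
  -- yields the quadratic remainder.
  have h3 := (convex_segment z z').norm_image_sub_le_of_norm_hasFDerivWithin_le'
    (f := fun z => G (t, z)) (φ := (H (t, z)).comp (ContinuousLinearMap.inr ℝ ℝ Z))
    (C := L * ‖z' - z‖) (fun y _ => (hd y).hasFDerivWithinAt) (fun y hy => (hlip' z y).trans (by
      have : ‖y - z‖ ≤ ‖z' - z‖ := by
        rw [segment_eq_image'] at hy
        obtain ⟨θ, hθ, rfl⟩ := hy
        simp only [add_sub_cancel_left, norm_smul, Real.norm_eq_abs, abs_of_nonneg hθ.1]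
        exact mul_le_of_le_one_left (norm_nonneg _) hθ.2
      gcongr)) (left_mem_segment ℝ z z') (right_mem_segment ℝ z z')
  rw [Real.norm_eq_abs] at h3
  exact h3.trans (le_of_eq (by ring))

end Nonlinearity

/-! ### Bounds and uniform continuity of the exact solution -/

section ExactSolution

variable {n : ℕ} {q r : ℕ} {T : ℝ} {ρ : ℝ → Rn n → ℝ}

namespace IsTimeSpaceCc

lemma exists_support (h : IsTimeSpaceCc q r T ρ) :
    ∃ R : ℝ, 1 ≤ R ∧ ∀ t ∈ Icc 0 T, ∀ x, R < ‖x‖ → ρ t x = 0 := by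
  obtain ⟨Ω, hΩ, h0⟩ := h.compact_support
  obtain ⟨R, hR⟩ := hΩ.isBounded.exists_norm_le
  refine ⟨max R 1, le_max_right _ _, fun t ht x hx => h0 t ht x fun hxΩ => ?_⟩
  have := hR x hxΩ
  have := le_max_left R 1
  linarith

lemma iteratedFDeriv_eq_zero {R : ℝ} {u : Rn n → ℝ} (hR : ∀ x, R < ‖x‖ → u x = 0) {m : ℕ} {x : Rn n}
    (hx : R < ‖x‖) : iteratedFDeriv ℝ m u x = 0 := by
  have hev : u =ᶠ[nhds x] 0 :=
    Filter.eventually_of_mem ((isOpen_lt continuous_const continuous_norm).mem_nhds hx) hR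
  rw [(hev.iteratedFDeriv ℝ m).self_of_nhds]
  simp

lemma exists_bound (h : IsTimeSpaceCc q r T ρ) :
    ∃ M : ℝ, 0 ≤ M ∧ ∀ m ≤ r, ∀ t ∈ Icc 0 T, ∀ x, ‖iteratedFDeriv ℝ m (ρ t) x‖ ≤ M := by
  obtain ⟨R, hR, h0⟩ := h.exists_support
  have hk : ∀ m : ℕ, ∃ L : ℝ, 0 ≤ L ∧
      (m ≤ r → ∀ t ∈ Icc 0 T, ∀ x, ‖iteratedFDeriv ℝ m (ρ t) x‖ ≤ L) := fun m => by
    by_cases hm : m ≤ r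
    · obtain ⟨L, hL, hb⟩ := exists_bound_of_zero_off (h.space_continuous m hm)
        (isCompact_closedBall (0 : Rn n) R) fun t ht z hz =>
          iteratedFDeriv_eq_zero (h0 t ht) (by simpa using hz)
      exact ⟨L, hL, fun _ => hb⟩
    · exact ⟨0, le_rfl, fun h' => absurd h' hm⟩
  choose L hL hb using hk
  refine ⟨∑ m ∈ Finset.range (r + 1), L m, Finset.sum_nonneg fun m _ => hL m, fun m hm t ht x =>
    (hb m hm t ht x).trans (Finset.single_le_sum (fun m _ => hL m) (Finset.mem_range.2 (by omega)))⟩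

/-- This is the source of the arbitrarily small factor in the borderline case `k = 2 + n/2`. For `‖x
- y‖ ≤ 1`, either both points lie in the ball of radius `R + 1` or both lie outside the support. -/
lemma exists_modulus (h : IsTimeSpaceCc q r T ρ) {η : ℝ} (hη : 0 < η) {m : ℕ} (hm : m ≤ r) :
    ∃ δ : ℝ, 0 < δ ∧ ∀ t ∈ Icc 0 T, ∀ x y : Rn n, ‖x - y‖ ≤ δ →
      ‖iteratedFDeriv ℝ m (ρ t) x - iteratedFDeriv ℝ m (ρ t) y‖ ≤ η := by
  obtain ⟨R, hR, h0⟩ := h.exists_support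
  have huc := (isCompact_Icc.prod (isCompact_closedBall (0 : Rn n) (R + 1))
    ).uniformContinuousOn_of_continuous
    ((h.space_continuous m hm).mono (prod_mono subset_rfl (subset_univ _)))
  rw [Metric.uniformContinuousOn_iff] at huc
  obtain ⟨δ, hδ, hu⟩ := huc η hη
  refine ⟨min (δ / 2) 1, by positivity, fun t ht x y hxy => ?_⟩
  have h1 : ‖x - y‖ ≤ 1 := hxy.trans (min_le_right _ _)
  have h2 : ‖x - y‖ < δ := (hxy.trans (min_le_left _ _)).trans_lt (by linarith)
  by_cases hx : ‖x‖ ≤ R + 1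
  · by_cases hy : ‖y‖ ≤ R + 1
    · have := hu (t, x) ⟨ht, by simpa using hx⟩ (t, y) ⟨ht, by simpa using hy⟩
        (by rw [Prod.dist_eq, dist_self, dist_eq_norm]; simpa [hδ] using h2)
      rw [dist_eq_norm] at this
      exact this.le
    · have h3 := norm_sub_norm_le y x
      rw [norm_sub_rev] at h3
      rw [iteratedFDeriv_eq_zero (h0 t ht) (x := x) (by linarith),
        iteratedFDeriv_eq_zero (h0 t ht) (x := y) (by linarith)]
      simpa using hη.le
  · have h3 := norm_sub_norm_le x y
    rw [iteratedFDeriv_eq_zero (h0 t ht) (x := x) (by linarith),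
      iteratedFDeriv_eq_zero (h0 t ht) (x := y) (by linarith)]
    simpa using hη.le

end IsTimeSpaceCc

lemma norm_gradient_sub_le {u : Rn n → ℝ} (hu : ContDiff ℝ 2 u) {M : ℝ}
    (hM : ∀ x, ‖iteratedFDeriv ℝ 2 u x‖ ≤ M) (x y : Rn n) :
    ‖gradient u x - gradient u y‖ ≤ M * ‖x - y‖ := by
  have h1 : Differentiable ℝ (fderiv ℝ u) :=
    (hu.fderiv_right (m := 1) (by norm_num)).differentiable one_ne_zero
  have h2 := convex_univ.norm_image_sub_le_of_norm_fderiv_le (𝕜 := ℝ) (f := fderiv ℝ u) (C := M)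
    (fun z _ => h1 z) (fun z _ => by
      rw [← norm_iteratedFDeriv_one, norm_iteratedFDeriv_fderiv]; exact hM z)
    (mem_univ y) (mem_univ x)
  rw [gradient, gradient, ← map_sub, LinearIsometryEquiv.norm_map]
  exact h2

lemma abs_sub_le_of_iteratedFDeriv {u : Rn n → ℝ} (hu : ContDiff ℝ 1 u) {M : ℝ}
    (hM : ∀ x, ‖iteratedFDeriv ℝ 1 u x‖ ≤ M) (x y : Rn n) : |u x - u y| ≤ M * ‖x - y‖ :=
  convex_univ.norm_image_sub_le_of_norm_fderiv_le (𝕜 := ℝ) (f := u) (C := M)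
    (fun z _ => hu.differentiable one_ne_zero z)
    (fun z _ => by rw [← norm_iteratedFDeriv_one]; exact hM z) (mem_univ y) (mem_univ x)

end ExactSolution

/-! ### Counting grid points and the stencils of the scheme -/

section Grid

variable {n : ℕ} {F : Type*} [NormedAddCommGroup F] [NormedSpace ℝ F]

lemma pow_le_card_box {ρ : ℝ} (hρ : 0 ≤ ρ) : ρ ^ n ≤ ((box (0 : Rn n) ρ).card : ℝ) := by
  rw [box, Fintype.card_piFinset, Nat.cast_prod]
  calc ρ ^ n = ∏ _i : Fin n, ρ := by simp
    _ ≤ _ := by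
      refine Finset.prod_le_prod (fun _ _ => hρ) fun i _ => ?_
      simp only [PiLp.zero_apply, zero_sub, zero_add, Int.card_Icc, Int.ceil_neg, sub_neg_eq_add]
      have h1 := Int.lt_floor_add_one ρ
      have h2 : 0 ≤ ⌊ρ⌋ := Int.floor_nonneg.2 hρ
      have h3 : (((⌊ρ⌋ + 1 + ⌊ρ⌋).toNat : ℤ) : ℝ) = ⌊ρ⌋ + 1 + ⌊ρ⌋ := by
        rw [Int.toNat_of_nonneg (by omega)]; push_cast; ring
      rw [Int.cast_natCast] at h3
      rw [h3]
      have h4 : (0 : ℝ) ≤ ⌊ρ⌋ := by exact_mod_cast h2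
      linarith

lemma norm_gridPoint_le {h ρ : ℝ} (hh : 0 ≤ h) {w : Fin n → ℤ} (hw : w ∈ box (0 : Rn n) ρ) :
    ‖gridPoint h w‖ ≤ n * (ρ * h) := by
  rw [mem_box] at hw
  have h2 : ‖gridPoint h w‖ ≤ ∑ i, ‖gridPoint h w i‖ := by
    conv_lhs => rw [show gridPoint h w = ∑ i, gridPoint h w i • basisVec i by
      ext q; simp [Finset.sum_apply, Pi.single_apply]]
    refine (norm_sum_le _ _).trans (Finset.sum_le_sum fun i _ => ?_)
    rw [norm_smul]; simp
  refine h2.trans ?_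
  calc ∑ i, ‖gridPoint h w i‖ ≤ ∑ _i : Fin n, ρ * h := Finset.sum_le_sum fun i _ => by
        rw [gridPoint_apply, norm_mul, Real.norm_eq_abs, Real.norm_eq_abs, abs_of_nonneg hh]
        have := hw i
        rw [PiLp.zero_apply, zero_sub, abs_neg] at this
        gcongr
    _ = _ := by simp

lemma sumSq_le_card_mul {J G : Type*} [NormedAddCommGroup G] {u : J → G} {S : Finset J} {δ : ℝ} (h0 : ∀ j ∉ S, u j = 0)
    (hδ : ∀ j, ‖u j‖ ≤ δ) : sumSq u ≤ S.card * δ ^ 2 := by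
  unfold sumSq
  rw [tsum_eq_sum (s := S) fun j hj => by simp [h0 j hj], ← nsmul_eq_mul, ← Finset.sum_const]
  exact Finset.sum_le_sum fun j _ => pow_le_pow_left₀ (norm_nonneg _) (hδ j) 2

lemma kernelSum_add_right (φ : Rn n → F) (ε h : ℝ) (c : (Fin n → ℤ) → ℝ) (w : Fin n → ℤ) (x : Rn n) :
    kernelSum φ ε h (fun j => c (j + w)) x = kernelSum φ ε h c (x + gridPoint h w) := by
  unfold kernelSum
  congr 1
  rw [← tsum_add_right (fun j => c j • φ (ε⁻¹ • (x + gridPoint h w - gridPoint h j))) w]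
  exact tsum_congr fun j => by rw [gridPoint_add]; congr 3; abel

lemma kernelSum_smul {φ : Rn n → F} {R : ℝ} (hφ : ∀ z, R < ‖z‖ → φ z = 0) {ε h : ℝ}
    (hε : 0 < ε) (hh : 0 < h) (r : ℝ) (c : (Fin n → ℤ) → ℝ) (x : Rn n) :
    kernelSum (fun z => r • φ z) ε h c x = r • kernelSum φ ε h c x := by
  rw [kernelSum_eq_sum hφ hε hh c subset_rfl,
    kernelSum_eq_sum (φ := fun z => r • φ z) (fun z hz => by rw [hφ z hz, smul_zero]) hε hh c
      subset_rfl, smul_comm r, Finset.smul_sum (r := r)]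
  congr 1
  exact Finset.sum_congr rfl fun j _ => smul_comm _ _ _

/-- Cauchy-Schwarz over the roughly `(ε / h) ^ n` active points: one of the two factors `(h / ε) ^
n` from the weight is used up by their number. -/
lemma normSq_kernelSum_le {φ : Rn n → F} {R K : ℝ} (hR : 1 ≤ R) (hφ : ∀ z, R < ‖z‖ → φ z = 0)
    (hK : ∀ z, ‖φ z‖ ≤ K) {ε h : ℝ} (hh : 0 < h) (hε : h ≤ ε) {c : (Fin n → ℤ) → ℝ}
    (hc : c.HasFiniteSupport) (x : Rn n) :
    ‖kernelSum φ ε h c x‖ ^ 2 ≤ K ^ 2 * (3 * R) ^ n * ((h / ε) ^ n * sumSq c) := by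
  have hε0 : 0 < ε := hh.trans_le hε
  have hs := sumSq_nonneg c
  rw [kernelSum_eq_sum hφ hε0 hh c subset_rfl, norm_smul, mul_pow, Real.norm_eq_abs,
    abs_of_pos (by positivity)]
  set B := box (h⁻¹ • x) (R * (ε / h))
  have h1 := normSq_sum_smul_le (V := B) (κ := fun j => φ (ε⁻¹ • (x - gridPoint h j)))
    (fun j _ => hK _) c
  have h2 : ∑ j ∈ B, c j ^ 2 ≤ sumSq c := by
    simpa using sum_normSq_le_sumSq hc B (g := id) Function.injective_id.injOn
  have h3 : (B.card : ℝ) ≤ (3 * R) ^ n * (ε / h) ^ n := by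
    refine (card_box_le _ (by positivity)).trans ?_
    rw [← mul_pow]
    have h4 : 1 ≤ ε / h := (one_le_div hh).2 hε
    gcongr
    nlinarith
  calc _ ≤ ((h / ε) ^ n) ^ 2 * (K ^ 2 * ((3 * R) ^ n * (ε / h) ^ n) * sumSq c) := by
        gcongr
        refine h1.trans ?_
        gcongr
    _ = K ^ 2 * (3 * R) ^ n * ((h / ε) ^ n * (h / ε * (ε / h)) ^ n * sumSq c) := by
        rw [mul_pow (h / ε)]; ring
    _ = _ := by
        rw [div_mul_div_cancel₀ hε0.ne', div_self hh.ne', one_pow, mul_one]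

/-- A quasi-interpolant vanishes where all coefficients of the neighbouring grid points vanish. -/
lemma kernelSum_eq_zero {φ : Rn n → F} {R : ℝ} (hφ : ∀ z, R < ‖z‖ → φ z = 0) {ε h : ℝ}
    (hε : 0 < ε) {c : (Fin n → ℤ) → ℝ} {x : Rn n}
    (hc : ∀ j, ‖x - gridPoint h j‖ ≤ R * ε → c j = 0) : kernelSum φ ε h c x = 0 := by
  unfold kernelSum
  have : ∀ j, c j • φ (ε⁻¹ • (x - gridPoint h j)) = 0 := fun j => by
    by_cases hj : ‖x - gridPoint h j‖ ≤ R * ε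
    · rw [hc j hj, zero_smul]
    · rw [hφ, smul_zero]
      rw [norm_smul, norm_inv, Real.norm_eq_abs, abs_of_pos hε, ← div_eq_inv_mul,
        lt_div_iff₀ hε]
      exact not_le.1 hj
  simp [this]

lemma card_W_le {R ε h : ℝ} (hR : 1 ≤ R) (hh : 0 < h) (hε : h ≤ ε) :
    ((box (0 : Rn n) (2 * R * (ε / h))).card : ℝ) ≤ (5 * R) ^ n * (ε / h) ^ n := by
  have h4 : 1 ≤ ε / h := (one_le_div hh).2 hε
  refine (card_box_le _ (by positivity)).trans ?_
  rw [← mul_pow]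
  gcongr
  nlinarith

lemma le_card_W {R ε h : ℝ} (hR : 1 ≤ R) (hh : 0 < h) (hε : h ≤ ε) :
    (ε / h) ^ n ≤ ((box (0 : Rn n) (2 * R * (ε / h))).card : ℝ) := by
  have h4 : 1 ≤ ε / h := (one_le_div hh).2 hε
  refine le_trans ?_ (pow_le_card_box (by positivity))
  gcongr
  nlinarith

/-- The normalisation `(h / ε) ^ n` of the quasi-interpolant is, up to a constant, one over the
number of points of the larger stencil. -/
lemma div_pow_le_card_W {R ε h : ℝ} (hR : 1 ≤ R) (hh : 0 < h) (hε : h ≤ ε) :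
    (h / ε) ^ n ≤ (5 * R) ^ n / ((box (0 : Rn n) (2 * R * (ε / h))).card : ℝ) := by
  have hε0 : 0 < ε := hh.trans_le hε
  have h1 := card_W_le (n := n) hR hh hε
  have h2 := le_card_W (n := n) hR hh hε
  have h3 : 0 < (ε / h) ^ n := by positivity
  rw [le_div_iff₀ (h3.trans_le h2)]
  calc _ ≤ (h / ε) ^ n * ((5 * R) ^ n * (ε / h) ^ n) := by gcongr
    _ = (5 * R) ^ n * (h / ε * (ε / h)) ^ n := by rw [mul_pow (h / ε)]; ring
    _ = _ := by rw [div_mul_div_cancel₀ hε0.ne', div_self hh.ne', one_pow, mul_one]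

/-- The stencil weights of the quasi-interpolant. -/
def stencilWeight (φ : Rn n → F) (ε h : ℝ) (v : Fin n → ℤ) : F :=
  (h / ε) ^ n • φ (ε⁻¹ • gridPoint h v)

/-- The larger box has twice the half side length because it must contain all differences of points
of the smaller one. Evenness of `ζ` provides the oddness of the gradient weights. -/
lemma isStencilPair {ζ : Rn n → ℝ} (hd : Differentiable ℝ ζ) (heven : ∀ x, ζ (-x) = ζ x)
    {R K₀ K : ℝ} (hR : 1 ≤ R) (hK₀ : ∀ z, |ζ z| ≤ K₀) (hK₁ : ∀ z, ‖gradient ζ z‖ ≤ K₀)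
    (hK : (5 * R) ^ n * K₀ ≤ K) (hK1 : 1 ≤ K) {ε h : ℝ} (hh : 0 < h) (hε : h ≤ ε) (hε1 : ε ≤ 1) :
    IsStencilPair (box (0 : Rn n) (R * (ε / h))) (box (0 : Rn n) (2 * R * (ε / h))) ε K
      (stencilWeight ζ ε h) (stencilWeight (fun z => ε⁻¹ • gradient ζ z) ε h) := by
  have hε0 : 0 < ε := hh.trans_le hε
  have h5 := div_pow_le_card_W (n := n) hR hh hε
  have hN : 0 < ((box (0 : Rn n) (2 * R * (ε / h))).card : ℝ) :=
    lt_of_lt_of_le (by positivity) (le_card_W (n := n) hR hh hε)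
  refine ⟨hK1, hε0, hε1, ?_, fun v hv => ?_, fun v hv v' hv' => ?_, fun v _ => ?_, fun v _ => ?_,
    fun v => ?_⟩
  · rw [mem_box]; intro i; simp; positivity
  · rw [mem_box] at hv ⊢
    intro q
    simpa using hv q
  · rw [mem_box] at hv hv' ⊢
    intro q
    have h1 := hv q
    have h2 := hv' q
    simp only [PiLp.zero_apply, zero_sub, abs_neg, Pi.sub_apply, Int.cast_sub] at h1 h2 ⊢
    have := abs_sub (v q : ℝ) (v' q : ℝ)
    linarith
  · rw [stencilWeight, norm_smul, Real.norm_eq_abs, abs_of_pos (by positivity : 0 < (h / ε) ^ n)]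
    calc _ ≤ (5 * R) ^ n / ((box (0 : Rn n) (2 * R * (ε / h))).card : ℝ) * K₀ := by
          gcongr; exact hK₀ _
      _ = (5 * R) ^ n * K₀ / ((box (0 : Rn n) (2 * R * (ε / h))).card : ℝ) := by ring
      _ ≤ _ := by gcongr
  · rw [stencilWeight, norm_smul, norm_smul, Real.norm_eq_abs,
      abs_of_pos (by positivity : 0 < (h / ε) ^ n), norm_inv, Real.norm_eq_abs, abs_of_pos hε0]
    calc _ ≤ (5 * R) ^ n / ((box (0 : Rn n) (2 * R * (ε / h))).card : ℝ) * (ε⁻¹ * K₀) := by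
          gcongr; exact hK₁ _
      _ = (5 * R) ^ n * K₀ / (((box (0 : Rn n) (2 * R * (ε / h))).card : ℝ) * ε) := by field_simp
      _ ≤ _ := by gcongr
  · rw [stencilWeight, stencilWeight, gridPoint_neg, smul_neg, gradient_neg_of_even hd heven,
      smul_neg, smul_neg]

end Grid

/-! ### Derivation of the error equation -/

section ErrorEq

variable {n : ℕ}

/-- The error of the scheme satisfies an `ErrorEquation`. -/
lemma errorEquation {ζ : Rn n → ℝ} (hd : Differentiable ℝ ζ) {R : ℝ} (hR : 1 ≤ R)
    (h0 : ∀ z, R < ‖z‖ → ζ z = 0) {ε h : ℝ} (hh : 0 < h) (hε : h ≤ ε)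
    {g : Rn n × ℝ × Rn n → ℝ} {D : Rn n × ℝ × Rn n → (Rn n × ℝ × Rn n) →L[ℝ] ℝ} {L M K : ℝ}
    (hL : 0 ≤ L) (hM : 0 ≤ M) (hD : ∀ z, ‖D z‖ ≤ L)
    (hDlip : ∀ z z', ‖D z' - D z‖ ≤ L * ‖z' - z‖)
    (hDT : ∀ z z', |g z' - g z - D z (z' - z)| ≤ L * ‖z' - z‖ ^ 2)
    {u : Rn n → ℝ} (hu1 : ∀ x y, |u x - u y| ≤ M * ‖x - y‖)
    (hu2 : ∀ x y, ‖gradient u x - gradient u y‖ ≤ M * ‖x - y‖)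
    (hfu : Function.HasFiniteSupport fun j : Fin n → ℤ => u (gridPoint h j))
    (hfg : Function.HasFiniteSupport fun j : Fin n → ℤ => gradient u (gridPoint h j))
    {c : (Fin n → ℤ) → ℝ} (hc : c.HasFiniteSupport) (hK1 : L ≤ K)
    (hK2 : L * ((1 + M) * (n * (2 * R))) ≤ K)
    (hU : ∀ j, |quasiInterpolant ζ ε h (fun j => u (gridPoint h j)) (gridPoint h j)
      - u (gridPoint h j)| ≤ K * ε)
    (hP : ∀ j, ‖gradient (quasiInterpolant ζ ε h fun j => u (gridPoint h j)) (gridPoint h j)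
      - gradient u (gridPoint h j)‖ ≤ K * ε) :
    ∃ (a : (Fin n → ℤ) → ℝ) (b : (Fin n → ℤ) → Rn n →L[ℝ] ℝ) (Q : (Fin n → ℤ) → ℝ),
      ErrorEquation (box (0 : Rn n) (R * (ε / h))) (box (0 : Rn n) (2 * R * (ε / h))) ε K
      (stencilWeight ζ ε h) (stencilWeight (fun z => ε⁻¹ • gradient ζ z) ε h)
      (fun j => c j - u (gridPoint h j))
      (fun j => -g (gridPoint h j, quasiInterpolant ζ ε h c (gridPoint h j),
          gradient (quasiInterpolant ζ ε h c) (gridPoint h j))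
        + g (gridPoint h j, u (gridPoint h j), gradient u (gridPoint h j)))
      a b Q
      (fun j => quasiInterpolant ζ ε h (fun j => u (gridPoint h j)) (gridPoint h j)
        - u (gridPoint h j))
      (fun j => gradient (quasiInterpolant ζ ε h fun j => u (gridPoint h j)) (gridPoint h j)
        - gradient u (gridPoint h j)) := by
  have hε0 : 0 < ε := hh.trans_le hε
  have h0g := gradient_eq_zero h0
  have h0g' : ∀ z, R < ‖z‖ → ε⁻¹ • gradient ζ z = 0 := fun z hz => by rw [h0g z hz, smul_zero]
  set V := box (0 : Rn n) (R * (ε / h))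
  set W := box (0 : Rn n) (2 * R * (ε / h))
  set μ := stencilWeight ζ ε h
  set κ := stencilWeight (fun z => ε⁻¹ • gradient ζ z) ε h
  have hqv : ∀ (c : (Fin n → ℤ) → ℝ) j, quasiInterpolant ζ ε h c (gridPoint h j) = stencil V μ c j :=
    fun c j => by rw [quasiInterpolant_eq_kernelSum, kernelSum_gridPoint h0 hε0 hh]; rfl
  have hqg : ∀ (c : (Fin n → ℤ) → ℝ) j,
      gradient (quasiInterpolant ζ ε h c) (gridPoint h j) = stencil V κ c j := fun c j => by
    rw [(hasGradientAt_quasiInterpolant hd h0 hε0 hh _ _).gradient,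
      ← kernelSum_smul h0g hε0 hh, kernelSum_gridPoint h0g' hε0 hh]
    rfl
  simp only [hqv, hqg] at hU hP ⊢
  -- The nonlinearity is linearised at the exact state `z j`, so the coefficients inherit the
  -- regularity of the solution and do not depend on the scheme.
  set z : (Fin n → ℤ) → Rn n × ℝ × Rn n := fun j =>
    (gridPoint h j, u (gridPoint h j), gradient u (gridPoint h j)) with hz
  set z' : (Fin n → ℤ) → Rn n × ℝ × Rn n := fun j =>
    (gridPoint h j, stencil V μ c j, stencil V κ c j) with hz'
  set I : Rn n →L[ℝ] Rn n × ℝ × Rn n := (ContinuousLinearMap.inr ℝ (Rn n) (ℝ × Rn n)).comp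
    (ContinuousLinearMap.inr ℝ ℝ (Rn n)) with hI
  have hIv : ∀ v, I v = (0, 0, v) := fun v => rfl
  have hIn' : ∀ v, ‖I v‖ = ‖v‖ := fun v => by rw [hIv]; simp [Prod.norm_def]
  have hIn : ∀ A : (Rn n × ℝ × Rn n) →L[ℝ] ℝ, ‖A.comp I‖ ≤ ‖A‖ := fun A =>
    ContinuousLinearMap.opNorm_le_bound _ (norm_nonneg _) fun v => by
      exact (A.le_opNorm _).trans (congrArg (‖A‖ * ·) (hIn' v)).le
  have hAe : ∀ A : (Rn n × ℝ × Rn n) →L[ℝ] ℝ, |A (0, 1, 0)| ≤ ‖A‖ := fun A => by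
    have := A.le_opNorm (0, 1, 0)
    simpa [Prod.norm_def] using this
  -- A stencil shift has length at most `n * (2 * R) * ε`, so the exact state, and with it `a` and
  -- `b`, varies by `O(ε)`.
  have hzlip : ∀ w ∈ W, ∀ j, L * ‖z (j + w) - z j‖ ≤ K * ε := fun w hw j => by
    have h1 := norm_gridPoint_le hh.le hw
    have h2 : gridPoint h (j + w) - gridPoint h j = gridPoint h w := by
      rw [gridPoint_add, add_sub_cancel_left]
    have h3 : ‖z (j + w) - z j‖ ≤ (1 + M) * ‖gridPoint h w‖ := by
      have e1 := hu1 (gridPoint h (j + w)) (gridPoint h j)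
      have e2 := hu2 (gridPoint h (j + w)) (gridPoint h j)
      rw [h2] at e1 e2
      have h4 : M * ‖gridPoint h w‖ ≤ (1 + M) * ‖gridPoint h w‖ := by gcongr; linarith
      simp only [hz, Prod.norm_def, Prod.mk_sub_mk, h2]
      refine max_le ?_ (max_le ?_ ?_)
      · exact le_mul_of_one_le_left (norm_nonneg _) (by linarith)
      · exact e1.trans h4
      · exact e2.trans h4
    calc L * ‖z (j + w) - z j‖ ≤ L * ((1 + M) * (n * (2 * R * (ε / h) * h))) := by
          gcongr; exact h3.trans (by gcongr)
      _ = L * ((1 + M) * (n * (2 * R))) * ε := by field_simp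
      _ ≤ _ := by gcongr
  have hdiff : ∀ j, z' j - z j = (0, stencil V μ (fun j => c j - u (gridPoint h j)) j
      + (stencil V μ (fun j => u (gridPoint h j)) j - u (gridPoint h j)),
      stencil V κ (fun j => c j - u (gridPoint h j)) j
      + (stencil V κ (fun j => u (gridPoint h j)) j - gradient u (gridPoint h j))) := fun j => by
    simp only [hz, hz', Prod.mk_sub_mk, sub_self, stencil_sub]
    congr 2 <;> abel
  have hQle : ∀ j, |g (z' j) - g (z j) - D (z j) (z' j - z j)| ≤ L *
      ((stencil V μ (fun j => c j - u (gridPoint h j)) j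
        + (stencil V μ (fun j => u (gridPoint h j)) j - u (gridPoint h j))) ^ 2
      + ‖stencil V κ (fun j => c j - u (gridPoint h j)) j
        + (stencil V κ (fun j => u (gridPoint h j)) j - gradient u (gridPoint h j))‖ ^ 2) := fun j => by
    refine (hDT _ _).trans (mul_le_mul_of_nonneg_left ?_ hL)
    rw [hdiff]
    set p := stencil V μ (fun j => c j - u (gridPoint h j)) j
        + (stencil V μ (fun j => u (gridPoint h j)) j - u (gridPoint h j))
    set q := stencil V κ (fun j => c j - u (gridPoint h j)) j
        + (stencil V κ (fun j => u (gridPoint h j)) j - gradient u (gridPoint h j))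
    simp only [Prod.norm_def, norm_zero]
    rw [max_eq_right (le_max_of_le_left (norm_nonneg _)), ← sq_abs p, ← Real.norm_eq_abs]
    rcases max_cases ‖p‖ ‖q‖ with h | h <;> rw [h.1] <;> nlinarith [sq_nonneg ‖p‖, sq_nonneg ‖q‖]
  have hef : Function.HasFiniteSupport fun j => c j - u (gridPoint h j) := hc.sub hfu
  have hUf : Function.HasFiniteSupport fun j =>
      stencil V μ (fun j => u (gridPoint h j)) j - u (gridPoint h j) :=
    (hasFiniteSupport_stencil V μ hfu).sub hfu
  have hPf : Function.HasFiniteSupport fun j =>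
      stencil V κ (fun j => u (gridPoint h j)) j - gradient u (gridPoint h j) :=
    (hasFiniteSupport_stencil V κ hfu).sub hfg
  refine ⟨fun j => D (z j) (0, 1, 0), fun j => (D (z j)).comp I,
    fun j => g (z' j) - g (z j) - D (z j) (z' j - z j), ?_⟩
  refine ⟨hef, ?_, hUf, hPf, fun j => (hAe _).trans ((hD _).trans hK1),
    fun j => (hIn _).trans ((hD _).trans hK1), fun w hw j => ?_, fun w hw j => ?_, fun j => ?_,
    hU, hP, fun j => ?_⟩
  · refine (((hasFiniteSupport_stencil V μ hef).add hUf).union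
      ((hasFiniteSupport_stencil V κ hef).add hPf)).subset fun j hj => ?_
    by_contra hcon
    simp only [mem_union, Function.mem_support, not_or, not_not, Pi.add_apply] at hcon
    have := hQle j
    rw [hcon.1, hcon.2] at this
    simp only [norm_zero, ne_eq, OfNat.ofNat_ne_zero, not_false_eq_true, zero_pow, add_zero,
      mul_zero, abs_nonpos_iff] at this
    exact hj this
  · rw [← _root_.sub_apply]
    exact (hAe _).trans ((hDlip _ _).trans (hzlip w hw j))
  · rw [← ContinuousLinearMap.sub_comp]
    exact (hIn _).trans ((hDlip _ _).trans (hzlip w hw j))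
  · refine (hQle j).trans ?_
    gcongr
  · have h1 : D (z j) (z' j - z j) = D (z j) (0, 1, 0)
        * (stencil V μ (fun j => c j - u (gridPoint h j)) j
          + (stencil V μ (fun j => u (gridPoint h j)) j - u (gridPoint h j)))
        + (D (z j)).comp I (stencil V κ (fun j => c j - u (gridPoint h j)) j
          + (stencil V κ (fun j => u (gridPoint h j)) j - gradient u (gridPoint h j))) := by
      rw [hdiff]
      set p := stencil V μ (fun j => c j - u (gridPoint h j)) j
        + (stencil V μ (fun j => u (gridPoint h j)) j - u (gridPoint h j))
      set q := stencil V κ (fun j => c j - u (gridPoint h j)) j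
        + (stencil V κ (fun j => u (gridPoint h j)) j - gradient u (gridPoint h j))
      have : ((0, p, q) : Rn n × ℝ × Rn n) = p • ((0, 1, 0) : Rn n × ℝ × Rn n) + I q := by
        rw [hIv]; simp
      rw [this, map_add, map_smul, smul_eq_mul, mul_comm]
      rfl
    linarith

end ErrorEq

/-! ### Consistency errors at the grid points -/

section GridError

variable {n : ℕ} {k s : ℕ} {ζ : Rn n → ℝ}

/-- The error of the quasi-interpolant of `u` at the grid points. -/
def valueError (ζ : Rn n → ℝ) (ε h : ℝ) (u : Rn n → ℝ) (j : Fin n → ℤ) : ℝ :=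
  quasiInterpolant ζ ε h (fun j => u (gridPoint h j)) (gridPoint h j) - u (gridPoint h j)

/-- The error of the gradient of the quasi-interpolant of `u` at the grid points. -/
def gradientError (ζ : Rn n → ℝ) (ε h : ℝ) (u : Rn n → ℝ) (j : Fin n → ℤ) : Rn n :=
  gradient (quasiInterpolant ζ ε h fun j => u (gridPoint h j)) (gridPoint h j)
    - gradient u (gridPoint h j)

/-- The bound `B` on the two top derivatives is kept apart from `M`: for translation differences `B`
can be made small by uniform continuity, while `M` only has to be bounded. -/
lemma exists_gridError_bound (hζ : IsCompactKernel k s ζ) (heven : ∀ x, ζ (-x) = ζ x) {l : ℕ}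
    (hl : 1 ≤ l) (hls : l + 1 ≤ s) :
    ∃ C : ℝ, 0 ≤ C ∧ ∀ ε h : ℝ, 0 < h → h ≤ ε → ε ≤ 1 → ∀ u : Rn n → ℝ, ContDiff ℝ (k + 1 : ℕ) u →
      ∀ B M : ℝ, (∀ y, ‖iteratedFDeriv ℝ k u y‖ ≤ B) → (∀ y, ‖iteratedFDeriv ℝ (k + 1) u y‖ ≤ B) →
      (∀ q ≤ k, ∀ y, ‖iteratedFDeriv ℝ q u y‖ ≤ M) → ∀ j,
      |valueError ζ ε h u j| ≤ C * (ε ^ k * B + (h / ε) ^ l * M) ∧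
      ‖gradientError ζ ε h u j‖ ≤ C * (ε ^ k * B + (h / ε) ^ l * M) := by
  obtain ⟨C₁, hC₁, h₁⟩ := hζ.exists_consistency_value hl (by omega : l ≤ s)
  obtain ⟨C₂, hC₂, h₂⟩ := hζ.exists_consistency_gradient_gridPoint heven hl hls
  refine ⟨C₁ + C₂, by positivity, fun ε h hh hε hε1 u hu B M hB hB' hM j => ?_⟩
  have hε0 : 0 < ε := hh.trans_le hε
  have hB0 : 0 ≤ B := (norm_nonneg _).trans (hB 0)
  have hM0 : 0 ≤ M := (norm_nonneg _).trans (hM 0 (Nat.zero_le _) 0)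
  have hX : 0 ≤ ε ^ k * B + (h / ε) ^ l * M := by positivity
  constructor
  · refine (h₁ ε h hh hε hε1 u (hu.of_le (by exact_mod_cast Nat.le_succ k)) B M hB _
      fun q hq => hM q hq.le _).trans ?_
    nlinarith
  · refine (h₂ ε h hh hε hε1 u hu B M hB' j fun q _ hq => hM q hq _).trans ?_
    nlinarith

lemma iteratedFDeriv_translate_sub {u : Rn n → ℝ} {q : ℕ} (hu : ContDiff ℝ q u) (v y : Rn n) :
    iteratedFDeriv ℝ q (fun x => u (x + v) - u x) y
      = iteratedFDeriv ℝ q u (y + v) - iteratedFDeriv ℝ q u y := by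
  have h1 : ContDiff ℝ q fun x => u (x + v) := hu.comp (contDiff_id.add contDiff_const)
  rw [← congrFun (iteratedFDeriv_comp_add_right' q v) y]
  exact iteratedFDeriv_sub_apply h1.contDiffAt hu.contDiffAt

/-- Quasi-interpolation commutes with grid translations, so the difference of the errors is the
error of the difference. -/
lemma shiftDiff_valueError {R : ℝ} (h0 : ∀ z, R < ‖z‖ → ζ z = 0) {ε h : ℝ} (hε : 0 < ε)
    (hh : 0 < h) (u : Rn n → ℝ) (w j : Fin n → ℤ) :
    shiftDiff w (valueError ζ ε h u) j
      = valueError ζ ε h (fun x => u (x + gridPoint h w) - u x) j := by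
  simp only [shiftDiff, valueError, quasiInterpolant_eq_kernelSum, gridPoint_add,
    kernelSum_sub h0 hε hh]
  rw [← kernelSum_add_right]
  simp only [gridPoint_add]
  ring

lemma gradientError_eq (hd : Differentiable ℝ ζ) {R : ℝ} (h0 : ∀ z, R < ‖z‖ → ζ z = 0) {ε h : ℝ}
    (hε : 0 < ε) (hh : 0 < h) (u : Rn n → ℝ) (j : Fin n → ℤ) :
    gradientError ζ ε h u j = ε⁻¹ • kernelSum (gradient ζ) ε h (fun j => u (gridPoint h j))
      (gridPoint h j) - gradient u (gridPoint h j) := by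
  rw [gradientError, (hasGradientAt_quasiInterpolant hd h0 hε hh _ _).gradient]

lemma gradient_translate_sub {u : Rn n → ℝ} (hu : Differentiable ℝ u) (v y : Rn n) :
    gradient (fun x => u (x + v) - u x) y = gradient u (y + v) - gradient u y := by
  simp only [gradient]
  rw [fderiv_fun_sub (by fun_prop) (by fun_prop), fderiv_comp_add_right, map_sub]

lemma shiftDiff_gradientError (hd : Differentiable ℝ ζ) {R : ℝ} (h0 : ∀ z, R < ‖z‖ → ζ z = 0)
    {ε h : ℝ} (hε : 0 < ε) (hh : 0 < h) {u : Rn n → ℝ} (hu : Differentiable ℝ u)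
    (w j : Fin n → ℤ) :
    shiftDiff w (gradientError ζ ε h u) j
      = gradientError ζ ε h (fun x => u (x + gridPoint h w) - u x) j := by
  simp only [shiftDiff, gradientError_eq hd h0 hε hh, gridPoint_add,
    kernelSum_sub (gradient_eq_zero h0) hε hh, gradient_translate_sub hu]
  rw [← kernelSum_add_right]
  simp only [gridPoint_add, smul_sub]
  abel

lemma gridError_eq_zero (hd : Differentiable ℝ ζ) {R R' : ℝ} (h0 : ∀ z, R < ‖z‖ → ζ z = 0)
    (hR : 0 ≤ R) {ε h : ℝ} (hε : 0 < ε) (hh : 0 < h) (hε1 : ε ≤ 1) {u : Rn n → ℝ}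
    (hu : ∀ x, R' < ‖x‖ → u x = 0) {j : Fin n → ℤ} (hj : R' + R < ‖gridPoint h j‖) :
    valueError ζ ε h u j = 0 ∧ gradientError ζ ε h u j = 0 := by
  have hc : ∀ i, ‖gridPoint h j - gridPoint h i‖ ≤ R * ε → u (gridPoint h i) = 0 := fun i hi => by
    apply hu
    have h1 := norm_sub_norm_le (gridPoint h j) (gridPoint h i)
    nlinarith
  have hj' : R' < ‖gridPoint h j‖ := by linarith
  constructor
  · rw [valueError, quasiInterpolant_eq_kernelSum, kernelSum_eq_zero h0 hε hc, hu _ hj', sub_zero]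
  · rw [gradientError_eq hd h0 hε hh, kernelSum_eq_zero (gradient_eq_zero h0) hε hc,
      gradient_eq_zero hu _ hj', smul_zero, sub_zero]

lemma lt_norm_gridPoint {R h : ℝ} (hh : 0 < h) {j : Fin n → ℤ} (hj : j ∉ box (0 : Rn n) (R / h)) :
    R < ‖gridPoint h j‖ := by
  contrapose! hj
  apply mem_box_of_norm_le
  rw [gridPoint_eq_smul, norm_smul, Real.norm_of_nonneg hh.le] at hj
  rw [zero_sub, norm_neg, le_div_iff₀ hh, mul_comm]
  exact hj

/-- A fixed cube contains about `h ^ (-n) = ε ^ (-n) * (ε / h) ^ n` grid points. This is where the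
factor `ε ^ (-n)` in mean squares originates. -/
lemma card_box_div_le {R R' ε h : ℝ} (hR : 1 ≤ R) (hR' : 0 ≤ R') (hh : 0 < h) (hε : h ≤ ε)
    (hε1 : ε ≤ 1) :
    ((box (0 : Rn n) (R' / h)).card : ℝ)
      ≤ (2 * R' + 1) ^ n * (ε ^ n)⁻¹ * (box (0 : Rn n) (2 * R * (ε / h))).card := by
  have hε0 : 0 < ε := hh.trans_le hε
  calc ((box (0 : Rn n) (R' / h)).card : ℝ) ≤ (2 * (R' / h) + 1) ^ n := card_box_le _ (by positivity)
    _ ≤ ((2 * R' + 1) * h⁻¹) ^ n := by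
      gcongr
      have : 1 ≤ h⁻¹ := (one_le_inv₀ hh).2 (hε.trans hε1)
      rw [div_eq_mul_inv]; linarith
    _ = (2 * R' + 1) ^ n * (ε ^ n)⁻¹ * (ε / h) ^ n := by
      rw [← inv_pow, ← mul_pow, ← mul_pow]; congr 1; field_simp
    _ ≤ _ := by gcongr; exact le_card_W hR hh hε

end GridError

/-! ### Elementary properties of the scheme and of the exact solution -/

section Scheme

variable {n : ℕ} {T : ℝ} {f : ℝ → Rn n → ℝ → Rn n → ℝ} {ρ₀ : Rn n → ℝ} {ζ : Rn n → ℝ} {ε h : ℝ}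
  {c : (Fin n → ℤ) → ℝ → ℝ}

lemma SolvesScheme.abs_sub_initial_le (hc : SolvesScheme T f ρ₀ ζ ε h c) {i : Fin n → ℤ} {L : ℝ}
    (hf : ∀ t ∈ Icc 0 T, ∀ u p, |f t (gridPoint h i) u p| ≤ L) {t : ℝ} (ht : t ∈ Icc 0 T) :
    |c i t - ρ₀ (gridPoint h i)| ≤ L * t := by
  have h0 : (0 : ℝ) ∈ Icc 0 T := ⟨le_rfl, ht.1.trans ht.2⟩
  have := (convex_Icc (0 : ℝ) T).norm_image_sub_le_of_norm_hasDerivWithin_le (C := L)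
    (fun τ hτ => hc.equation i τ hτ) (fun τ hτ => by rw [norm_neg]; exact hf τ hτ _ _) h0 ht
  rwa [hc.initial, sub_zero, Real.norm_eq_abs, Real.norm_of_nonneg ht.1] at this

/-- Where `f` vanishes the coefficient is constant in time, so the error has finite support and all
sums over the grid are finite. -/
lemma SolvesScheme.eq_zero (hc : SolvesScheme T f ρ₀ ζ ε h c) {R : ℝ}
    (hf : ∀ t ∈ Icc 0 T, ∀ x, R < ‖x‖ → ∀ u p, f t x u p = 0) (h0 : ∀ x, R < ‖x‖ → ρ₀ x = 0)
    {i : Fin n → ℤ} (hi : R < ‖gridPoint h i‖) {t : ℝ} (ht : t ∈ Icc 0 T) : c i t = 0 := by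
  have := hc.abs_sub_initial_le (i := i) (L := 0)
    (fun t ht u p => by rw [hf t ht _ hi, abs_zero]) ht
  rw [h0 _ hi, sub_zero, zero_mul] at this
  exact abs_nonpos_iff.1 this

lemma IsTimeSpaceCc.hasDerivWithinAt {q r : ℕ} (hq : 1 ≤ q) {ρ : ℝ → Rn n → ℝ}
    (hρ : IsTimeSpaceCc q r T ρ) (hpde : SolvesPDE T f ρ₀ ρ) {t : ℝ} (ht : t ∈ Icc 0 T) (x : Rn n) :
    HasDerivWithinAt (fun τ => ρ τ x) (-f t x (ρ t x) (gradient (ρ t) x)) (Icc 0 T) t := by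
  have h1 := ((hρ.time_smooth x).differentiableOn (by exact_mod_cast (by omega : q ≠ 0)) t
    ht).hasDerivWithinAt
  rwa [eq_neg_of_add_eq_zero_left (hpde.equation t ht x)] at h1

end Scheme

/-! ### Consistency errors in mean square -/

section MeanSquareGridError

variable {n : ℕ}

/-- The grid errors of `ρ` and their differences, pointwise and in the mean square sense. -/
lemma exists_sumSq_gridError_bound {k s : ℕ} {ζ : Rn n → ℝ} (hζ : IsCompactKernel k s ζ)
    (heven : ∀ x, ζ (-x) = ζ x) {l : ℕ} (hl : 1 ≤ l) (hls : l + 1 ≤ s) {r : ℕ} (hr : k + 1 ≤ r)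
    {T : ℝ} {ρ : ℝ → Rn n → ℝ} (hρ : IsTimeSpaceCc 2 r T ρ) {R : ℝ} (hR : 1 ≤ R)
    (h0 : ∀ z, R < ‖z‖ → ζ z = 0) :
    ∃ A : ℝ, 1 ≤ A ∧ (∀ ε h : ℝ, 0 < h → h ≤ ε → ε ≤ 1 → ∀ t ∈ Icc 0 T,
        (∀ j, |valueError ζ ε h (ρ t) j| ≤ A * (ε ^ k + (h / ε) ^ l)) ∧
        (∀ j, ‖gradientError ζ ε h (ρ t) j‖ ≤ A * (ε ^ k + (h / ε) ^ l)) ∧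
        sumSq (valueError ζ ε h (ρ t)) + sumSq (gradientError ζ ε h (ρ t))
          ≤ (box (0 : Rn n) (2 * R * (ε / h))).card
            * (A * (ε ^ n)⁻¹ * (ε ^ k + (h / ε) ^ l) ^ 2)) ∧
      ∀ η : ℝ, 0 < η → ∃ ε₀ : ℝ, 0 < ε₀ ∧ ∀ ε h : ℝ, 0 < h → h ≤ ε → ε ≤ 1 → ε ≤ ε₀ →
        ∀ t ∈ Icc 0 T, ∀ w ∈ box (0 : Rn n) (2 * R * (ε / h)),
        sumSq (shiftDiff w (valueError ζ ε h (ρ t)))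
          + sumSq (shiftDiff w (gradientError ζ ε h (ρ t)))
          ≤ (box (0 : Rn n) (2 * R * (ε / h))).card
            * (A * (ε ^ n)⁻¹ * (ε ^ k * η + (h / ε) ^ l) ^ 2) := by
  obtain ⟨C, hC, hE⟩ := exists_gridError_bound hζ heven hl hls
  obtain ⟨R', hR', hsupp⟩ := hρ.exists_support
  obtain ⟨M, hM, hbd⟩ := hρ.exists_bound
  have hd : Differentiable ℝ ζ := hζ.smooth.differentiable (by exact_mod_cast (by omega : s ≠ 0))
  have hu : ∀ t ∈ Icc 0 T, ContDiff ℝ (k + 1 : ℕ) (ρ t) := fun t ht =>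
    (hρ.space_smooth t ht).of_le (by exact_mod_cast hr)
  -- Support radius of the solution, plus kernel radius, plus the largest length of a stencil shift
  -- for `ε ≤ 1`.
  set R₁ := R' + R + n * (2 * R) with hR₁
  have hn0 : (0 : ℝ) ≤ n * (2 * R) := by positivity
  set D := C * (1 + 2 * M) with hD
  have hD0 : 0 ≤ D := by positivity
  set A := 1 + D + (2 * R₁ + 1) ^ n * (2 * D ^ 2) with hA
  have hA0 : 0 ≤ (2 * R₁ + 1) ^ n * (2 * D ^ 2) := by positivity
  have key : ∀ ε h : ℝ, 0 < h → h ≤ ε → ε ≤ 1 → ∀ (u : (Fin n → ℤ) → ℝ) (p : (Fin n → ℤ) → Rn n)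
      (δ : ℝ), 0 ≤ δ → (∀ j ∉ box (0 : Rn n) (R₁ / h), u j = 0 ∧ p j = 0) →
      (∀ j, |u j| ≤ D * δ ∧ ‖p j‖ ≤ D * δ) →
      sumSq u + sumSq p ≤ (box (0 : Rn n) (2 * R * (ε / h))).card * (A * (ε ^ n)⁻¹ * δ ^ 2) := by
    intro ε h hh hε hε1 u p δ hδ hz hb
    have hε0 : 0 < ε := hh.trans_le hε
    calc sumSq u + sumSq p ≤ (box (0 : Rn n) (R₁ / h)).card * (D * δ) ^ 2
          + (box (0 : Rn n) (R₁ / h)).card * (D * δ) ^ 2 :=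
          add_le_add (sumSq_le_card_mul (fun j hj => (hz j hj).1) fun j => (hb j).1)
            (sumSq_le_card_mul (fun j hj => (hz j hj).2) fun j => (hb j).2)
      _ = (box (0 : Rn n) (R₁ / h)).card * (2 * D ^ 2 * δ ^ 2) := by ring
      _ ≤ ((2 * R₁ + 1) ^ n * (ε ^ n)⁻¹ * (box (0 : Rn n) (2 * R * (ε / h))).card)
          * (2 * D ^ 2 * δ ^ 2) := by
        gcongr; exact card_box_div_le hR (by positivity) hh hε hε1
      _ = (box (0 : Rn n) (2 * R * (ε / h))).card
          * ((2 * R₁ + 1) ^ n * (2 * D ^ 2) * (ε ^ n)⁻¹ * δ ^ 2) := by ring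
      _ ≤ _ := by gcongr; linarith
  refine ⟨A, by linarith, fun ε h hh hε hε1 t ht => ?_, fun η hη => ?_⟩
  · have hε0 : 0 < ε := hh.trans_le hε
    have hb : ∀ j, |valueError ζ ε h (ρ t) j| ≤ D * (ε ^ k + (h / ε) ^ l) ∧
        ‖gradientError ζ ε h (ρ t) j‖ ≤ D * (ε ^ k + (h / ε) ^ l) := fun j => by
      have h1 := hE ε h hh hε hε1 (ρ t) (hu t ht) M M (hbd k (by omega) t ht)
        (hbd (k + 1) hr t ht) (fun q hq y => hbd q (by omega) t ht y) j
      have h2 : C * (ε ^ k * M + (h / ε) ^ l * M) ≤ D * (ε ^ k + (h / ε) ^ l) := by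
        rw [← add_mul, hD, mul_assoc, mul_comm (_ + _) M]
        gcongr; linarith
      exact ⟨h1.1.trans h2, h1.2.trans h2⟩
    have hDA : D * (ε ^ k + (h / ε) ^ l) ≤ A * (ε ^ k + (h / ε) ^ l) := by gcongr; linarith
    refine ⟨fun j => (hb j).1.trans hDA, fun j => (hb j).2.trans hDA,
      key ε h hh hε hε1 _ _ _ (by positivity) (fun j hj => ?_) hb⟩
    refine gridError_eq_zero hd h0 (by linarith) hε0 hh hε1 (hsupp t ht) ?_
    have := lt_norm_gridPoint hh hj
    linarith
  · obtain ⟨δ₁, hδ₁, hm₁⟩ := hρ.exists_modulus hη (by omega : k ≤ r)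
    obtain ⟨δ₂, hδ₂, hm₂⟩ := hρ.exists_modulus hη hr
    -- Shifts have length at most `n * (2 * R) * ε`; this threshold keeps them below both moduli of
    -- continuity.
    refine ⟨min δ₁ δ₂ / (n * (2 * R) + 1), by positivity, fun ε h hh hε hε1 hε' t ht w hw => ?_⟩
    have hε0 : 0 < ε := hh.trans_le hε
    have hw1 : ‖gridPoint h w‖ ≤ n * (2 * R) * ε := by
      refine (norm_gridPoint_le hh.le hw).trans (le_of_eq ?_)
      field_simp
    have hw2 : ‖gridPoint h w‖ ≤ min δ₁ δ₂ := by
      rw [le_div_iff₀ (by positivity)] at hε'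
      nlinarith
    have hw3 : ‖gridPoint h w‖ ≤ n * (2 * R) := hw1.trans (mul_le_of_le_one_right hn0 hε1)
    have hdu : Differentiable ℝ (ρ t) := (hu t ht).differentiable (by simp)
    refine key ε h hh hε hε1 _ _ _ (by positivity) (fun j hj => ?_) fun j => ?_
    · have h1 := lt_norm_gridPoint hh hj
      have h2 : R' + R < ‖gridPoint h j‖ := by linarith
      have h3 : R' + R < ‖gridPoint h (j + w)‖ := by
        have := norm_sub_norm_le (gridPoint h j) (-gridPoint h w)
        rw [sub_neg_eq_add, ← gridPoint_add, norm_neg] at this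
        linarith
      have e1 := gridError_eq_zero hd h0 (by linarith) hε0 hh hε1 (hsupp t ht) h2
      have e2 := gridError_eq_zero hd h0 (by linarith) hε0 hh hε1 (hsupp t ht) h3
      simp [shiftDiff, e1.1, e1.2, e2.1, e2.2]
    · rw [shiftDiff_valueError h0 hε0 hh, shiftDiff_gradientError hd h0 hε0 hh hdu]
      have hg : ∀ q ≤ k + 1, ∀ y, iteratedFDeriv ℝ q (fun x => ρ t (x + gridPoint h w) - ρ t x) y
          = iteratedFDeriv ℝ q (ρ t) (y + gridPoint h w) - iteratedFDeriv ℝ q (ρ t) y :=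
        fun q hq y => iteratedFDeriv_translate_sub ((hu t ht).of_le (by exact_mod_cast hq)) _ _
      -- The difference function has top derivatives at most `η` by uniform continuity, and lower
      -- ones at most `2 * M` by the triangle inequality.
      have h1 := hE ε h hh hε hε1 (fun x => ρ t (x + gridPoint h w) - ρ t x)
        (((hu t ht).comp (contDiff_id.add contDiff_const)).sub (hu t ht)) η (2 * M)
        (fun y => by
          rw [hg k (by omega)]
          exact hm₁ t ht _ _ (by rw [add_sub_cancel_left]; exact hw2.trans (min_le_left _ _)))
        (fun y => by
          rw [hg (k + 1) le_rfl]
          exact hm₂ t ht _ _ (by rw [add_sub_cancel_left]; exact hw2.trans (min_le_right _ _)))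
        (fun q hq y => by
          rw [hg q (by omega)]
          refine (norm_sub_le _ _).trans ?_
          have := hbd q (by omega) t ht (y + gridPoint h w)
          have := hbd q (by omega) t ht y
          linarith) j
      have h2 : C * (ε ^ k * η + (h / ε) ^ l * (2 * M)) ≤ D * (ε ^ k * η + (h / ε) ^ l) := by
        rw [hD, mul_assoc]
        gcongr
        have : 0 ≤ ε ^ k * η * (2 * M) := by positivity
        have : 0 ≤ (h / ε) ^ l := by positivity
        nlinarith
      exact ⟨h1.1.trans h2, h1.2.trans h2⟩

end MeanSquareGridError

/-! ### The mean square error of the coefficients -/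

section CoefficientError

variable {n : ℕ}

lemma IsCompactKernel.exists_bound {k s : ℕ} {ζ : Rn n → ℝ} (hζ : IsCompactKernel k s ζ)
    (hs : s ≠ 0) {R : ℝ} (h0 : ∀ z, R < ‖z‖ → ζ z = 0) :
    ∃ K : ℝ, 0 ≤ K ∧ (∀ z, |ζ z| ≤ K) ∧ ∀ z, ‖gradient ζ z‖ ≤ K := by
  have hgc : Continuous (gradient ζ) := (InnerProductSpace.toDual ℝ (Rn n)).symm.continuous.comp
    (hζ.smooth.continuous_fderiv (by exact_mod_cast hs))
  obtain ⟨K₁, hK₁⟩ := hζ.smooth.continuous.bounded_above_of_compact_support hζ.compact_support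
  obtain ⟨K₂, hK₂⟩ := hgc.bounded_above_of_compact_support
    (HasCompactSupport.intro (isCompact_closedBall (0 : Rn n) R) fun z hz =>
      gradient_eq_zero h0 z (by simpa using hz))
  exact ⟨max K₁ K₂, (norm_nonneg _).trans ((hK₁ 0).trans (le_max_left _ _)),
    fun z => (hK₁ z).trans (le_max_left _ _), fun z => (hK₂ z).trans (le_max_right _ _)⟩

/-- The smallness condition of the energy argument holds if the consistency error is small. -/
lemma energy_smallness {k : ℕ} {A C η ε E lam : ℝ} (hA : 0 < A) (hC : 1 ≤ C) (hη0 : 0 < η)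
    (hη1 : η ≤ 1) (hη2 : C * (8 * A) * η ≤ 1) (hε0 : 0 < ε) (hεη : ε ≤ η) (hE0 : 0 < E) (hE1 : E ≤ 1)
    (hE : E ^ 2 = ε ^ n) (hl0 : 0 ≤ lam) (hkE : ε ^ k ≤ ε ^ 2 * E) (hlE : lam ≤ ε ^ 3 * E) :
    ε ^ k + lam ≤ 2 * ε ∧
    A * (ε ^ n)⁻¹ * (ε ^ k * η + lam) ^ 2 ≤ A * (ε ^ n)⁻¹ * (ε ^ k + lam) ^ 2 ∧
    C * (ε ^ 2 * (A * (ε ^ n)⁻¹ * (ε ^ k + lam) ^ 2) + A * (ε ^ n)⁻¹ * (ε ^ k * η + lam) ^ 2)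
      ≤ ε ^ 4 := by
  have hε1 : ε ≤ 1 := hεη.trans hη1
  have hεn : 0 < ε ^ n := by positivity
  set δ := ε ^ k + lam with hδ
  have hk0 : 0 < ε ^ k := by positivity
  have hδ1 : δ ≤ 2 * (ε ^ 2 * E) := by
    have : ε ^ 3 * E ≤ ε ^ 2 * E := by
      exact mul_le_mul_of_nonneg_right (pow_le_pow_of_le_one hε0.le hε1 (by norm_num)) hE0.le
    linarith
  have hδ2 : δ ≤ 2 * ε := by
    have h1 : ε ^ 2 * E ≤ ε ^ 2 := mul_le_of_le_one_right (by positivity) hE1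
    have h2 : ε ^ 2 ≤ ε := by nlinarith
    linarith
  -- The kernel term is small through `η`; the quadrature term is small through its spare power of
  -- `ε`, as `ε ≤ η`.
  have hδη : ε ^ k * η + lam ≤ 2 * η * (ε ^ 2 * E) := by
    have h1 : ε ^ k * η ≤ ε ^ 2 * E * η := by gcongr
    have h2 : ε ^ 3 * E ≤ η * (ε ^ 2 * E) := by
      have : ε * (ε ^ 2 * E) ≤ η * (ε ^ 2 * E) := by gcongr
      linarith
    linarith
  have hδη' : ε ^ k * η + lam ≤ δ := by
    have := mul_le_of_le_one_right hk0.le hη1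
    linarith
  set d := A * (ε ^ n)⁻¹ * δ ^ 2 with hdd
  set θ := A * (ε ^ n)⁻¹ * (ε ^ k * η + lam) ^ 2 with hθ
  have hθd : θ ≤ d := by rw [hθ, hdd]; gcongr
  have hEinv : (ε ^ n)⁻¹ * E ^ 2 = 1 := by rw [hE]; exact inv_mul_cancel₀ hεn.ne'
  have hdle : d ≤ 4 * A * ε ^ 4 := by
    calc d ≤ A * (ε ^ n)⁻¹ * (2 * (ε ^ 2 * E)) ^ 2 := by rw [hdd]; gcongr
      _ = 4 * A * ε ^ 4 * ((ε ^ n)⁻¹ * E ^ 2) := by ring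
      _ = _ := by rw [hEinv, mul_one]
  have hθle : θ ≤ 4 * A * η ^ 2 * ε ^ 4 := by
    calc θ ≤ A * (ε ^ n)⁻¹ * (2 * η * (ε ^ 2 * E)) ^ 2 := by rw [hθ]; gcongr
      _ = 4 * A * η ^ 2 * ε ^ 4 * ((ε ^ n)⁻¹ * E ^ 2) := by ring
      _ = _ := by rw [hEinv, mul_one]
  have hsmall : C * (ε ^ 2 * d + θ) ≤ ε ^ 4 := by
    have hη3 : η ^ 2 ≤ η := by nlinarith
    have hε2 : ε ^ 2 ≤ η ^ 2 := by gcongr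
    calc C * (ε ^ 2 * d + θ) ≤ C * (η ^ 2 * (4 * A * ε ^ 4) + 4 * A * η ^ 2 * ε ^ 4) := by gcongr
      _ = C * (8 * A) * η ^ 2 * ε ^ 4 := by ring
      _ ≤ C * (8 * A) * η * ε ^ 4 := by gcongr
      _ ≤ 1 * ε ^ 4 := by gcongr
      _ = ε ^ 4 := one_mul _
  exact ⟨hδ2, hθd, hsmall⟩

set_option maxHeartbeats 1000000 in
/-- The mean square error of the coefficients of the scheme. -/
lemma exists_coefficient_error_bound {k l r s : ℕ} {ζ : Rn n → ℝ} (hζ : IsCompactKernel k s ζ)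
    (heven : ∀ x, ζ (-x) = ζ x) (hl : 1 ≤ l) (hls : l + 1 ≤ s) (hr : k + 1 ≤ r)
    {T : ℝ} (hT : 0 < T) {f : ℝ → Rn n → ℝ → Rn n → ℝ}
    (hf : ContDiffOn ℝ 2 (fun z : ℝ × Rn n × ℝ × Rn n => f z.1 z.2.1 z.2.2.1 z.2.2.2)
      (Icc 0 T ×ˢ univ))
    (hf_supp : ∃ K : Set (Rn n × ℝ × Rn n), IsCompact K ∧
      ∀ t ∈ Icc 0 T, ∀ x u p, (x, u, p) ∉ K → f t x u p = 0)
    {ρ₀ : Rn n → ℝ} {ρ : ℝ → Rn n → ℝ} (hρ : IsTimeSpaceCc 2 r T ρ) (hpde : SolvesPDE T f ρ₀ ρ)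
    {R : ℝ} (hR : 1 ≤ R) (h0 : ∀ z, R < ‖z‖ → ζ z = 0) :
    ∃ C ε₀ : ℝ, 0 ≤ C ∧ 0 < ε₀ ∧ ε₀ ≤ 1 ∧ ∀ ε h E : ℝ, 0 < h → h ≤ ε → ε ≤ ε₀ → 0 < E → E ≤ 1 →
      E ^ 2 = ε ^ n → ε ^ k ≤ ε ^ 2 * E → (h / ε) ^ l ≤ ε ^ 3 * E →
      ∀ c : (Fin n → ℤ) → ℝ → ℝ, SolvesScheme T f ρ₀ ζ ε h c → ∀ t ∈ Icc 0 T,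
        (Function.HasFiniteSupport fun j => c j t - ρ t (gridPoint h j)) ∧
        sumSq (fun j => c j t - ρ t (gridPoint h j))
          ≤ (box (0 : Rn n) (2 * R * (ε / h))).card * (C * (ε ^ n)⁻¹ * (ε ^ k + (h / ε) ^ l) ^ 2) := by
  obtain ⟨Kf, hKf, hf0⟩ := hf_supp
  obtain ⟨L, hL, -, D, -, hD⟩ := exists_nonlinearity_bound hT hf hKf
    fun t ht z hz => hf0 t ht z.1 z.2.1 z.2.2 hz
  obtain ⟨R', hR', hsupp⟩ := hρ.exists_support
  obtain ⟨M, hM, hbd⟩ := hρ.exists_bound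
  obtain ⟨Rf, hRf⟩ := hKf.isBounded.exists_norm_le
  have hd : Differentiable ℝ ζ := hζ.smooth.differentiable (by exact_mod_cast (by omega : s ≠ 0))
  obtain ⟨K₀, hK₀, hK₁, hK₂⟩ := hζ.exists_bound (by omega) h0
  have hk1 := hζ.one_le_order
  obtain ⟨A, hA, hA₁, hA₂⟩ := exists_sumSq_gridError_bound hζ heven hl hls hr hρ hR h0
  have hX₁ : 0 ≤ (5 * R) ^ n * K₀ := by positivity
  have hX₂ : 0 ≤ L * ((1 + M) * (n * (2 * R))) := by positivity
  -- A single constant dominates all requirements of `IsStencilPair` and `ErrorEquation`. The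
  -- summand `2 * A` is for the pointwise consistency errors, which are at most `A * (2 * ε)`.
  set K := 1 + (5 * R) ^ n * K₀ + L + L * ((1 + M) * (n * (2 * R))) + 2 * A with hK
  obtain ⟨C, hC, hmain⟩ := exists_error_bound (J := Fin n → ℤ) (E := Rn n) K hT.le
  -- The stability constant `C` is fixed before `η`, and `η` determines how small `ε` must be.
  set η := 1 / (1 + C * (8 * A)) with hη
  have hη0 : 0 < η := by positivity
  have hη1 : η ≤ 1 := by
    rw [hη, div_le_one (by positivity)]; nlinarith
  have hη2 : C * (8 * A) * η ≤ 1 := by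
    rw [hη, mul_one_div, div_le_one (by positivity)]; linarith
  obtain ⟨ε₁, hε₁, hA₂⟩ := hA₂ η hη0
  refine ⟨C * (2 * A), min η ε₁, by positivity, by positivity, (min_le_left _ _).trans hη1, ?_⟩
  intro ε h E hh hhε hεmin hE0 hE1 hE hkE hlE c hc t ht
  have hε0 : 0 < ε := hh.trans_le hhε
  have hεη : ε ≤ η := hεmin.trans (min_le_left _ _)
  have hε1 : ε ≤ 1 := hεη.trans hη1
  have hεn : 0 < ε ^ n := by positivity
  set δ := ε ^ k + (h / ε) ^ l with hδ
  set N : ℝ := ((box (0 : Rn n) (2 * R * (ε / h))).card : ℝ) with hN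
  have hN0 : 0 < N := lt_of_lt_of_le (by positivity) (le_card_W (n := n) hR hh hhε)
  have hl0 : 0 < (h / ε) ^ l := by positivity
  obtain ⟨hδ2, hθd, hsmall⟩ := energy_smallness (by linarith) hC hη0 hη1 hη2 hε0 hεη hE0 hE1 hE hl0.le
    hkE hlE
  set d := A * (ε ^ n)⁻¹ * δ ^ 2 with hdd
  set θ := A * (ε ^ n)⁻¹ * (ε ^ k * η + (h / ε) ^ l) ^ 2 with hθ
  have hd0 : 0 < d := by positivity
  have hθ0 : 0 < θ := by positivity
  have h0T : (0 : ℝ) ∈ Icc 0 T := ⟨le_rfl, hT.le⟩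
  have hf0' : ∀ t ∈ Icc 0 T, ∀ x, max Rf R' < ‖x‖ → ∀ u p, f t x u p = 0 := fun t ht x hx u p => by
    refine hf0 t ht x u p fun hmem => ?_
    have h1 : ‖x‖ ≤ ‖(x, u, p)‖ := norm_fst_le (x, u, p)
    linarith [hRf _ hmem, le_max_left Rf R']
  have hρ₀ : ∀ x, max Rf R' < ‖x‖ → ρ₀ x = 0 := fun x hx => by
    rw [← hpde.initial]
    exact hsupp 0 h0T x ((le_max_right _ _).trans_lt hx)
  have hcz : ∀ t ∈ Icc 0 T, ∀ j ∉ box (0 : Rn n) (max Rf R' / h), c j t = 0 := fun t ht j hj =>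
    hc.eq_zero hf0' hρ₀ (lt_norm_gridPoint hh hj) ht
  have hρz : ∀ t ∈ Icc 0 T, ∀ j ∉ box (0 : Rn n) (max Rf R' / h), ρ t (gridPoint h j) = 0 :=
    fun t ht j hj => hsupp t ht _ ((le_max_right _ _).trans_lt (lt_norm_gridPoint hh hj))
  have hgz : ∀ t ∈ Icc 0 T, ∀ j ∉ box (0 : Rn n) (max Rf R' / h),
      gradient (ρ t) (gridPoint h j) = 0 := fun t ht j hj =>
    gradient_eq_zero (hsupp t ht) _ ((le_max_right _ _).trans_lt (lt_norm_gridPoint hh hj))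
  have hfin : ∀ {F : Type} [Zero F] (u : (Fin n → ℤ) → F),
      (∀ j ∉ box (0 : Rn n) (max Rf R' / h), u j = 0) → u.HasFiniteSupport := fun u hu =>
    (Finset.finite_toSet _).subset fun j hj => by
      by_contra hmem
      exact hj (hu j hmem)
  have hez : ∀ t ∈ Icc 0 T, ∀ j ∉ box (0 : Rn n) (max Rf R' / h),
      c j t - ρ t (gridPoint h j) = 0 := fun t ht j hj => by
    rw [hcz t ht j hj, hρz t ht j hj, sub_zero]
  have herr : ∀ t ∈ Icc 0 T, ∃ (a : (Fin n → ℤ) → ℝ) (b : (Fin n → ℤ) → Rn n →L[ℝ] ℝ)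
      (Q : (Fin n → ℤ) → ℝ),
      ErrorEquation (box (0 : Rn n) (R * (ε / h))) (box (0 : Rn n) (2 * R * (ε / h))) ε K
      (stencilWeight ζ ε h) (stencilWeight (fun z => ε⁻¹ • gradient ζ z) ε h)
      (fun j => c j t - ρ t (gridPoint h j))
      (fun j => -f t (gridPoint h j) (quasiInterpolant ζ ε h (fun j => c j t) (gridPoint h j))
          (gradient (quasiInterpolant ζ ε h fun j => c j t) (gridPoint h j))
        + f t (gridPoint h j) (ρ t (gridPoint h j)) (gradient (ρ t) (gridPoint h j)))
      a b Q (valueError ζ ε h (ρ t)) (gradientError ζ ε h (ρ t)) := fun t ht => by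
    obtain ⟨hA₃, hA₄, -⟩ := hA₁ ε h hh hhε hε1 t ht
    have hKδ : A * δ ≤ K * ε := by
      calc A * δ ≤ A * (2 * ε) := by gcongr
        _ = 2 * A * ε := by ring
        _ ≤ K * ε := by gcongr; linarith
    have hut : ContDiff ℝ (k + 1 : ℕ) (ρ t) :=
      (hρ.space_smooth t ht).of_le (by exact_mod_cast hr)
    exact errorEquation hd hR h0 hh hhε (g := fun z => f t z.1 z.2.1 z.2.2) hL hM (hD t ht).1
      (hD t ht).2.1 (hD t ht).2.2
      (abs_sub_le_of_iteratedFDeriv (hut.of_le (by exact_mod_cast (by omega : 1 ≤ k + 1)))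
        (hbd 1 (by omega) t ht))
      (norm_gradient_sub_le (hut.of_le (by exact_mod_cast (by omega : 2 ≤ k + 1)))
        (hbd 2 (by omega) t ht))
      (hfin _ (hρz t ht)) (hfin _ (hgz t ht)) (hfin _ (hcz t ht)) (by linarith) (by linarith)
      (fun j => (hA₃ j).trans hKδ) (fun j => (hA₄ j).trans hKδ)
  choose! a b Q herr using herr
  have hpair := isStencilPair (K := K) hd heven hR hK₁ hK₂ (by linarith) (by linarith) hh hhε hε1
  have hder : ∀ j, ∀ t ∈ Icc 0 T, HasDerivWithinAt (fun t => c j t - ρ t (gridPoint h j))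
      (-f t (gridPoint h j) (quasiInterpolant ζ ε h (fun j => c j t) (gridPoint h j))
          (gradient (quasiInterpolant ζ ε h fun j => c j t) (gridPoint h j))
        + f t (gridPoint h j) (ρ t (gridPoint h j)) (gradient (ρ t) (gridPoint h j)))
      (Icc 0 T) t := fun j t ht => by
    have := (hc.equation j t ht).sub (hρ.hasDerivWithinAt (by norm_num) hpde ht (gridPoint h j))
    rwa [sub_neg_eq_add] at this
  have := hmain _ _ ε _ _ (box (0 : Rn n) (max Rf R' / h))
    (fun j t => c j t - ρ t (gridPoint h j)) _ (fun j t => a t j) b Q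
    (fun t => valueError ζ ε h (ρ t)) (fun t => gradientError ζ ε h (ρ t)) d θ hpair hez
    (fun j => by rw [hc.initial, hpde.initial, sub_self]) hder herr hd0
    (fun t ht => (hA₁ ε h hh hhε hε1 t ht).2.2) hθ0
    (fun t ht w hw => hA₂ ε h hh hhε hε1 (hεmin.trans (min_le_right _ _)) t ht w hw) hsmall t ht
  refine ⟨hfin _ (hez t ht), ?_⟩
  rw [div_le_iff₀ hN0] at this
  calc _ ≤ C * (d + θ) * N := this
    _ ≤ C * (d + d) * N := by gcongr
    _ = _ := by rw [hdd]; ring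

end CoefficientError

/-! ### From mean square to uniform estimates -/

section PointwiseError

variable {n : ℕ}

/-- With `E = ε ^ (n/2)`, the passage from mean square over the grid to the supremum costs no power
of `h`; the factor `E⁻¹` is already contained in the mean square bound. -/
lemma norm_kernelSum_le_of_sumSq_le {F : Type*} [NormedAddCommGroup F] [NormedSpace ℝ F]
    {φ : Rn n → F} {R K : ℝ} (hR : 1 ≤ R) (hφ : ∀ z, R < ‖z‖ → φ z = 0) (hK : ∀ z, ‖φ z‖ ≤ K)
    {ε h : ℝ} (hh : 0 < h) (hε : h ≤ ε) {c : (Fin n → ℤ) → ℝ} (hc : c.HasFiniteSupport)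
    {C E δ : ℝ} (hC : 0 ≤ C) (hE : 0 < E) (hEε : E ^ 2 = ε ^ n) (hδ : 0 ≤ δ)
    (hs : sumSq c ≤ (box (0 : Rn n) (2 * R * (ε / h))).card * (C * (ε ^ n)⁻¹ * δ ^ 2)) (x : Rn n) :
    ‖kernelSum φ ε h c x‖ ≤ (1 + K ^ 2 * (3 * R) ^ n * (5 * R) ^ n * C) * (E⁻¹ * δ) := by
  have hε0 : 0 < ε := hh.trans_le hε
  set X := K ^ 2 * (3 * R) ^ n * (5 * R) ^ n * C with hX
  have hX0 : 0 ≤ X := by positivity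
  refine le_of_sq_le_sq ?_ (by positivity)
  calc ‖kernelSum φ ε h c x‖ ^ 2 ≤ K ^ 2 * (3 * R) ^ n * ((h / ε) ^ n * sumSq c) :=
        normSq_kernelSum_le hR hφ hK hh hε hc x
    _ ≤ K ^ 2 * (3 * R) ^ n * ((h / ε) ^ n
        * ((5 * R) ^ n * (ε / h) ^ n * (C * (ε ^ n)⁻¹ * δ ^ 2))) := by
      gcongr
      exact hs.trans (by gcongr; exact card_W_le hR hh hε)
    _ = X * (E⁻¹ * δ) ^ 2 := by
      have h1 : (h / ε) ^ n * (ε / h) ^ n = 1 := by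
        rw [← mul_pow, div_mul_div_cancel₀ hε0.ne', div_self hh.ne', one_pow]
      rw [← hEε, hX]
      linear_combination K ^ 2 * (3 * R) ^ n * (5 * R) ^ n * (C * (E ^ 2)⁻¹ * δ ^ 2) * h1
    _ ≤ ((1 + X) * (E⁻¹ * δ)) ^ 2 := by
      rw [mul_pow (1 + X)]
      exact mul_le_mul_of_nonneg_right (by nlinarith) (sq_nonneg _)

/-- The error of the scheme for small kernel widths. -/
lemma exists_pointwise_bound_of_small {k l r s : ℕ} {ζ : Rn n → ℝ} (hζ : IsCompactKernel k s ζ)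
    (heven : ∀ x, ζ (-x) = ζ x) (hl : 1 ≤ l) (hls : l + 1 ≤ s) (hr : k + 1 ≤ r)
    {T : ℝ} (hT : 0 < T) {f : ℝ → Rn n → ℝ → Rn n → ℝ}
    (hf : ContDiffOn ℝ 2 (fun z : ℝ × Rn n × ℝ × Rn n => f z.1 z.2.1 z.2.2.1 z.2.2.2)
      (Icc 0 T ×ˢ univ))
    (hf_supp : ∃ K : Set (Rn n × ℝ × Rn n), IsCompact K ∧
      ∀ t ∈ Icc 0 T, ∀ x u p, (x, u, p) ∉ K → f t x u p = 0)
    {ρ₀ : Rn n → ℝ} {ρ : ℝ → Rn n → ℝ} (hρ : IsTimeSpaceCc 2 r T ρ) (hpde : SolvesPDE T f ρ₀ ρ) :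
    ∃ C ε₀ : ℝ, 0 ≤ C ∧ 0 < ε₀ ∧ ε₀ ≤ 1 ∧ ∀ ε h E : ℝ, 0 < h → h ≤ ε → ε ≤ ε₀ → 0 < E → E ≤ 1 →
      E ^ 2 = ε ^ n → ε ^ k ≤ ε ^ 2 * E → (h / ε) ^ l ≤ ε ^ 3 * E →
      ∀ c : (Fin n → ℤ) → ℝ → ℝ, SolvesScheme T f ρ₀ ζ ε h c → ∀ t ∈ Icc 0 T, ∀ x,
        |ρ t x - quasiInterpolant ζ ε h (fun j => c j t) x|
          ≤ C * (E⁻¹ * (ε ^ k + (h / ε) ^ l / ε)) ∧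
        ‖gradient (ρ t) x - gradient (quasiInterpolant ζ ε h fun j => c j t) x‖
          ≤ C * (ε⁻¹ * (E⁻¹ * (ε ^ k + (h / ε) ^ l / ε))) := by
  obtain ⟨R, hR, h0⟩ := exists_radius hζ.compact_support
  obtain ⟨M, hM, hbd⟩ := hρ.exists_bound
  obtain ⟨K, hK, hK₁, hK₂⟩ := hζ.exists_bound (by omega) h0
  have hd : Differentiable ℝ ζ := hζ.smooth.differentiable (by exact_mod_cast (by omega : s ≠ 0))
  obtain ⟨C₁, hC₁, h₁⟩ := hζ.exists_consistency_value hl (by omega : l ≤ s)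
  obtain ⟨C₂, hC₂, h₂⟩ := hζ.exists_consistency_gradient hl hls
  obtain ⟨C₀, ε₀, hC₀, hε₀, hε₀1, hmain⟩ :=
    exists_coefficient_error_bound hζ heven hl hls hr hT hf hf_supp hρ hpde hR h0
  set B := 1 + K ^ 2 * (3 * R) ^ n * (5 * R) ^ n * C₀ with hB
  have hB0 : 0 ≤ B := by positivity
  refine ⟨C₁ * M + C₂ * ((k + 1) * M) + B, ε₀, by positivity, hε₀, hε₀1, ?_⟩
  intro ε h E hh hhε hεε hE0 hE1 hE hkE hlE c hc t ht x
  obtain ⟨hfin, hsum⟩ := hmain ε h E hh hhε hεε hE0 hE1 hE hkE hlE c hc t ht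
  have hε0 : 0 < ε := hh.trans_le hhε
  have hε1 : ε ≤ 1 := hεε.trans hε₀1
  have hut : ContDiff ℝ (k + 1 : ℕ) (ρ t) := (hρ.space_smooth t ht).of_le (by exact_mod_cast hr)
  set δ := ε ^ k + (h / ε) ^ l / ε with hδ
  have hEi : 1 ≤ E⁻¹ := (one_le_inv₀ hE0).2 hE1
  have hεi : 1 ≤ ε⁻¹ := (one_le_inv₀ hε0).2 hε1
  have hlε : (h / ε) ^ l ≤ (h / ε) ^ l / ε := by
    rw [div_eq_mul_inv _ ε]; exact le_mul_of_one_le_right (by positivity) hεi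
  have hδ0 : 0 ≤ δ := by positivity
  have hδ1 : ε ^ k + (h / ε) ^ l ≤ δ := by rw [hδ]; gcongr
  have hδE : δ ≤ E⁻¹ * δ := le_mul_of_one_le_left hδ0 hEi
  have hδε : E⁻¹ * δ ≤ ε⁻¹ * (E⁻¹ * δ) := le_mul_of_one_le_left (by positivity) hεi
  have hBδ : B * (E⁻¹ * (ε ^ k + (h / ε) ^ l)) ≤ B * (E⁻¹ * δ) := by gcongr
  have hCk : 0 ≤ C₂ * ((k + 1) * M) := by positivity
  have hCM : 0 ≤ C₁ * M := by positivity
  constructor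
  · have e1 := h₁ ε h hh hhε hε1 (ρ t) (hut.of_le (by exact_mod_cast Nat.le_succ k)) M M
      (hbd k (by omega) t ht) x fun q hq => hbd q (by omega) t ht x
    have e2 := norm_kernelSum_le_of_sumSq_le hR h0 hK₁ hh hhε hfin hC₀ hE0 hE
      (by positivity) hsum x
    rw [kernelSum_sub h0 hε0 hh] at e2
    rw [quasiInterpolant_eq_kernelSum] at e1 ⊢
    have e3 := abs_sub_le (ρ t x) (kernelSum ζ ε h (fun j => ρ t (gridPoint h j)) x)
      (kernelSum ζ ε h (fun j => c j t) x)
    rw [abs_sub_comm] at e1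
    rw [Real.norm_eq_abs, abs_sub_comm] at e2
    have e4 : C₁ * (ε ^ k * M + (h / ε) ^ l * M) ≤ C₁ * M * (E⁻¹ * δ) := by
      rw [← add_mul, mul_comm _ M, ← mul_assoc]
      exact mul_le_mul_of_nonneg_left (hδ1.trans hδE) hCM
    rw [add_mul, add_mul]
    linarith [mul_nonneg hCk (hδ0.trans hδE)]
  -- Away from the grid points the oddness argument is unavailable and the term of order zero stays
  -- in the quadrature error; it accounts for the additional `1 / ε` in the `h`-term.
  · have e1 := h₂ ε h hh hhε (ρ t) hut M (hbd (k + 1) hr t ht) x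
    have e2 := norm_kernelSum_le_of_sumSq_le hR (gradient_eq_zero h0) hK₂ hh hhε hfin hC₀ hE0 hE
      (by positivity) hsum x
    rw [kernelSum_sub (gradient_eq_zero h0) hε0 hh] at e2
    rw [(hasGradientAt_quasiInterpolant hd h0 hε0 hh _ _).gradient]
    have e3 := norm_sub_le_norm_sub_add_norm_sub (gradient (ρ t) x)
      (ε⁻¹ • kernelSum (gradient ζ) ε h (fun j => ρ t (gridPoint h j)) x)
      (ε⁻¹ • kernelSum (gradient ζ) ε h (fun j => c j t) x)
    rw [norm_sub_rev] at e1 e2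
    rw [← smul_sub, norm_smul, norm_inv, Real.norm_of_nonneg hε0.le] at e3
    have e5 : ∑ q ∈ Finset.range (k + 1), ε ^ q * ‖iteratedFDeriv ℝ q (ρ t) x‖ ≤ (k + 1) * M := by
      refine (Finset.sum_le_card_nsmul _ _ M fun q hq => ?_).trans (by simp)
      have := hbd q (by have := Finset.mem_range.1 hq; omega) t ht x
      exact (mul_le_of_le_one_left (norm_nonneg _) (pow_le_one₀ hε0.le hε1)).trans this
    have e4 : C₂ * (ε ^ k * M + (h / ε) ^ l * (ε⁻¹ * ∑ q ∈ Finset.range (k + 1),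
        ε ^ q * ‖iteratedFDeriv ℝ q (ρ t) x‖)) ≤ C₂ * ((k + 1) * M) * (ε⁻¹ * (E⁻¹ * δ)) := by
      calc _ ≤ C₂ * (ε ^ k * ((k + 1) * M) + (h / ε) ^ l * (ε⁻¹ * ((k + 1) * M))) := by
            have hk1 : M ≤ (k + 1) * M :=
              le_mul_of_one_le_left hM (by linarith [(Nat.cast_nonneg k : (0 : ℝ) ≤ k)])
            gcongr
        _ = C₂ * ((k + 1) * M) * δ := by rw [hδ]; ring
        _ ≤ _ := mul_le_mul_of_nonneg_left (hδE.trans hδε) hCk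
    have e6 : ε⁻¹ * ‖kernelSum (gradient ζ) ε h (fun j => ρ t (gridPoint h j)) x
        - kernelSum (gradient ζ) ε h (fun j => c j t) x‖ ≤ B * (ε⁻¹ * (E⁻¹ * δ)) := by
      calc _ ≤ ε⁻¹ * (B * (E⁻¹ * δ)) := by gcongr; exact e2.trans hBδ
        _ = _ := by ring
    rw [add_mul, add_mul]
    linarith [mul_nonneg hCM ((hδ0.trans hδE).trans hδε)]

end PointwiseError

/-! ### Multi-index derivatives of order at most one, and large kernel widths -/

section Derivatives

variable {n : ℕ}

lemma partialDeriv_eq_gradient {u : Rn n → ℝ} (hu : Differentiable ℝ u) (i : Fin n) (x : Rn n) :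
    partialDeriv i u x = gradient u x i := by
  rw [partialDeriv, (hu x).lineDeriv_eq_fderiv, gradient_apply]
  rfl

lemma foldr_partialDeriv (α : Fin n → ℕ) (u : Rn n → ℝ) {L : List (Fin n)}
    (h : ∀ i ∈ L, α i = 0) : L.foldr (fun i v => (partialDeriv i)^[α i] v) u = u := by
  induction L with
  | nil => rfl
  | cons a L ih =>
    rw [List.foldr_cons, ih fun i hi => h i (List.mem_cons_of_mem _ hi), h a List.mem_cons_self,
      Function.iterate_zero, id]

lemma multiDeriv_of_order_eq_zero {α : Fin n → ℕ} (hα : order α = 0) (u : Rn n → ℝ) :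
    multiDeriv α u = u :=
  foldr_partialDeriv α u fun i _ => by
    rw [order, Finset.sum_eq_zero_iff] at hα
    exact hα i (Finset.mem_univ i)

lemma exists_multiDeriv_of_order_eq_one {α : Fin n → ℕ} (hα : order α = 1) :
    ∃ i, ∀ u : Rn n → ℝ, multiDeriv α u = partialDeriv i u := by
  obtain ⟨i, hi⟩ : ∃ i, α i ≠ 0 := by
    by_contra! h
    simp [order, h] at hα
  have h1 := Finset.add_sum_erase Finset.univ α (Finset.mem_univ i)
  rw [← order, hα] at h1
  have hi1 : α i = 1 := by omega
  have h0 : ∀ q, q ≠ i → α q = 0 := fun q hq =>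
    (Finset.sum_eq_zero_iff.1 (by omega : ∑ q ∈ Finset.univ.erase i, α q = 0)) q
      (Finset.mem_erase.2 ⟨hq, Finset.mem_univ q⟩)
  refine ⟨i, fun u => ?_⟩
  obtain ⟨L₁, L₂, hL⟩ := List.append_of_mem (List.mem_finRange i)
  have hnd := List.nodup_finRange n
  rw [hL, List.nodup_middle, List.nodup_cons, List.mem_append, not_or] at hnd
  rw [multiDeriv, hL, List.foldr_append, List.foldr_cons,
    foldr_partialDeriv α u fun q hq => h0 q fun h => hnd.1.2 (h ▸ hq), hi1, Function.iterate_one,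
    foldr_partialDeriv α _ fun q hq => h0 q fun h => hnd.1.1 (h ▸ hq)]

lemma eLpNorm_multiDeriv_sub_le {u v : Rn n → ℝ} (hu : Differentiable ℝ u)
    (hv : Differentiable ℝ v) {B : ℕ → ℝ} (h0 : ∀ x, |u x - v x| ≤ B 0)
    (h1 : ∀ x, ‖gradient u x - gradient v x‖ ≤ B 1) {α : Fin n → ℕ} (hα : order α ≤ 1) :
    eLpNorm (fun x => multiDeriv α u x - multiDeriv α v x) ⊤ volume
      ≤ ENNReal.ofReal (B (order α)) := by
  rw [eLpNorm_exponent_top]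
  refine eLpNormEssSup_le_of_ae_bound (Filter.Eventually.of_forall fun x => ?_)
  rcases Nat.le_one_iff_eq_zero_or_eq_one.1 hα with h | h
  · rw [multiDeriv_of_order_eq_zero h, multiDeriv_of_order_eq_zero h, h]
    exact h0 x
  · obtain ⟨i, hi⟩ := exists_multiDeriv_of_order_eq_one h
    rw [hi, hi, h, partialDeriv_eq_gradient hu, partialDeriv_eq_gradient hv, ← PiLp.sub_apply]
    exact (PiLp.norm_apply_le _ i).trans (h1 x)

/-- The error of the scheme is bounded for kernel widths that are bounded from below. -/
lemma exists_pointwise_bound {k r s : ℕ} {ζ : Rn n → ℝ} (hζ : IsCompactKernel k s ζ)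
    (hs : s ≠ 0) (hr : 1 ≤ r) {T : ℝ} (hT : 0 < T) {f : ℝ → Rn n → ℝ → Rn n → ℝ}
    (hf : ContDiffOn ℝ 2 (fun z : ℝ × Rn n × ℝ × Rn n => f z.1 z.2.1 z.2.2.1 z.2.2.2)
      (Icc 0 T ×ˢ univ))
    (hf_supp : ∃ K : Set (Rn n × ℝ × Rn n), IsCompact K ∧
      ∀ t ∈ Icc 0 T, ∀ x u p, (x, u, p) ∉ K → f t x u p = 0)
    {ρ₀ : Rn n → ℝ} {ρ : ℝ → Rn n → ℝ} (hρ : IsTimeSpaceCc 2 r T ρ) (hpde : SolvesPDE T f ρ₀ ρ) :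
    ∃ A : ℝ, 0 ≤ A ∧ ∀ ε h : ℝ, 0 < h → h ≤ ε →
      ∀ c : (Fin n → ℤ) → ℝ → ℝ, SolvesScheme T f ρ₀ ζ ε h c → ∀ t ∈ Icc 0 T, ∀ x,
        |ρ t x - quasiInterpolant ζ ε h (fun j => c j t) x| ≤ A ∧
        ‖gradient (ρ t) x - gradient (quasiInterpolant ζ ε h fun j => c j t) x‖
          ≤ A * (1 + ε⁻¹) := by
  obtain ⟨R, hR, h0⟩ := exists_radius hζ.compact_support
  obtain ⟨M, hM, hbd⟩ := hρ.exists_bound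
  obtain ⟨K, hK, hK₁, hK₂⟩ := hζ.exists_bound hs h0
  have hd : Differentiable ℝ ζ := hζ.smooth.differentiable (by exact_mod_cast hs)
  obtain ⟨Kf, hKf, hf0⟩ := hf_supp
  obtain ⟨L, hL, hfL, -⟩ := exists_nonlinearity_bound hT hf hKf
    fun t ht z hz => hf0 t ht z.1 z.2.1 z.2.2 hz
  have hval : ∀ t ∈ Icc 0 T, ∀ x, |ρ t x| ≤ M := fun t ht x => by
    simpa using hbd 0 (Nat.zero_le _) t ht x
  set X := (2 * R + 1) ^ n * (K * (M + L * T)) with hX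
  have hX0 : 0 ≤ X := by positivity
  refine ⟨M + X, by positivity, fun ε h hh hε c hc t ht x => ?_⟩
  have hε0 : 0 < ε := hh.trans_le hε
  have hcb : ∀ j, |c j t| ≤ M + L * T := fun j => by
    have h1 := hc.abs_sub_initial_le (i := j) (L := L)
      (fun τ hτ u p => hfL τ hτ (gridPoint h j, u, p)) ht
    have h2 := hval 0 ⟨le_rfl, hT.le⟩ (gridPoint h j)
    rw [hpde.initial] at h2
    have h3 := abs_sub_abs_le_abs_sub (c j t) (ρ₀ (gridPoint h j))
    have h4 : L * t ≤ L * T := by gcongr; exact ht.2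
    linarith
  constructor
  · have h1 := norm_kernelSum_le (by linarith) h0 hK₁ hh hε hcb x
    rw [quasiInterpolant_eq_kernelSum]
    exact (abs_sub _ _).trans (add_le_add (hval t ht x) h1)
  · have h1 := norm_kernelSum_le (by linarith) (gradient_eq_zero h0) hK₂ hh hε hcb x
    rw [(hasGradientAt_quasiInterpolant hd h0 hε0 hh _ _).gradient]
    have h2 : ‖gradient (ρ t) x‖ ≤ M := by
      rw [gradient, LinearIsometryEquiv.norm_map, ← norm_iteratedFDeriv_one]
      exact hbd 1 hr t ht x
    refine (norm_sub_le _ _).trans ?_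
    rw [norm_smul, norm_inv, Real.norm_of_nonneg hε0.le]
    have h3 : ε⁻¹ * ‖kernelSum (gradient ζ) ε h (fun j => c j t) x‖ ≤ ε⁻¹ * X := by gcongr
    have h4 : 0 ≤ M * ε⁻¹ := by positivity
    linarith

end Derivatives

/-! ### Real powers of the kernel width -/

section PowerEstimates

lemma pow_le_of_le_rpow {h ε a : ℝ} {l : ℕ} (hl : l ≠ 0) (hh : 0 ≤ h) (hε : 0 < ε)
    (hle : h ≤ ε ^ (1 + a / (l : ℝ))) : h ^ l ≤ ε ^ l * ε ^ a := by
  have hl' : (l : ℝ) ≠ 0 := by exact_mod_cast hl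
  calc h ^ l ≤ (ε ^ (1 + a / (l : ℝ))) ^ l := by gcongr
    _ = ε ^ l * ε ^ a := by
      rw [← Real.rpow_mul_natCast hε.le, ← Real.rpow_natCast ε l, ← Real.rpow_add hε]
      congr 1
      field_simp

/-- For `ε` bounded from below, a power with exponent at least one dominates `1 + ε`. This absorbs
the crude bound for large kernel widths, uniformly as `ε` grows. -/
lemma exists_rpow_lower_bound {ε₀ A κ : ℝ} (hε₀ : 0 < ε₀) (hε₀1 : ε₀ ≤ 1) (hA : 0 ≤ A)
    (hκ : 1 ≤ κ) : ∃ C : ℝ, 0 ≤ C ∧ ∀ ε, ε₀ ≤ ε → A * (1 + ε) ≤ C * ε ^ κ := by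
  refine ⟨2 * A * (ε₀ ^ κ)⁻¹, by positivity, fun ε hε => ?_⟩
  have hε0 : 0 < ε := hε₀.trans_le hε
  have h1 : 1 ≤ ε / ε₀ := (one_le_div hε₀).2 hε
  have h2 : ε ≤ ε / ε₀ := le_div_self hε0.le hε₀ hε₀1
  have h3 : ε / ε₀ ≤ (ε / ε₀) ^ κ := Real.self_le_rpow_of_one_le h1 hκ
  calc A * (1 + ε) ≤ A * ((ε / ε₀) ^ κ + (ε / ε₀) ^ κ) := by gcongr <;> linarith
    _ = 2 * A * (ε₀ ^ κ)⁻¹ * ε ^ κ := by rw [Real.div_rpow hε0.le hε₀.le]; ring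

end PowerEstimates

end KernelScheme

end

/-! ### The error estimate -/

open KernelScheme in
theorem theorem2p2 (n : ℕ) (hn : 1 ≤ n) (T : ℝ) (hT : 0 < T) (k ℓ r s : ℕ)
    (hr : max (k + 1) ℓ ≤ r) (hk : 2 + (n : ℝ) / 2 ≤ (k : ℝ)) (hsℓ : ℓ < s) (hℓn : n < ℓ)
    (f : ℝ → KernelScheme.Rn n → ℝ → KernelScheme.Rn n → ℝ)
    (hf : ContDiffOn ℝ 2
      (fun z : ℝ × KernelScheme.Rn n × ℝ × KernelScheme.Rn n => f z.1 z.2.1 z.2.2.1 z.2.2.2)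
      (Set.Icc 0 T ×ˢ Set.univ))
    (hf_supp : ∃ K : Set (KernelScheme.Rn n × ℝ × KernelScheme.Rn n), IsCompact K ∧
      ∀ t ∈ Set.Icc 0 T, ∀ x u p, (x, u, p) ∉ K → f t x u p = 0)
    (ρ₀ : KernelScheme.Rn n → ℝ) (hρ₀ : ContDiff ℝ r ρ₀) (hρ₀_supp : HasCompactSupport ρ₀)
    (ρ : ℝ → KernelScheme.Rn n → ℝ) (hρ : KernelScheme.IsTimeSpaceCc 2 r T ρ)
    (hpde : KernelScheme.SolvesPDE T f ρ₀ ρ)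
    (ζ : KernelScheme.Rn n → ℝ) (hζ : KernelScheme.IsCompactKernel k s ζ)
    (hζ_even : ∀ x, ζ (-x) = ζ x) :
    ∃ C : ℝ, 0 < C ∧ ∀ ε h : ℝ, 0 < h → h ≤ ε →
      h ≤ ε ^ (1 + (3 + (n : ℝ) / 2) / (ℓ : ℝ)) →
      ∀ c : (Fin n → ℤ) → ℝ → ℝ, KernelScheme.SolvesScheme T f ρ₀ ζ ε h c →
      ∀ α : Fin n → ℕ, KernelScheme.order α ≤ 1 → ∀ t ∈ Set.Icc 0 T,
        MeasureTheory.eLpNorm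
            (fun x => KernelScheme.multiDeriv α (ρ t) x -
              KernelScheme.multiDeriv α
                (KernelScheme.quasiInterpolant ζ ε h (fun j => c j t)) x)
            ⊤ MeasureTheory.volume
          ≤ ENNReal.ofReal (C * ε ^ (-(KernelScheme.order α : ℝ) - (n : ℝ) / 2) *
              (ε ^ k + h ^ ℓ / ε ^ (ℓ + 1))) ∧
        (h ≤ ε ^ (1 + ((k : ℝ) + 1) / (ℓ : ℝ)) →
          MeasureTheory.eLpNorm
              (fun x => KernelScheme.multiDeriv α (ρ t) x -
                KernelScheme.multiDeriv α
                  (KernelScheme.quasiInterpolant ζ ε h (fun j => c j t)) x)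
              ⊤ MeasureTheory.volume
            ≤ ENNReal.ofReal (C * ε ^ ((k : ℝ) - (KernelScheme.order α : ℝ) - (n : ℝ) / 2))) := by
  have hs : ℓ + 1 ≤ s := hsℓ
  have hl : 1 ≤ ℓ := by omega
  have hr1 : k + 1 ≤ r := (le_max_left _ _).trans hr
  have hn0 : (0 : ℝ) ≤ (n : ℝ) / 2 := by positivity
  have hd : Differentiable ℝ ζ := hζ.smooth.differentiable (by exact_mod_cast (by omega : s ≠ 0))
  obtain ⟨R, hR, h0⟩ := exists_radius hζ.compact_support
  obtain ⟨C₁, ε₀, hC₁, hε₀, hε₀1, hsmall⟩ := exists_pointwise_bound_of_small hζ hζ_even hl hs hr1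
    hT hf hf_supp hρ hpde
  obtain ⟨A, hA, hlarge⟩ := exists_pointwise_bound hζ (by omega) (by omega) hT hf hf_supp hρ hpde
  obtain ⟨C₂, hC₂, hlow⟩ := exists_rpow_lower_bound (κ := (k : ℝ) - (n : ℝ) / 2) hε₀ hε₀1 hA
    (by linarith)
  set C := C₁ + C₂ + 1 with hC
  have hC0 : 0 < C := by positivity
  have main : ∀ ε h : ℝ, 0 < h → h ≤ ε → h ≤ ε ^ (1 + (3 + (n : ℝ) / 2) / (ℓ : ℝ)) →
      ∀ c : (Fin n → ℤ) → ℝ → ℝ, SolvesScheme T f ρ₀ ζ ε h c → ∀ α : Fin n → ℕ, order α ≤ 1 →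
      ∀ t ∈ Icc 0 T, eLpNorm (fun x => multiDeriv α (ρ t) x -
          multiDeriv α (quasiInterpolant ζ ε h (fun j => c j t)) x) ⊤ volume
        ≤ ENNReal.ofReal (C * ε ^ (-(order α : ℝ) - (n : ℝ) / 2)
          * (ε ^ k + h ^ ℓ / ε ^ (ℓ + 1))) := by
    intro ε h hh hhε hhε' c hc α hα t ht
    have hε0 : 0 < ε := hh.trans_le hhε
    set E := ε ^ ((n : ℝ) / 2) with hE
    have hE0 : 0 < E := Real.rpow_pos_of_pos hε0 _
    set δ := ε ^ k + h ^ ℓ / ε ^ (ℓ + 1) with hδ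
    have hδ0 : 0 ≤ δ := by positivity
    have hX : 0 ≤ E⁻¹ * δ := by positivity
    have e0 : ε ^ (-((0 : ℕ) : ℝ) - (n : ℝ) / 2) = E⁻¹ := by
      rw [Nat.cast_zero, neg_zero, zero_sub, Real.rpow_neg hε0.le]
    have e1 : ε ^ (-((1 : ℕ) : ℝ) - (n : ℝ) / 2) = ε⁻¹ * E⁻¹ := by
      rw [Nat.cast_one, sub_eq_add_neg, Real.rpow_add hε0, Real.rpow_neg_one,
        Real.rpow_neg hε0.le]
    have key : ∀ x, |ρ t x - quasiInterpolant ζ ε h (fun j => c j t) x| ≤ C * (E⁻¹ * δ) ∧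
        ‖gradient (ρ t) x - gradient (quasiInterpolant ζ ε h fun j => c j t) x‖
          ≤ C * (ε⁻¹ * (E⁻¹ * δ)) := by
      intro x
      -- Small widths use the energy argument; for the others the trivial bound is compared with `ε
      -- ^ (k - n/2)`, whose exponent is at least `2`.
      rcases le_or_gt ε ε₀ with hεε | hεε
      · have hε1 : ε ≤ 1 := hεε.trans hε₀1
        have hEn : E ^ 2 = ε ^ n := by
          rw [hE, ← Real.rpow_mul_natCast hε0.le, ← Real.rpow_natCast ε n]
          congr 1; push_cast; ring
        have hkE : ε ^ k ≤ ε ^ 2 * E := by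
          rw [hE, ← Real.rpow_natCast ε k, ← Real.rpow_natCast ε 2, ← Real.rpow_add hε0]
          exact Real.rpow_le_rpow_of_exponent_ge hε0 hε1 (by exact_mod_cast hk)
        have hlE : (h / ε) ^ ℓ ≤ ε ^ 3 * E := by
          have := pow_le_of_le_rpow (by omega) hh.le hε0 hhε'
          rw [div_pow, div_le_iff₀' (by positivity), hE, ← Real.rpow_natCast ε 3,
            ← Real.rpow_add hε0]
          exact_mod_cast this
        have hδ' : ε ^ k + (h / ε) ^ ℓ / ε = δ := by rw [hδ, div_pow, div_div, pow_succ]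
        have := hsmall ε h E hh hhε hεε hE0 (Real.rpow_le_one hε0.le hε1 hn0) hEn hkE hlE c hc t
          ht x
        rw [hδ'] at this
        exact ⟨this.1.trans (by gcongr; linarith), this.2.trans (by gcongr; linarith)⟩
      · have h1 := hlarge ε h hh hhε c hc t ht x
        have h2 : A * (1 + ε) ≤ C * (E⁻¹ * δ) := by
          calc A * (1 + ε) ≤ C₂ * ε ^ ((k : ℝ) - (n : ℝ) / 2) := hlow ε hεε.le
            _ = C₂ * (E⁻¹ * ε ^ k) := by
              rw [Real.rpow_sub hε0, Real.rpow_natCast, div_eq_inv_mul]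
            _ ≤ C * (E⁻¹ * δ) := by
              gcongr
              · linarith
              · exact le_add_of_nonneg_right (by positivity)
        refine ⟨h1.1.trans (le_trans ?_ h2), h1.2.trans ?_⟩
        · exact le_mul_of_one_le_right hA (by linarith)
        · calc A * (1 + ε⁻¹) = ε⁻¹ * (A * (1 + ε)) := by field_simp; ring
            _ ≤ ε⁻¹ * (C * (E⁻¹ * δ)) := by gcongr
            _ = _ := by ring
    refine eLpNorm_multiDeriv_sub_le
      (B := fun a => C * ε ^ (-(a : ℝ) - (n : ℝ) / 2) * δ)
      ((hρ.space_smooth t ht).differentiable (by exact_mod_cast (by omega : r ≠ 0)))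
      (fun x => (hasGradientAt_quasiInterpolant hd h0 hε0 hh _ x).differentiableAt)
      (fun x => ?_) (fun x => ?_) hα
    · rw [e0, mul_assoc]; exact (key x).1
    · rw [e1, mul_assoc, mul_assoc]; exact (key x).2
  -- The factor `2` serves the second estimate, where `h ^ ℓ / ε ^ (ℓ + 1)` is itself at most `ε ^
  -- k`.
  refine ⟨2 * C, by positivity, fun ε h hh hhε hhε' c hc α hα t ht => ?_⟩
  have hε0 : 0 < ε := hh.trans_le hhε
  have hmain := main ε h hh hhε hhε' c hc α hα t ht
  refine ⟨hmain.trans (ENNReal.ofReal_le_ofReal ?_), fun hhk =>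
    hmain.trans (ENNReal.ofReal_le_ofReal ?_)⟩
  · gcongr; linarith
  · have h1 : h ^ ℓ / ε ^ (ℓ + 1) ≤ ε ^ k := by
      have := pow_le_of_le_rpow (by omega) hh.le hε0 hhk
      rw [div_le_iff₀ (by positivity)]
      calc h ^ ℓ ≤ ε ^ ℓ * ε ^ ((k : ℝ) + 1) := this
        _ = ε ^ k * ε ^ (ℓ + 1) := by
          rw [Real.rpow_add hε0, Real.rpow_one, Real.rpow_natCast]; ring
    calc C * ε ^ (-(order α : ℝ) - (n : ℝ) / 2) * (ε ^ k + h ^ ℓ / ε ^ (ℓ + 1))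
        ≤ C * ε ^ (-(order α : ℝ) - (n : ℝ) / 2) * (ε ^ k + ε ^ k) := by gcongr
      _ = 2 * C * (ε ^ (k : ℝ) * ε ^ (-(order α : ℝ) - (n : ℝ) / 2)) := by
        rw [Real.rpow_natCast]; ring
      _ = _ := by rw [← Real.rpow_add hε0]; ring_nf
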